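/- Let $d\ge 1$. A configuration is a locally finite subset $\omega\subset\mathbb R^d$; the space $\Omega$ of configurations carries the $\sigma$-algebra generated by the counts $N_\Lambda(\omega)=\#(\omega\cap\Lambda)$, and $\Omega_f\subset\Omega$ is the set of finite configurations. Throughout, $\Lambda,\Lambda',\dots$ are bounded Borel sets, $\omega_\Lambda=\omega\cap\Lambda$, $\Lambda_n=[-n,n]^d$, $|\cdot|$ is Lebesgue measure, and $\pi_\Lambda$ is the law of the Poisson point process on $\Lambda$ with Lebesgue intensity. Let $\mathcal P$ be the set of stationary (translation invariant) probability measures $P$ on $\Omega$ with $E_P(N_{[0,1]^d})<\infty$, and write $P_\Lambda$ for the law of $\omega_\Lambda$ under $P$. Let $H:\Omega_f\to\mathbb R\cup\{+\infty\}$ be measurable and (i) stationary: $H(\omega+u)=H(\omega)$ for all $\omega\in\Omega_f$, $u\in\mathbb R^d$; (ii) hereditary: $H(\omega)=+\infty$ implies $H(\omega\cup\{x\})=+\infty$ for all $x\in\mathbb R^d$; (iii) non-degenerate: $H(\{0\})\ne+\infty$ and $H(\emptyset)=0$; (iv) stable: there is $A>0$ with $H(\omega)\ge -A\,\#\omega$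 for all $\omega\in\Omega_f$; (v) of finite range: there is $R\ge 0$ such that, for every $\Lambda$ and every $\omega\in\Omega$ with $\omega_{\Lambda^c}\in\Omega_\infty$, the quantity $$H_\Lambda(\omega)=H(\omega_{\Lambda'})-H(\omega_{\Lambda'\setminus\Lambda})\qquad(\infty-\infty:=0)$$ is the same for all $\Lambda'\supset\Lambda+B(0,R)$, where $B(0,R)$ is the closed ball and $\Omega_\infty$ is the set of $\omega\in\Omega$ with $H(\omega_\Lambda)<\infty$ for every $\Lambda$. Put $Z_\Lambda(\omega_{\Lambda^c})=\int e^{-H_\Lambda(\omega'_\Lambda\cup\omega_{\Lambda^c})}\,\pi_\Lambda(d\omega')$ and $f_\Lambda(\omega)=e^{-H_\Lambda(\omega)}/Z_\Lambda(\omega_{\Lambda^c})$. A probability measure $P$ on $\Omega$ is a Gibbs measure for $H$ if $P(\Omega_\infty)=1$ and, for every $\Lambda$ and every bounded measurable $g:\Omega\to\mathbb R$, $$\int g\,dP=\int\!\!\int g(\omega'_\Lambda\cup\omega_{\Lambda^c})\,f_\Lambda(\omega'_\Lambda\cup\omega_{\Lambda^c})\,\pi_\Lambda(d\omega')\,P(d\omega).$$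 Assume that for every $P\in\mathcal P$ the mean energy $$H(P)=\lim_{n\to\infty}\frac1{|\Lambda_n|}\int H(\omega_{\Lambda_n})\,P(d\omega)\in\mathbb R\cup\{+\infty\}$$ exists, and that for every Gibbs measure $P\in\mathcal P$ $$\lim_{n\to\infty}\frac1{|\Lambda_n|}\int\bigl(H_{\Lambda_n}(\omega)-H(\omega_{\Lambda_n})\bigr)\,P(d\omega)=0$$ (the integrals being defined and finite for all large $n$). Then the pressure $p_H=\lim_{n\to\infty}|\Lambda_n|^{-1}\ln Z_{\Lambda_n}(\emptyset)$ exists in $\mathbb R$; for every $P\in\mathcal P$ the specific entropy $I(P)=\lim_{n\to\infty}|\Lambda_n|^{-1}I(P_{\Lambda_n},\pi_{\Lambda_n})\in[0,+\infty]$ exists, where $I(\mu,\nu)=\int\ln\frac{d\mu}{d\nu}\,d\mu$ if $\mu\ll\nu$ and $I(\mu,\nu)=+\infty$ otherwise; and $$I(P)+H(P)\ge -p_H,$$ with equality if and only if $P$ is a Gibbs measure for $H$. -/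

import Mathlib

open MeasureTheory Filter Topology
open scoped ENNReal Pointwise

noncomputable section

namespace GibbsPP

/-- The Euclidean space `ℝ^d`. -/
abbrev Space (d : ℕ) := EuclideanSpace ℝ (Fin d)

/-- The bounded Borel subsets of `ℝ^d`. -/
abbrev Window (d : ℕ) := {Λ : Set (Space d) // MeasurableSet Λ ∧ Bornology.IsBounded Λ}

/-- The window `Λ' \ Λ`. -/
def Window.diff {d : ℕ} (Λ' Λ : Window d) : Window d :=
  ⟨Λ'.1 \ Λ.1, Λ'.2.1.diff Λ.2.1, Λ'.2.2.subset Set.sdiff_subset⟩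

/-- The closed `R`-neighbourhood of a window; for `0 ≤ R` it contains `Λ + B(0, R)`. -/
def Window.thicken {d : ℕ} (R : ℝ) (Λ : Window d) : Window d :=
  ⟨Metric.cthickening R Λ.1, Metric.isClosed_cthickening.measurableSet, Λ.2.2.cthickening⟩

/-- The cube `Λ_n = [-n, n]^d`. -/
def cube (d n : ℕ) : Window d :=
  ⟨{x | ∀ i, x i ∈ Set.Icc (-(n : ℝ)) n}, by
    constructor
    · simp only [Set.ofPred_forall]
      exact MeasurableSet.iInter fun i =>
        measurableSet_Icc.preimage (EuclideanSpace.proj (𝕜 := ℝ) i).continuous.measurable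
    · have h : {x : Space d | ∀ i, x i ∈ Set.Icc (-(n : ℝ)) n} =
          WithLp.ofLp ⁻¹' (Set.univ.pi fun _ => Set.Icc (-(n : ℝ)) n) := by
        ext x; simp [Pi.le_def, forall_and]
      rw [h]
      exact (PiLp.antilipschitzWith_ofLp 2 (fun _ : Fin d => ℝ)).isBounded_preimage
        (Bornology.IsBounded.pi fun _ => Metric.isBounded_Icc _ _)⟩

/-- The unit cube `[0, 1]^d`. -/
def unitCube (d : ℕ) : Set (Space d) := {x | ∀ i, x i ∈ Set.Icc (0 : ℝ) 1}

/-- Lebesgue measure of a window, as a real number. -/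
def vol {d : ℕ} (Λ : Window d) : ℝ := (volume Λ.1).toReal

/-- Configurations: locally finite subsets of `ℝ^d`. -/
abbrev Config (d : ℕ) :=
  {ω : Set (Space d) // ∀ Λ : Set (Space d), Bornology.IsBounded Λ → (ω ∩ Λ).Finite}

/-- The number of points `N_Λ(ω)` of `ω` in `Λ`. -/
def count {d : ℕ} (Λ : Set (Space d)) (ω : Config d) : ℕ := (ω.1 ∩ Λ).ncard

/-- The `σ`-algebra generated by the counting variables of bounded Borel sets. -/
instance instMeasurableSpaceConfig (d : ℕ) : MeasurableSpace (Config d) :=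
  ⨆ Λ : Window d, MeasurableSpace.comap (count Λ.1) ⊤

/-- Finite configurations, with the trace `σ`-algebra. -/
abbrev FinConfig (d : ℕ) := {ω : Config d // ω.1.Finite}

/-- A finite set as a finite configuration. -/
def ofFinite {d : ℕ} (s : Set (Space d)) (hs : s.Finite) : FinConfig d :=
  ⟨⟨s, fun _ _ => hs.inter_of_left _⟩, hs⟩

/-- `ω ∪ x`. -/
def FinConfig.insert {d : ℕ} (x : Space d) (ω : FinConfig d) : FinConfig d :=
  ofFinite (Insert.insert x ω.1.1) (ω.2.insert x)

/-- The configuration `ω ∩ S`. -/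
def restrict {d : ℕ} (S : Set (Space d)) (ω : Config d) : Config d :=
  ⟨ω.1 ∩ S, fun Λ hΛ => (ω.2 Λ hΛ).subset fun _ hx => ⟨hx.1.1, hx.2⟩⟩

/-- `ω_Λ = ω ∩ Λ`, as a finite configuration. -/
def finRestrict {d : ℕ} (Λ : Window d) (ω : Config d) : FinConfig d :=
  ⟨restrict Λ.1 ω, ω.2 Λ.1 Λ.2.2⟩

/-- `ω'_Λ ∪ ω_{Λᶜ}`. -/
def glue {d : ℕ} (Λ : Window d) (ω' ω : Config d) : Config d :=
  ⟨(ω'.1 ∩ Λ.1) ∪ (ω.1 ∩ Λ.1ᶜ), fun B hB => by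
    rw [Set.union_inter_distrib_right]
    exact ((restrict Λ.1 ω').2 B hB).union ((restrict Λ.1ᶜ ω).2 B hB)⟩

/-- Translation of a configuration by `u`. -/
def shift {d : ℕ} (u : Space d) (ω : Config d) : Config d :=
  ⟨(fun x => x + u) '' ω.1, fun B hB => by
    have h : (fun x => x + u) '' ω.1 ∩ B ⊆
        (fun x => x + u) '' (ω.1 ∩ (fun x => x + -u) '' B) := by
      rintro _ ⟨⟨x, hx, rfl⟩, hB⟩
      exact ⟨x, ⟨hx, x + u, hB, by simp⟩, rfl⟩
    refine ((ω.2 _ ?_).image _).subset h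
    have h2 : LipschitzWith 1 (fun x : Space d => x + -u) :=
      (isometry_add_right (-u)).lipschitz
    exact h2.isBounded_image hB⟩

/-- Translation of a finite configuration. -/
def FinConfig.shift {d : ℕ} (u : Space d) (ω : FinConfig d) : FinConfig d :=
  ⟨GibbsPP.shift u ω.1, ω.2.image _⟩

/-- The configuration consisting of the entries of a tuple. -/
def ofTuple {d k : ℕ} (x : Fin k → Space d) : Config d :=
  (ofFinite (Set.range x) (Set.finite_range x)).1

/-- The Poisson point process on `Λ` with Lebesgue intensity: the number of points is Poisson
with parameter `|Λ|` and, given that it is `k`, the points are `k` independent uniform points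
of `Λ`. Here `e^{-|Λ|} |Λ|^k / k!` times the `k`-th power of the uniform law is written as
`e^{-|Λ|} / k!` times the `k`-th power of Lebesgue measure on `Λ`. -/
def poisson {d : ℕ} (Λ : Window d) : Measure (Config d) :=
  Measure.sum fun k : ℕ =>
    (ENNReal.ofReal (Real.exp (-vol Λ)) / (k.factorial : ℝ≥0∞)) •
      (Measure.pi fun _ : Fin k => (volume : Measure (Space d)).restrict Λ.1).map ofTuple

/-- The stationary probability measures on configurations with finite intensity. -/
structure IsStationaryFI {d : ℕ} (P : Measure (Config d)) : Prop where
  prob : IsProbabilityMeasure P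
  stationary : ∀ u : Space d, P.map (shift u) = P
  intensity : ∫⁻ ω, (count (unitCube d) ω : ℝ≥0∞) ∂P < ⊤

/-- Energy functions; the value `⊥ = -∞` is excluded separately. -/
abbrev Energy (d : ℕ) := FinConfig d → EReal

/-- Invariance under translations. -/
def IsStationaryEnergy {d : ℕ} (H : Energy d) : Prop :=
  ∀ (ω : FinConfig d) (u : Space d), H ω = H (ω.shift u)

/-- Adding a point to a configuration of infinite energy gives infinite energy. -/
def IsHereditary {d : ℕ} (H : Energy d) : Prop :=
  ∀ (x : Space d) (ω : FinConfig d), H ω = ⊤ → H (ω.insert x) = ⊤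

/-- `H({0}) ≠ ∞` and `H(∅) = 0`. -/
def IsNonDegenerate {d : ℕ} (H : Energy d) : Prop :=
  H (ofFinite {0} (Set.finite_singleton 0)) ≠ ⊤ ∧ H (ofFinite ∅ Set.finite_empty) = 0

/-- `H(ω) ≥ -A N(ω)` for some `A > 0`. -/
def IsStable {d : ℕ} (H : Energy d) : Prop :=
  ∃ A : ℝ, 0 < A ∧ ∀ ω : FinConfig d, ((-(A * (ω.1.1.ncard : ℝ)) : ℝ) : EReal) ≤ H ω

/-- Subtraction on `ℝ ∪ {+∞}` with the convention `∞ - ∞ = 0`. -/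
def esub (a b : EReal) : EReal :=
  open Classical in if a = ⊤ ∧ b = ⊤ then 0 else a - b

/-- `H(ω_{Λ'}) - H(ω_{Λ' \ Λ})`. -/
def energyDiff {d : ℕ} (H : Energy d) (Λ Λ' : Window d) (ω : Config d) : EReal :=
  esub (H (finRestrict Λ' ω)) (H (finRestrict (Λ'.diff Λ) ω))

/-- The set `Ω_∞` of configurations with finite energy in every window. -/
def finiteEnergy {d : ℕ} (H : Energy d) : Set (Config d) :=
  {ω | ∀ Λ : Window d, H (finRestrict Λ ω) < ⊤}

/-- `H` has range `R`: `H(ω_{Λ'}) - H(ω_{Λ' \ Λ})` is the same for all `Λ'` containing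
`Λ + B(0, R)`. This is asked for all configurations whose part outside `Λ` has locally finite
energy. (Without that restriction the condition, together with stationarity, would rule out
the value `+∞`, because `∞ - ∞ = 0`.) -/
def HasRange {d : ℕ} (H : Energy d) (R : ℝ) : Prop :=
  ∀ (ω : Config d) (Λ Λ' Λ'' : Window d), restrict Λ.1ᶜ ω ∈ finiteEnergy H →
    Λ.1 + Metric.closedBall 0 R ⊆ Λ'.1 → Λ.1 + Metric.closedBall 0 R ⊆ Λ''.1 →
      energyDiff H Λ Λ' ω = energyDiff H Λ Λ'' ω

/-- The local energy `H_Λ(ω)` of an energy of range `R`. -/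
def localEnergy {d : ℕ} (H : Energy d) (R : ℝ) (Λ : Window d) (ω : Config d) : EReal :=
  energyDiff H Λ (Λ.thicken R) ω

/-- The partition function `Z_Λ(ω_{Λᶜ})`. -/
def partitionFn {d : ℕ} (H : Energy d) (R : ℝ) (Λ : Window d) (ω : Config d) : ℝ≥0∞ :=
  ∫⁻ ω', EReal.exp (-localEnergy H R Λ (glue Λ ω' ω)) ∂(poisson Λ)

/-- The local density `f_Λ(ω) = exp(-H_Λ(ω)) / Z_Λ(ω_{Λᶜ})`. -/
def localDensity {d : ℕ} (H : Energy d) (R : ℝ) (Λ : Window d) (ω : Config d) : ℝ≥0∞ :=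
  EReal.exp (-localEnergy H R Λ ω) / partitionFn H R Λ ω

/-- Gibbs measures: `P(Ω_∞) = 1` and the DLR equations hold in every window. -/
structure IsGibbs {d : ℕ} (H : Energy d) (R : ℝ) (P : Measure (Config d)) : Prop where
  prob : IsProbabilityMeasure P
  finite : ∀ᵐ ω ∂P, ω ∈ finiteEnergy H
  dlr : ∀ (Λ : Window d) (g : Config d → ℝ), Measurable g → (∃ C, ∀ ω, |g ω| ≤ C) →
    ∫ ω, g ω ∂P =
      ∫ ω, ∫ ω', g (glue Λ ω' ω) * (localDensity H R Λ (glue Λ ω' ω)).toReal ∂(poisson Λ) ∂P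

/-- Integral of an extended-real function: integral of the positive part minus integral of the
negative part. If both are infinite the value is `⊤ - ⊤ = ⊥`. -/
def eintegral {d : ℕ} (P : Measure (Config d)) (f : Config d → EReal) : EReal :=
  ((∫⁻ ω, (f ω).toENNReal ∂P : ℝ≥0∞) : EReal) - ((∫⁻ ω, (-f ω).toENNReal ∂P : ℝ≥0∞) : EReal)

/-- The specific entropy of `P` (limit of relative entropies per volume along the cubes)
exists and equals `I`. -/
def HasSpecificEntropy {d : ℕ} (P : Measure (Config d)) (I : EReal) : Prop :=
  Tendsto (fun n : ℕ =>
    ((InformationTheory.klDiv (P.map (restrict (cube d n).1)) (poisson (cube d n)) : ℝ≥0∞)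
      : EReal) / (vol (cube d n) : EReal)) atTop (𝓝 I)

/-- The pressure exists and equals `p`; the boundary condition is empty. -/
def HasPressure {d : ℕ} (H : Energy d) (R : ℝ) (p : ℝ) : Prop :=
  Tendsto (fun n : ℕ =>
    ENNReal.log (partitionFn H R (cube d n) (ofFinite ∅ Set.finite_empty).1) /
      (vol (cube d n) : EReal)) atTop (𝓝 (p : EReal))

/-- The mean energy of `P` exists and equals `h`. -/
def HasMeanEnergy {d : ℕ} (H : Energy d) (P : Measure (Config d)) (h : EReal) : Prop :=
  Tendsto (fun n : ℕ =>
    eintegral P (fun ω => H (finRestrict (cube d n) ω)) / (vol (cube d n) : EReal))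
      atTop (𝓝 h)

/-- The boundary term `∂H_Λ(ω) = H_Λ(ω) - H(ω_Λ)`. -/
def boundaryEnergy {d : ℕ} (H : Energy d) (R : ℝ) (Λ : Window d) (ω : Config d) : EReal :=
  esub (localEnergy H R Λ ω) (H (finRestrict Λ ω))

/-- The expected boundary term per volume vanishes in the limit. Since the limit is finite, this
includes that the boundary terms are `P`-integrable for all large `n`. -/
def HasNegligibleBoundary {d : ℕ} (H : Energy d) (R : ℝ) (P : Measure (Config d)) : Prop :=
  Tendsto (fun n : ℕ =>
    eintegral P (boundaryEnergy H R (cube d n)) / (vol (cube d n) : EReal)) atTop (𝓝 0)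

end GibbsPP

end

open GibbsPP

/-!
The Poisson law is the exponential of the commuting operators "add a point", so a function of
the points in disjoint windows integrates like a product. Two cubes separated by a gap wider than
the range do not interact; hence the logarithmic partition function is superadditive over separated
blocks, and its density along the cubes converges. For the entropy the same role is played by the
Donsker–Varadhan formula, which makes the relative entropy superadditive over disjoint blocks.

If a local function `f` is such that `exp f` has mean one under the Gibbs distribution in `Λ` with
any boundary condition, then inserting a copy of `exp f` in each of many separated blocks does not
change the partition function, and Donsker–Varadhan gives
`(number of blocks) * ∫ f dP ≤ entropy + energy + log Z`. The case without blocks is the variational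
inequality. In the case of equality the right-hand side is `o(volume)`, so `∫ f dP ≤ 0` for all
such `f`; perturbing `f = 0` in the direction of the deviation of an event from its conditional
probability shows that `P` is invariant under resampling, that is, Gibbs. Conversely, the DLR
equations bound the entropy of a Gibbs measure in a cube by minus the energy, the boundary term and
the logarithm of the partition function of a slightly smaller cube.
-/

noncomputable section

namespace GibbsPP

variable {d : ℕ}

/-! ### Configurations and windows -/

lemma Config.ext {ω ω' : Config d} (h : ∀ x, x ∈ ω.1 ↔ x ∈ ω'.1) : ω = ω' :=
  Subtype.ext (Set.ext h)

lemma finite_inter_window (ω : Config d) (Λ : Window d) : (ω.1 ∩ Λ.1).Finite := ω.2 _ Λ.2.2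

/-- The empty configuration. -/
abbrev emptyConfig (d : ℕ) : Config d := (ofFinite ∅ Set.finite_empty).1

/-- The configuration `ω ∪ {x}`; unlike `FinConfig.insert`, it accepts infinite configurations. -/
def insertPoint (x : Space d) (ω : Config d) : Config d :=
  ⟨insert x ω.1, fun B hB => ((ω.2 B hB).insert x).subset fun _ hy => hy.1.imp id (⟨·, hy.2⟩)⟩

/-- The empty window. -/
def emptyWindow (d : ℕ) : Window d := ⟨∅, MeasurableSet.empty, Bornology.isBounded_empty⟩

/-- The window `Λ ∩ S`, for a Borel set `S` that may be unbounded. -/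
def Window.inter (Λ : Window d) (S : Set (Space d)) (hS : MeasurableSet S) : Window d :=
  ⟨Λ.1 ∩ S, Λ.2.1.inter hS, Λ.2.2.subset Set.inter_subset_left⟩

/-- The union of two windows. -/
def Window.union (Λ Λ' : Window d) : Window d :=
  ⟨Λ.1 ∪ Λ'.1, Λ.2.1.union Λ'.2.1, Λ.2.2.union Λ'.2.2⟩

/-- The translate `Λ + u` of a window, matching the translate `shift u ω` of a configuration. -/
def Window.translate (u : Space d) (Λ : Window d) : Window d :=
  ⟨(fun x => x - u) ⁻¹' Λ.1, Λ.2.1.preimage (measurable_sub_const u), by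
    refine ((isometry_add_right u).lipschitz.isBounded_image Λ.2.2).subset fun x hx => ?_
    exact ⟨x - u, hx, sub_add_cancel x u⟩⟩

/-- The open ball as a window. -/
def ballWindow (x : Space d) (r : ℝ) : Window d :=
  ⟨Metric.ball x r, measurableSet_ball, Metric.isBounded_ball⟩

@[simp]
lemma mem_restrict {S : Set (Space d)} {ω : Config d} {x : Space d} :
    x ∈ (restrict S ω).1 ↔ x ∈ ω.1 ∧ x ∈ S := Iff.rfl

@[simp]
lemma mem_glue {Λ : Window d} {η ξ : Config d} {x : Space d} :
    x ∈ (glue Λ η ξ).1 ↔ (x ∈ η.1 ∧ x ∈ Λ.1) ∨ (x ∈ ξ.1 ∧ x ∉ Λ.1) := Iff.rfl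

@[simp]
lemma mem_insertPoint {x y : Space d} {ω : Config d} :
    y ∈ (insertPoint x ω).1 ↔ y = x ∨ y ∈ ω.1 := Iff.rfl

@[simp]
lemma notMem_emptyConfig (x : Space d) : x ∉ (emptyConfig d).1 := Set.notMem_empty x

@[simp]
lemma mem_shift {u x : Space d} {ω : Config d} : x ∈ (shift u ω).1 ↔ x - u ∈ ω.1 :=
  ⟨by rintro ⟨y, hy, rfl⟩; simpa using hy, fun h => ⟨x - u, h, sub_add_cancel x u⟩⟩

@[simp]
lemma Window.mem_diff {Λ Λ' : Window d} {x : Space d} :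
    x ∈ (Λ'.diff Λ).1 ↔ x ∈ Λ'.1 ∧ x ∉ Λ.1 := Iff.rfl

@[simp]
lemma Window.mem_inter {Λ : Window d} {S : Set (Space d)} {hS : MeasurableSet S} {x : Space d} :
    x ∈ (Λ.inter S hS).1 ↔ x ∈ Λ.1 ∧ x ∈ S := Iff.rfl

@[simp]
lemma Window.mem_union {Λ Λ' : Window d} {x : Space d} :
    x ∈ (Λ.union Λ').1 ↔ x ∈ Λ.1 ∨ x ∈ Λ'.1 := Iff.rfl

@[simp]
lemma Window.mem_translate {u x : Space d} {Λ : Window d} :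
    x ∈ (Λ.translate u).1 ↔ x - u ∈ Λ.1 := Iff.rfl

lemma restrict_of_subset {S : Set (Space d)} {ω : Config d} (h : ω.1 ⊆ S) : restrict S ω = ω :=
  Subtype.ext (Set.inter_eq_left.2 h)

lemma restrict_restrict_of_subset {S S' : Set (Space d)} (h : S ⊆ S') (ω : Config d) :
    restrict S (restrict S' ω) = restrict S ω :=
  Config.ext fun x => by simpa [and_assoc] using fun _ hx => h hx

lemma glue_glue (Λ : Window d) (η ζ ξ : Config d) : glue Λ η (glue Λ ζ ξ) = glue Λ η ξ :=
  Config.ext fun x => by simp only [mem_glue]; tauto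

lemma restrict_glue_of_subset {Λ : Window d} {S : Set (Space d)} (h : S ⊆ Λ.1) (η ξ : Config d) :
    restrict S (glue Λ η ξ) = restrict S η :=
  Config.ext fun x => by
    have := @h x
    simp only [mem_restrict, mem_glue]
    tauto

lemma restrict_glue_of_disjoint {Λ : Window d} {S : Set (Space d)} (h : Disjoint Λ.1 S)
    (η ξ : Config d) : restrict S (glue Λ η ξ) = restrict S ξ :=
  Config.ext fun x => by
    have : x ∈ S → x ∉ Λ.1 := fun hx => Set.disjoint_right.1 h hx
    simp only [mem_restrict, mem_glue]
    tauto

lemma restrict_compl_glue (Λ : Window d) (η ξ : Config d) :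
    restrict Λ.1ᶜ (glue Λ η ξ) = restrict Λ.1ᶜ ξ :=
  restrict_glue_of_disjoint disjoint_compl_right η ξ

lemma glue_restrict {Λ : Window d} {S : Set (Space d)} (h : Λ.1 ⊆ S) (η ξ : Config d) :
    glue Λ η (restrict S ξ) = restrict S (glue Λ η ξ) :=
  Config.ext fun x => by
    have := @h x
    simp only [mem_restrict, mem_glue]
    tauto

lemma glue_emptyConfig_left {Λ : Window d} {ω : Config d} (h : ω.1 ⊆ Λ.1ᶜ) :
    glue Λ (emptyConfig d) ω = ω :=
  Config.ext fun x => by simpa using fun hx => h hx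

lemma glue_emptyConfig_right {Λ : Window d} {ω : Config d} (h : ω.1 ⊆ Λ.1) :
    glue Λ ω (emptyConfig d) = ω :=
  Config.ext fun x => by simpa using fun hx => h hx

lemma insertPoint_comm (x y : Space d) (ω : Config d) :
    insertPoint x (insertPoint y ω) = insertPoint y (insertPoint x ω) :=
  Subtype.ext (Set.insert_comm x y ω.1)

lemma glue_insertPoint {Λ : Window d} {x : Space d} (hx : x ∈ Λ.1) (η ξ : Config d) :
    glue Λ (insertPoint x η) ξ = insertPoint x (glue Λ η ξ) :=
  Config.ext fun y => by
    have : y = x → y ∈ Λ.1 := fun h => h ▸ hx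
    simp only [mem_insertPoint, mem_glue]
    tauto

lemma shift_neg_shift (u : Space d) (ω : Config d) : shift (-u) (shift u ω) = ω :=
  Config.ext fun x => by simp

lemma shift_emptyConfig (u : Space d) : shift u (emptyConfig d) = emptyConfig d :=
  Config.ext fun x => by simp

lemma shift_insertPoint (u x : Space d) (ω : Config d) :
    shift u (insertPoint x ω) = insertPoint (x + u) (shift u ω) :=
  Subtype.ext Set.image_insert_eq

lemma restrict_shift_neg (u : Space d) (Λ : Window d) (ω : Config d) :
    restrict Λ.1 (shift (-u) ω) = shift (-u) (restrict (Λ.translate u).1 ω) :=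
  Config.ext fun x => by simp

lemma shift_glue_shift_neg (u : Space d) (Λ : Window d) (η ξ : Config d) :
    shift u (glue Λ η (shift (-u) ξ)) = glue (Λ.translate u) (shift u η) ξ :=
  Config.ext fun x => by simp

lemma ofTuple_cons {k : ℕ} (x : Space d) (y : Fin k → Space d) :
    ofTuple (Fin.cons x y : Fin (k + 1) → Space d) = insertPoint x (ofTuple y) :=
  Subtype.ext (Fin.range_cons x y)

lemma ofTuple_zero (x : Fin 0 → Space d) : ofTuple x = emptyConfig d :=
  Subtype.ext (Set.range_eq_empty x)

lemma isClosed_config (ω : Config d) : IsClosed ω.1 := by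
  refine isClosed_of_closure_subset fun x hx => ?_
  have hx1 : x ∈ closure (ω.1 ∩ Metric.closedBall x 1) := by
    rw [mem_closure_iff_nhds] at hx ⊢
    intro t ht
    obtain ⟨y, hy, hy'⟩ := hx _ (Filter.inter_mem ht (Metric.closedBall_mem_nhds x one_pos))
    exact ⟨y, hy.1, hy', hy.2⟩
  rw [(ω.2 _ Metric.isBounded_closedBall).isClosed.closure_eq] at hx1
  exact hx1.1

lemma subset_thicken (Λ : Window d) (R : ℝ) : Λ.1 ⊆ (Λ.thicken R).1 :=
  Metric.self_subset_cthickening _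

lemma add_closedBall_subset_thicken (Λ : Window d) (R : ℝ) :
    Λ.1 + Metric.closedBall 0 R ⊆ (Λ.thicken R).1 := by
  rintro _ ⟨a, ha, b, hb, rfl⟩
  refine Metric.mem_cthickening_of_dist_le _ a R _ ha ?_
  simpa [dist_eq_norm] using hb

lemma thicken_emptyWindow (R : ℝ) : ((emptyWindow d).thicken R).1 = ∅ :=
  Metric.cthickening_empty R

lemma exists_subset_cube (Λ : Window d) : ∃ n : ℕ, Λ.1 ⊆ (cube d n).1 := by
  obtain ⟨r, hr⟩ := Λ.2.2.subset_closedBall 0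
  obtain ⟨n, hn⟩ := exists_nat_ge r
  refine ⟨n, fun x hx i => abs_le.1 ?_⟩
  calc |x i| ≤ ‖x‖ := PiLp.norm_apply_le x i
    _ ≤ r := by simpa using hr hx
    _ ≤ n := hn

lemma cube_mono {m n : ℕ} (h : m ≤ n) : (cube d m).1 ⊆ (cube d n).1 := fun _ hx i =>
  Set.Icc_subset_Icc (neg_le_neg (Nat.cast_le.2 h)) (Nat.cast_le.2 h) (hx i)

lemma thicken_cube_subset (m r : ℕ) {R : ℝ} (hR : 0 ≤ R) (hr : R < r) :
    ((cube d m).thicken R).1 ⊆ (cube d (m + r)).1 := by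
  intro x hx i
  obtain ⟨y, hy, hxy⟩ : ∃ y ∈ (cube d m).1, x ∈ Metric.closedBall y r := by
    simpa using Metric.cthickening_subset_iUnion_closedBall_of_lt _ (hR.trans_lt hr) hr hx
  have hxyi : |x i - y i| ≤ r :=
    (PiLp.norm_apply_le (x - y) i).trans (by simpa [dist_eq_norm] using hxy)
  obtain ⟨h1, h2⟩ := abs_le.1 hxyi
  obtain ⟨h3, h4⟩ := hy i
  push_cast
  exact ⟨by linarith, by linarith⟩

/-! ### Volumes of windows -/

instance isFiniteMeasure_restrict_window (Λ : Window d) :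
    IsFiniteMeasure ((volume : Measure (Space d)).restrict Λ.1) :=
  ⟨by rw [Measure.restrict_apply_univ]; exact Λ.2.2.measure_lt_top⟩

lemma ofReal_vol (Λ : Window d) : ENNReal.ofReal (vol Λ) = volume Λ.1 :=
  ENNReal.ofReal_toReal Λ.2.2.measure_lt_top.ne

lemma vol_nonneg (Λ : Window d) : 0 ≤ vol Λ := ENNReal.toReal_nonneg

lemma vol_translate (u : Space d) (Λ : Window d) : vol (Λ.translate u) = vol Λ := by
  simp only [vol, Window.translate, sub_eq_add_neg, measure_preimage_add_right]

lemma vol_add_vol_diff {Λ Λ' : Window d} (h : Λ'.1 ⊆ Λ.1) : vol Λ' + vol (Λ.diff Λ') = vol Λ := by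
  have hsplit : volume Λ.1 = volume Λ'.1 + volume (Λ.diff Λ').1 := by
    conv_lhs => rw [← Set.union_sdiff_cancel h]
    exact measure_union disjoint_sdiff_self_right (Λ.diff Λ').2.1
  rw [vol, vol, vol, hsplit,
    ENNReal.toReal_add Λ'.2.2.measure_lt_top.ne (Λ.diff Λ').2.2.measure_lt_top.ne]

/-! ### Measurability on the space of configurations -/

lemma measurable_count (Λ : Window d) : Measurable (count Λ.1) := fun s _ =>
  le_iSup (fun Λ : Window d => MeasurableSpace.comap (count Λ.1) ⊤) Λ _ ⟨s, trivial, rfl⟩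

lemma measurable_of_count {α : Type*} [MeasurableSpace α] {f : α → Config d}
    (h : ∀ Λ : Window d, Measurable fun a => count Λ.1 (f a)) : Measurable f := by
  rw [measurable_iff_le_map]
  refine iSup_le fun Λ => ?_
  rintro _ ⟨s, -, rfl⟩
  exact h Λ (show MeasurableSet s from trivial)

lemma count_eq_zero_iff {Λ : Window d} {ω : Config d} : count Λ.1 ω = 0 ↔ Disjoint ω.1 Λ.1 := by
  rw [count, Set.ncard_eq_zero (finite_inter_window ω Λ), Set.disjoint_iff_inter_eq_empty]

lemma count_restrict {Λ : Window d} {S : Set (Space d)} (hS : MeasurableSet S) (ω : Config d) :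
    count Λ.1 (restrict S ω) = count (Λ.inter S hS).1 ω :=
  congrArg Set.ncard <| by
    ext x; simp only [Set.mem_inter_iff, mem_restrict, Window.mem_inter]; tauto

lemma count_glue (Λ B : Window d) (η ξ : Config d) :
    count B.1 (glue Λ η ξ) =
      count (B.inter Λ.1 Λ.2.1).1 η + count (B.inter Λ.1ᶜ Λ.2.1.compl).1 ξ := by
  rw [count, count, count, ← Set.ncard_union_eq _ (finite_inter_window η _)
    (finite_inter_window ξ _)]
  · congr 1
    ext x
    simp only [Set.mem_inter_iff, Set.mem_union, mem_glue, Window.mem_inter, Set.mem_compl_iff]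
    tauto
  · exact Set.disjoint_left.2 fun x hx hx' => hx'.2.2 hx.2.2

lemma count_shift (u : Space d) (Λ : Window d) (ω : Config d) :
    count Λ.1 (shift u ω) = count (Λ.translate (-u)).1 ω := by
  have h : (shift u ω).1 ∩ Λ.1 = (fun x => x + u) '' (ω.1 ∩ (Λ.translate (-u)).1) := by
    ext x
    simp only [Set.mem_inter_iff, mem_shift, Window.mem_translate, Set.mem_image, sub_neg_eq_add]
    constructor
    · exact fun hx => ⟨x - u, by simpa using hx, sub_add_cancel x u⟩
    · rintro ⟨y, hy, rfl⟩
      simpa using hy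
  rw [count, h, Set.ncard_image_of_injective _ (add_left_injective u), count]

lemma measurable_restrict {S : Set (Space d)} (hS : MeasurableSet S) : Measurable (restrict S) :=
  measurable_of_count fun Λ => by
    simpa only [count_restrict hS] using measurable_count (Λ.inter S hS)

lemma measurable_finRestrict (Λ : Window d) : Measurable (finRestrict Λ) :=
  (measurable_restrict Λ.2.1).subtype_mk

lemma measurable_glue (Λ : Window d) :
    Measurable fun z : Config d × Config d => glue Λ z.1 z.2 :=
  measurable_of_count fun B => by
    simp only [count_glue]
    exact ((measurable_count _).comp measurable_fst).add ((measurable_count _).comp measurable_snd)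

lemma measurable_glue_left (Λ : Window d) (ξ : Config d) : Measurable fun η => glue Λ η ξ :=
  (measurable_glue Λ).comp (measurable_id.prodMk measurable_const)

lemma measurable_lintegral_glue (Λ : Window d) (μ : Measure (Config d)) [SFinite μ]
    {F : Config d → ℝ≥0∞} (hF : Measurable F) :
    Measurable fun ξ => ∫⁻ η, F (glue Λ η ξ) ∂μ :=
  Measurable.lintegral_prod_right' (f := fun z : Config d × Config d => F (glue Λ z.2 z.1))
    (hF.comp ((measurable_glue Λ).comp measurable_swap))

lemma measurable_shift (u : Space d) : Measurable (shift u) :=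
  measurable_of_count fun Λ => by
    simpa only [count_shift] using measurable_count (Λ.translate (-u))

lemma mem_config_iff_forall_ball {s : Set (Space d)} (hs : Dense s) {x : Space d} {ω : Config d} :
    x ∈ ω.1 ↔ ∀ n : ℕ, ∃ q ∈ s, x ∈ Metric.ball q (1 / (n + 1 : ℝ)) ∧
      count (ballWindow q (1 / (n + 1 : ℝ))).1 ω ≠ 0 := by
  simp only [ne_eq, count_eq_zero_iff, Set.not_disjoint_iff]
  constructor
  · intro hx n
    obtain ⟨q, hq, hqx⟩ := hs.exists_dist_lt x Nat.one_div_pos_of_nat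
    exact ⟨q, hq, hqx, x, hx, hqx⟩
  · intro h
    rw [← (isClosed_config ω).closure_eq, Metric.mem_closure_iff]
    intro ε hε
    obtain ⟨n, hn⟩ := exists_nat_one_div_lt (half_pos hε)
    obtain ⟨q, -, hxq, y, hy, hyq⟩ := h n
    refine ⟨y, hy, ?_⟩
    have hxq : dist x q < 1 / (n + 1 : ℝ) := hxq
    have hyq : dist y q < 1 / (n + 1 : ℝ) := hyq
    linarith [dist_triangle_right x y q]

lemma measurableSet_mem_config : MeasurableSet {z : Space d × Config d | z.1 ∈ z.2.1} := by
  obtain ⟨s, hs, hsd⟩ := TopologicalSpace.exists_countable_dense (Space d)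
  have h : {z : Space d × Config d | z.1 ∈ z.2.1} =
      ⋂ n : ℕ, ⋃ q ∈ s, (Prod.fst ⁻¹' Metric.ball q (1 / (n + 1 : ℝ))) ∩
        (Prod.snd ⁻¹' (count (ballWindow q (1 / (n + 1 : ℝ))).1 ⁻¹' {0}ᶜ)) := by
    ext z
    simp only [Set.mem_iInter, Set.mem_iUnion, exists_prop]
    exact mem_config_iff_forall_ball hsd
  rw [h]
  refine MeasurableSet.iInter fun n => MeasurableSet.biUnion hs fun q _ => ?_
  exact (measurable_fst measurableSet_ball).inter
    (measurable_snd (measurable_count _ (measurableSet_singleton 0).compl))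

open Classical in
lemma count_insertPoint (Λ : Window d) (x : Space d) (ω : Config d) :
    count Λ.1 (insertPoint x ω) = count Λ.1 ω + if x ∈ Λ.1 ∧ x ∉ ω.1 then 1 else 0 := by
  simp only [count, insertPoint]
  split_ifs with h
  · rw [Set.insert_inter_of_mem h.1, Set.ncard_insert_of_notMem (fun h' => h.2 h'.1)
      (finite_inter_window ω Λ)]
  · rw [add_zero]
    congr 1
    ext y
    have : y = x → ¬(y ∈ Λ.1 ∧ y ∉ ω.1) := fun hy => hy ▸ h
    simp only [Set.mem_inter_iff, Set.mem_insert_iff]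
    tauto

lemma measurable_insertPoint : Measurable fun z : Space d × Config d => insertPoint z.1 z.2 := by
  classical
  refine measurable_of_count fun B => ?_
  simp only [count_insertPoint]
  exact ((measurable_count B).comp measurable_snd).add <| Measurable.ite
    ((measurable_fst B.2.1).inter measurableSet_mem_config.compl) measurable_const measurable_const

lemma measurable_ofTuple {k : ℕ} : Measurable (ofTuple : (Fin k → Space d) → Config d) := by
  induction k with
  | zero =>
    rw [funext ofTuple_zero]
    exact measurable_const
  | succ k ih =>
    have h : (ofTuple : (Fin (k + 1) → Space d) → Config d) =
        fun x => insertPoint (x 0) (ofTuple (Fin.tail x)) := by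
      funext x
      rw [← ofTuple_cons, Fin.cons_self_tail]
    rw [h]
    have htail : Measurable fun x : Fin (k + 1) → Space d => (Fin.tail x : Fin k → Space d) :=
      measurable_pi_lambda _ fun i => measurable_pi_apply i.succ
    have h' : Measurable fun x : Fin (k + 1) → Space d => ofTuple (Fin.tail x : Fin k → Space d) :=
      ih.comp htail
    have h0 : Measurable fun x : Fin (k + 1) → Space d => x 0 := measurable_pi_apply 0
    exact measurable_insertPoint.comp (h0.prodMk h')

lemma measurableSet_config_subset {S : Set (Space d)} (hS : MeasurableSet S) :
    MeasurableSet {ω : Config d | ω.1 ⊆ S} := by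
  have h : {ω : Config d | ω.1 ⊆ S} =
      ⋂ n : ℕ, count ((ballWindow 0 (n : ℝ)).inter Sᶜ hS.compl).1 ⁻¹' {0} := by
    ext ω
    simp only [Set.mem_iInter, Set.mem_preimage, Set.mem_singleton_iff, count_eq_zero_iff]
    constructor
    · exact fun h n => Set.disjoint_left.2 fun x hx hx' => hx'.2 (h hx)
    · intro h x hx
      by_contra hxS
      obtain ⟨n, hn⟩ := exists_nat_gt (dist x 0)
      exact Set.disjoint_left.1 (h n) hx ⟨hn, hxS⟩
  rw [h]
  exact MeasurableSet.iInter fun n => measurable_count _ (measurableSet_singleton 0)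

/-! ### Local functions -/

/-- `f` depends only on the points in `S`. -/
def IsLocalOn {β : Type*} (S : Set (Space d)) (f : Config d → β) : Prop :=
  ∀ ω, f (restrict S ω) = f ω

section IsLocalOn

variable {β : Type*} {S S' : Set (Space d)} {f : Config d → β}

lemma IsLocalOn.congr (hf : IsLocalOn S f) {ω ω' : Config d} (h : restrict S ω = restrict S ω') :
    f ω = f ω' := by
  rw [← hf ω, h, hf ω']

lemma IsLocalOn.mono (hf : IsLocalOn S f) (h : S ⊆ S') : IsLocalOn S' f := fun ω => by
  rw [← hf, restrict_restrict_of_subset h, hf]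

lemma IsLocalOn.comp_shift_neg {Λ : Window d} (hf : IsLocalOn Λ.1 f) (u : Space d) :
    IsLocalOn (Λ.translate u).1 fun ω => f (shift (-u) ω) := fun ω => by
  simp only [← restrict_shift_neg, hf (shift (-u) ω)]

lemma isLocalOn_comp_restrict (S : Set (Space d)) (f : Config d → β) :
    IsLocalOn S fun ω => f (restrict S ω) := fun ω => by
  simp only [restrict_restrict_of_subset subset_rfl]

end IsLocalOn

/-! ### The Poisson point process -/

/-- The weight `e^{-v} / k!` of the `k`-point configurations in `poisson Λ`, where `v = |Λ|`; the
factor `v ^ k` is carried by Lebesgue measure. -/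
def poissonWeight (v : ℝ) (k : ℕ) : ℝ≥0∞ := ENNReal.ofReal (Real.exp (-v)) / (k.factorial : ℝ≥0∞)

/-- The measurable functions on configurations, as a module on which the operators `addPoint` act
linearly. -/
def MeasurableFun (d : ℕ) : Submodule ℝ≥0∞ (Config d → ℝ≥0∞) where
  carrier := {F | Measurable F}
  add_mem' := Measurable.add
  zero_mem' := measurable_const
  smul_mem' c _ hF := hF.const_mul c

/-- A measurable function, as an element of `MeasurableFun d`. -/
def toMeasurableFun {F : Config d → ℝ≥0∞} (hF : Measurable F) : MeasurableFun d := ⟨F, hF⟩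

@[simp]
lemma coe_toMeasurableFun {F : Config d → ℝ≥0∞} (hF : Measurable F) :
    (toMeasurableFun hF).1 = F := rfl

/-- The operator that integrates over the position in `S` of an additional point. The Poisson
expectation over `Λ` is `e^{-|Λ|}` times the exponential of `addPoint Λ`, evaluated at `∅`. -/
def addPoint (S : Set (Space d)) : Module.End ℝ≥0∞ (MeasurableFun d) where
  toFun F := ⟨fun ω => ∫⁻ x in S, F.1 (insertPoint x ω),
    Measurable.lintegral_prod_right' (f := fun z : Config d × Space d => F.1 (insertPoint z.2 z.1))
      (F.2.comp (measurable_insertPoint.comp measurable_swap))⟩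
  map_add' F _ := Subtype.ext (funext fun _ => lintegral_add_left
    (F.2.comp (measurable_insertPoint.comp (measurable_id.prodMk measurable_const))) _)
  map_smul' c F := Subtype.ext (funext fun _ => lintegral_const_mul c
    (F.2.comp (measurable_insertPoint.comp (measurable_id.prodMk measurable_const))))

lemma addPoint_apply (S : Set (Space d)) (F : MeasurableFun d) (ω : Config d) :
    (addPoint S F).1 ω = ∫⁻ x in S, F.1 (insertPoint x ω) := rfl

lemma addPoint_union {S T : Set (Space d)} (hT : MeasurableSet T) (h : Disjoint S T) :
    addPoint (S ∪ T) = addPoint S + addPoint T := by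
  ext F ω
  simp only [addPoint_apply, LinearMap.add_apply, Submodule.coe_add, Pi.add_apply,
    Measure.restrict_union h hT, lintegral_add_measure]

lemma commute_addPoint (S T : Set (Space d)) : Commute (addPoint S) (addPoint T) := by
  ext F ω
  simp only [Module.End.mul_apply, addPoint_apply]
  rw [lintegral_lintegral_swap]
  · simp only [insertPoint_comm]
  · refine (F.2.comp ?_).aemeasurable
    exact measurable_insertPoint.comp (measurable_snd.prodMk
      (measurable_insertPoint.comp (measurable_fst.prodMk measurable_const)))

lemma addPoint_pow_emptyConfig (S : Set (Space d)) (k : ℕ) (F : MeasurableFun d) :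
    ((addPoint S ^ k) F).1 (emptyConfig d) =
      ∫⁻ x, F.1 (ofTuple x) ∂Measure.pi fun _ : Fin k => volume.restrict S := by
  induction k generalizing F with
  | zero => simp [ofTuple_zero]
  | succ k ih =>
    rw [pow_succ, Module.End.mul_apply, ih]
    have hmp := measurePreserving_piFinSuccAbove
      (fun _ : Fin (k + 1) => (volume : Measure (Space d)).restrict S) 0
    rw [← hmp.symm.lintegral_comp_emb (MeasurableEquiv.measurableEmbedding _), lintegral_prod_symm]
    · refine lintegral_congr fun y => ?_
      rw [addPoint_apply]
      refine lintegral_congr fun x => ?_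
      rw [← ofTuple_cons]
      simp [MeasurableEquiv.piFinSuccAbove, Fin.insertNthEquiv]
    · exact ((F.2.comp measurable_ofTuple).comp (MeasurableEquiv.measurable _)).aemeasurable

lemma addPoint_pow_glue (Λ : Window d) (k : ℕ) (F : MeasurableFun d) (η ξ : Config d) :
    ((addPoint Λ.1 ^ k) F).1 (glue Λ η ξ) =
      ((addPoint Λ.1 ^ k)
        (toMeasurableFun (F.2.comp (measurable_glue_left Λ ξ)))).1 η := by
  induction k generalizing η with
  | zero => rfl
  | succ k ih =>
    simp only [pow_succ', Module.End.mul_apply, addPoint_apply]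
    exact setLIntegral_congr_fun Λ.2.1 fun x hx => by simp only [← ih, glue_insertPoint hx]

lemma addPoint_pow_translate (u : Space d) (Λ : Window d) (k : ℕ) (F : MeasurableFun d)
    (ω : Config d) :
    ((addPoint (Λ.translate u).1 ^ k) F).1 (shift u ω) =
      ((addPoint Λ.1 ^ k) (toMeasurableFun (F.2.comp (measurable_shift u)))).1 ω := by
  induction k generalizing ω with
  | zero => rfl
  | succ k ih =>
    simp only [pow_succ', Module.End.mul_apply, addPoint_apply]
    rw [← lintegral_indicator (Λ.translate u).2.1, ← lintegral_indicator Λ.2.1,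
      ← lintegral_add_right_eq_self _ u]
    refine lintegral_congr fun x => ?_
    by_cases hx : x ∈ Λ.1
    · rw [Set.indicator_of_mem hx, Set.indicator_of_mem (by simpa using hx),
        ← shift_insertPoint, ih]
    · rw [Set.indicator_of_notMem hx, Set.indicator_of_notMem (by simpa using hx)]

lemma lintegral_poisson (Λ : Window d) {F : Config d → ℝ≥0∞} (hF : Measurable F) :
    ∫⁻ ω, F ω ∂poisson Λ =
      ∑' k : ℕ, poissonWeight (vol Λ) k *
        ((addPoint Λ.1 ^ k) (toMeasurableFun hF)).1 (emptyConfig d) := by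
  rw [poisson, lintegral_sum_measure]
  refine tsum_congr fun k => ?_
  rw [lintegral_smul_measure, lintegral_map hF measurable_ofTuple, addPoint_pow_emptyConfig,
    smul_eq_mul, poissonWeight, coe_toMeasurableFun]

lemma ae_poisson_subset (Λ : Window d) : ∀ᵐ ω ∂poisson Λ, ω.1 ⊆ Λ.1 := by
  rw [poisson, Measure.ae_sum_iff]
  refine fun k => Measure.ae_smul_measure ?_ _
  rw [ae_map_iff measurable_ofTuple.aemeasurable (measurableSet_config_subset Λ.2.1),
    ← Measure.restrict_pi_pi]
  refine (ae_restrict_mem (MeasurableSet.univ_pi fun _ => Λ.2.1)).mono fun x hx => ?_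
  rintro _ ⟨i, rfl⟩
  exact hx i trivial

lemma tsum_poissonWeight_mul {v c : ℝ} (hv : 0 ≤ v) (hc : 0 ≤ c) :
    ∑' k : ℕ, poissonWeight v k * (ENNReal.ofReal c ^ k * ENNReal.ofReal v ^ k) =
      ENNReal.ofReal (Real.exp (v * (c - 1))) := by
  have hterm (k : ℕ) : poissonWeight v k * (ENNReal.ofReal c ^ k * ENNReal.ofReal v ^ k) =
      ENNReal.ofReal (Real.exp (-v) * ((c * v) ^ k / k.factorial)) := by
    rw [poissonWeight, ← mul_pow, ← ENNReal.ofReal_mul hc, ← ENNReal.ofReal_pow (by positivity),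
      ← ENNReal.ofReal_natCast, ← ENNReal.ofReal_div_of_pos (by positivity),
      ← ENNReal.ofReal_mul (by positivity)]
    congr 1
    ring
  have hsum : HasSum (fun k : ℕ => Real.exp (-v) * ((c * v) ^ k / k.factorial))
      (Real.exp (-v) * Real.exp (c * v)) := by
    rw [Real.exp_eq_exp_ℝ]
    exact (NormedSpace.expSeries_div_hasSum_exp (c * v)).mul_left _
  simp only [hterm]
  rw [← ENNReal.ofReal_tsum_of_nonneg (fun k => by positivity) hsum.summable, hsum.tsum_eq,
    ← Real.exp_add]
  congr 2
  ring

instance isProbabilityMeasure_poisson (Λ : Window d) : IsProbabilityMeasure (poisson Λ) := by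
  constructor
  calc poisson Λ Set.univ = ∫⁻ _, 1 ∂poisson Λ := lintegral_one.symm
    _ = ∑' k : ℕ, poissonWeight (vol Λ) k *
          (ENNReal.ofReal 1 ^ k * ENNReal.ofReal (vol Λ) ^ k) := by
        rw [lintegral_poisson Λ measurable_const]
        simp [addPoint_pow_emptyConfig, Measure.pi_univ, ofReal_vol]
    _ = 1 := by
        rw [tsum_poissonWeight_mul (vol_nonneg Λ) zero_le_one]
        simp

lemma count_ofTuple_le (S : Set (Space d)) {k : ℕ} (x : Fin k → Space d) :
    count S (ofTuple x) ≤ k :=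
  calc count S (ofTuple x) ≤ (Set.range x).ncard :=
        Set.ncard_le_ncard Set.inter_subset_left (Set.finite_range x)
    _ ≤ (Set.univ : Set (Fin k)).ncard := by
        rw [← Set.image_univ]
        exact Set.ncard_image_le Set.finite_univ
    _ = k := by simp

lemma lintegral_pow_count_poisson_le (Λ : Window d) {c : ℝ} (hc : 1 ≤ c) :
    ∫⁻ ω, ENNReal.ofReal c ^ count Λ.1 ω ∂poisson Λ ≤
      ENNReal.ofReal (Real.exp (vol Λ * (c - 1))) := by
  have hm : Measurable fun ω : Config d => ENNReal.ofReal c ^ count Λ.1 ω :=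
    (measurable_from_top (f := fun k : ℕ => ENNReal.ofReal c ^ k)).comp (measurable_count Λ)
  have hc' : 1 ≤ ENNReal.ofReal c := ENNReal.one_le_ofReal.2 hc
  rw [lintegral_poisson Λ hm, ← tsum_poissonWeight_mul (vol_nonneg Λ) (zero_le_one.trans hc)]
  gcongr with k
  rw [addPoint_pow_emptyConfig]
  calc ∫⁻ x, ENNReal.ofReal c ^ count Λ.1 (ofTuple x)
        ∂(Measure.pi fun _ : Fin k => (volume : Measure (Space d)).restrict Λ.1)
      ≤ ∫⁻ _, ENNReal.ofReal c ^ k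
          ∂(Measure.pi fun _ : Fin k => (volume : Measure (Space d)).restrict Λ.1) :=
        lintegral_mono fun x => pow_le_pow_right₀ hc' (count_ofTuple_le Λ.1 x)
    _ = ENNReal.ofReal c ^ k * ENNReal.ofReal (vol Λ) ^ k := by
        simp [Measure.pi_univ, ofReal_vol]

lemma exp_neg_vol_mul_le_lintegral_poisson (Λ : Window d) {F : Config d → ℝ≥0∞}
    (hF : Measurable F) :
    ENNReal.ofReal (Real.exp (-vol Λ)) * F (emptyConfig d) ≤ ∫⁻ ω, F ω ∂poisson Λ := by
  rw [lintegral_poisson Λ hF]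
  refine le_of_eq_of_le ?_ (ENNReal.le_tsum 0)
  simp [poissonWeight]

lemma lintegral_poisson_translate (u : Space d) (Λ : Window d) {F : Config d → ℝ≥0∞}
    (hF : Measurable F) :
    ∫⁻ ω, F ω ∂poisson (Λ.translate u) = ∫⁻ ω, F (shift u ω) ∂poisson Λ := by
  rw [lintegral_poisson _ hF, vol_translate]
  refine (tsum_congr fun k => congrArg _ ?_).trans
    (lintegral_poisson Λ (hF.comp (measurable_shift u))).symm
  have h := addPoint_pow_translate u Λ k (toMeasurableFun hF) (emptyConfig d)
  rwa [shift_emptyConfig] at h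

lemma poissonWeight_add_mul_choose (v w : ℝ) (i j : ℕ) :
    poissonWeight (v + w) (i + j) * (i + j).choose i = poissonWeight v i * poissonWeight w j := by
  have hfact (n : ℕ) : (n.factorial : ℝ≥0∞) ≠ 0 := Nat.cast_ne_zero.2 n.factorial_ne_zero
  have hchoose : ((i + j).choose i : ℝ≥0∞) * (i.factorial * j.factorial) = (i + j).factorial := by
    have := Nat.add_choose_mul_factorial_mul_factorial i j
    rw [← Nat.choose_symm_add, mul_assoc] at this
    exact_mod_cast this
  have hc : ((i + j).choose i : ℝ≥0∞) ≠ 0 :=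
    Nat.cast_ne_zero.2 (Nat.choose_pos (Nat.le_add_right i j)).ne'
  simp only [poissonWeight, div_eq_mul_inv]
  rw [← hchoose, ENNReal.mul_inv (.inl hc) (.inl (ENNReal.natCast_ne_top _)),
    ENNReal.mul_inv (.inl (hfact i)) (.inl (ENNReal.natCast_ne_top _)), neg_add, Real.exp_add,
    ENNReal.ofReal_mul (Real.exp_pos _).le]
  calc _ = (((i + j).choose i : ℝ≥0∞)⁻¹ * (i + j).choose i) *
        (ENNReal.ofReal (Real.exp (-v)) * (i.factorial : ℝ≥0∞)⁻¹ *
          (ENNReal.ofReal (Real.exp (-w)) * (j.factorial : ℝ≥0∞)⁻¹)) := by ring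
    _ = _ := by rw [ENNReal.inv_mul_cancel hc (ENNReal.natCast_ne_top _), one_mul]

lemma poissonWeight_mul_add_pow_apply {f g : Module.End ℝ≥0∞ (MeasurableFun d)}
    (h : Commute f g) (v w : ℝ) (k : ℕ) (F : MeasurableFun d) (ω : Config d) :
    poissonWeight (v + w) k * (((f + g) ^ k) F).1 ω =
      ∑ m ∈ Finset.HasAntidiagonal.antidiagonal k,
        poissonWeight v m.1 * (poissonWeight w m.2 * ((f ^ m.1 * g ^ m.2) F).1 ω) := by
  rw [h.add_pow', LinearMap.sum_apply, Submodule.coe_sum, Finset.sum_apply, Finset.mul_sum]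
  refine Finset.sum_congr rfl fun ⟨i, j⟩ hm => ?_
  obtain rfl : i + j = k := by simpa using hm
  rw [← mul_assoc, ← poissonWeight_add_mul_choose, LinearMap.smul_apply, mul_assoc,
    ← Nat.cast_smul_eq_nsmul ℝ≥0∞]
  rfl

lemma tsum_tsum_eq_tsum_sum_antidiagonal (f : ℕ → ℕ → ℝ≥0∞) :
    ∑' i, ∑' j, f i j = ∑' k, ∑ m ∈ Finset.HasAntidiagonal.antidiagonal k, f m.1 m.2 := by
  rw [← ENNReal.tsum_prod, ← (Finset.HasAntidiagonal.sigmaAntidiagonalEquivProd (A := ℕ)).tsum_eq,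
    ENNReal.tsum_sigma']
  refine tsum_congr fun k => ?_
  rw [tsum_fintype, ← Finset.sum_coe_sort (Finset.HasAntidiagonal.antidiagonal k)]
  rfl

lemma lintegral_poisson_glue {Λ : Window d} {F : Config d → ℝ≥0∞} (hF : Measurable F)
    {ξ : Config d} (hξ : ξ.1 ⊆ Λ.1ᶜ) :
    ∫⁻ η, F (glue Λ η ξ) ∂poisson Λ =
      ∑' i : ℕ, poissonWeight (vol Λ) i * ((addPoint Λ.1 ^ i) (toMeasurableFun hF)).1 ξ := by
  refine (lintegral_poisson Λ (hF.comp (measurable_glue_left Λ ξ))).trans ?_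
  refine tsum_congr fun i => congrArg _ ?_
  have h := addPoint_pow_glue Λ i (toMeasurableFun hF) (emptyConfig d) ξ
  rw [glue_emptyConfig_left hξ] at h
  exact h.symm

/-- The restrictions of the Poisson point process to disjoint windows are independent: the two
exponentials of commuting operators multiply, which is the binomial theorem. -/
theorem lintegral_poisson_split {Λ Λ' : Window d} (h : Λ'.1 ⊆ Λ.1) {F : Config d → ℝ≥0∞}
    (hF : Measurable F) :
    ∫⁻ ω, F ω ∂poisson Λ =
      ∫⁻ ξ, ∫⁻ η, F (glue Λ' η ξ) ∂poisson Λ' ∂poisson (Λ.diff Λ') := by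
  set Λ'' := Λ.diff Λ'
  have hcomm : Commute (addPoint Λ'.1) (addPoint Λ''.1) := commute_addPoint _ _
  have hinner : ∀ᵐ ξ ∂poisson Λ'', ∫⁻ η, F (glue Λ' η ξ) ∂poisson Λ' =
      ∑' i : ℕ, poissonWeight (vol Λ') i * ((addPoint Λ'.1 ^ i) (toMeasurableFun hF)).1 ξ := by
    filter_upwards [ae_poisson_subset Λ''] with ξ hξ
    exact lintegral_poisson_glue hF (hξ.trans fun _ hx => hx.2)
  have houter (i : ℕ) : ∫⁻ ξ, ((addPoint Λ'.1 ^ i) (toMeasurableFun hF)).1 ξ ∂poisson Λ'' =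
      ∑' j : ℕ, poissonWeight (vol Λ'') j *
        ((addPoint Λ'.1 ^ i * addPoint Λ''.1 ^ j) (toMeasurableFun hF)).1 (emptyConfig d) := by
    rw [lintegral_poisson Λ'' ((addPoint Λ'.1 ^ i) (toMeasurableFun hF)).2]
    refine tsum_congr fun j => ?_
    rw [(hcomm.pow_pow i j).eq, Module.End.mul_apply]
    rfl
  have hunion : addPoint Λ.1 = addPoint Λ'.1 + addPoint Λ''.1 := by
    rw [← addPoint_union Λ''.2.1 disjoint_sdiff_self_right]
    exact congrArg addPoint (Set.union_sdiff_cancel h).symm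
  calc ∫⁻ ω, F ω ∂poisson Λ
      = ∑' k : ℕ, poissonWeight (vol Λ' + vol Λ'') k *
          (((addPoint Λ'.1 + addPoint Λ''.1) ^ k) (toMeasurableFun hF)).1 (emptyConfig d) := by
        rw [lintegral_poisson Λ hF, hunion, vol_add_vol_diff h]
    _ = ∑' i : ℕ, ∑' j : ℕ, poissonWeight (vol Λ') i * (poissonWeight (vol Λ'') j *
          ((addPoint Λ'.1 ^ i * addPoint Λ''.1 ^ j) (toMeasurableFun hF)).1 (emptyConfig d)) := by
        simp only [poissonWeight_mul_add_pow_apply hcomm]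
        rw [tsum_tsum_eq_tsum_sum_antidiagonal]
    _ = ∑' i : ℕ, ∫⁻ ξ, poissonWeight (vol Λ') i *
          ((addPoint Λ'.1 ^ i) (toMeasurableFun hF)).1 ξ ∂poisson Λ'' := by
        refine tsum_congr fun i => ?_
        rw [lintegral_const_mul _ ((addPoint Λ'.1 ^ i) (toMeasurableFun hF)).2, houter,
          ENNReal.tsum_mul_left]
    _ = _ := by
        rw [lintegral_congr_ae hinner, lintegral_tsum fun i =>
          (((addPoint Λ'.1 ^ i) (toMeasurableFun hF)).2.const_mul _).aemeasurable]

lemma lintegral_prod_poisson {ι : Type*} {B : ι → Window d} {W : ι → Config d → ℝ≥0∞}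
    (hB : Pairwise fun i j => Disjoint (B i).1 (B j).1) (hW : ∀ i, Measurable (W i))
    (hloc : ∀ i, IsLocalOn (B i).1 (W i)) (J : Finset ι) {Λ : Window d}
    (hΛ : ∀ i ∈ J, (B i).1 ⊆ Λ.1) :
    ∫⁻ ω, ∏ i ∈ J, W i ω ∂poisson Λ = ∏ i ∈ J, ∫⁻ ω, W i ω ∂poisson (B i) := by
  classical
  induction J using Finset.induction_on generalizing Λ with
  | empty => simp
  | insert i J hi ih =>
    have hdisj {j : ι} (hj : j ∈ J) : Disjoint (B i).1 (B j).1 := hB fun h => hi (h ▸ hj)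
    have hΛJ : ∀ j ∈ J, (B j).1 ⊆ (Λ.diff (B i)).1 := fun j hj x hx =>
      ⟨hΛ j (Finset.mem_insert_of_mem hj) hx, Set.disjoint_right.1 (hdisj hj) hx⟩
    have hprod : Measurable fun ω => ∏ j ∈ J, W j ω :=
      Finset.measurable_fun_prod _ fun j _ => hW j
    rw [lintegral_poisson_split (hΛ i (Finset.mem_insert_self i J))
      (Finset.measurable_fun_prod _ fun j _ => hW j), Finset.prod_insert hi, ← ih hΛJ,
      ← lintegral_const_mul _ hprod]
    refine lintegral_congr fun ξ => ?_
    rw [← lintegral_mul_const _ (hW i)]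
    refine lintegral_congr fun η => ?_
    rw [Finset.prod_insert hi]
    congr 1
    · exact (hloc i).congr (restrict_glue_of_subset subset_rfl η ξ)
    · exact Finset.prod_congr rfl fun j hj =>
        (hloc j).congr (restrict_glue_of_disjoint (hdisj hj) η ξ)

/-! ### Energies of finite range -/

/-- The standing assumptions on an energy of range `R`. -/
structure IsAdmissible (H : Energy d) (R : ℝ) : Prop where
  meas : Measurable H
  stat : IsStationaryEnergy H
  her : IsHereditary H
  map_empty : H (ofFinite ∅ Set.finite_empty) = 0
  stable : IsStable H
  range_nonneg : 0 ≤ R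
  range : HasRange H R

/-- The Boltzmann weight `exp(-H(ω_Λ))`. -/
def boltz (H : Energy d) (Λ : Window d) (ω : Config d) : ℝ≥0∞ :=
  EReal.exp (-H (finRestrict Λ ω))

lemma finRestrict_congr {Λ Λ' : Window d} {ω ω' : Config d}
    (h : ∀ x, (x ∈ ω.1 ∧ x ∈ Λ.1) ↔ (x ∈ ω'.1 ∧ x ∈ Λ'.1)) :
    finRestrict Λ ω = finRestrict Λ' ω' :=
  Subtype.ext (Config.ext h)

lemma measurable_energy {H : Energy d} (hH : Measurable H) (Λ : Window d) :
    Measurable fun ω => H (finRestrict Λ ω) := hH.comp (measurable_finRestrict _)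

lemma measurable_localEnergy {H : Energy d} (hH : Measurable H) (R : ℝ) (Λ : Window d) :
    Measurable (localEnergy H R Λ) := by
  have h1 := measurable_energy hH (Λ.thicken R)
  have h2 := measurable_energy hH ((Λ.thicken R).diff Λ)
  unfold localEnergy energyDiff esub
  refine Measurable.ite ?_ measurable_const ?_
  · exact (h1 (measurableSet_singleton _)).inter (h2 (measurableSet_singleton _))
  · simp only [sub_eq_add_neg]
    exact h1.add (continuous_neg.measurable.comp h2)

lemma measurable_exp_neg {α : Type*} [MeasurableSpace α] {f : α → EReal} (hf : Measurable f) :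
    Measurable fun a => EReal.exp (-f a) :=
  (continuous_neg.measurable.comp hf).ereal_exp

lemma boltz_congr (H : Energy d) {Λ Λ' : Window d} {ω ω' : Config d}
    (h : ∀ x, (x ∈ ω.1 ∧ x ∈ Λ.1) ↔ (x ∈ ω'.1 ∧ x ∈ Λ'.1)) :
    boltz H Λ ω = boltz H Λ' ω' := by
  rw [boltz, finRestrict_congr h, boltz]

lemma boltz_eq_zero_iff {H : Energy d} {Λ : Window d} {ω : Config d} :
    boltz H Λ ω = 0 ↔ H (finRestrict Λ ω) = ⊤ := by
  rw [boltz, EReal.exp_eq_zero_iff, EReal.neg_eq_bot_iff]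

namespace IsAdmissible

variable {H : Energy d} {R : ℝ}

lemma ne_bot (hH : IsAdmissible H R) (ω : FinConfig d) : H ω ≠ ⊥ := by
  obtain ⟨A, -, hA⟩ := hH.stable
  exact ((EReal.bot_lt_coe _).trans_le (hA ω)).ne'

lemma map_eq_zero (hH : IsAdmissible H R) {ω : FinConfig d} (h : ω.1.1 = ∅) : H ω = 0 := by
  rw [← hH.map_empty]
  exact congrArg H (Subtype.ext (Subtype.ext h))

lemma eq_top_of_subset (hH : IsAdmissible H R) {ω ω' : FinConfig d} (h : ω.1.1 ⊆ ω'.1.1)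
    (hω : H ω = ⊤) : H ω' = ⊤ := by
  have key (s : Set (Space d)) (hs : s.Finite) : H (ofFinite (s ∪ ω.1.1) (hs.union ω.2)) = ⊤ := by
    induction s, hs using Set.Finite.induction_on with
    | empty =>
      simp only [Set.empty_union]
      exact hω
    | @insert a s _ hs ih =>
      simp only [Set.insert_union]
      exact hH.her a _ ih
  have hω' := key ω'.1.1 ω'.2
  simp only [Set.union_eq_self_of_subset_right h] at hω'
  exact hω'

lemma lt_top_of_subset (hH : IsAdmissible H R) {ω ω' : FinConfig d} (h : ω.1.1 ⊆ ω'.1.1)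
    (hω : H ω' < ⊤) : H ω < ⊤ :=
  lt_top_iff_ne_top.2 fun h' => hω.ne (hH.eq_top_of_subset h h')

lemma finRestrict_lt_top (hH : IsAdmissible H R) {Λ Λ' : Window d} {ω ω' : Config d}
    (h : ω.1 ∩ Λ.1 ⊆ ω'.1 ∩ Λ'.1) (hω : H (finRestrict Λ' ω') < ⊤) : H (finRestrict Λ ω) < ⊤ :=
  hH.lt_top_of_subset (ω := finRestrict Λ ω) (ω' := finRestrict Λ' ω') h hω

lemma finiteEnergy_of_subset (hH : IsAdmissible H R) {ω ω' : Config d} (h : ω.1 ⊆ ω'.1)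
    (hω : ω' ∈ finiteEnergy H) : ω ∈ finiteEnergy H := fun Λ =>
  hH.finRestrict_lt_top (Set.inter_subset_inter_left _ h) (hω Λ)

lemma finiteEnergy_of_window (hH : IsAdmissible H R) {ω : Config d} {Λ : Window d}
    (h : ω.1 ⊆ Λ.1) (hω : H (finRestrict Λ ω) < ⊤) : ω ∈ finiteEnergy H := fun _ =>
  hH.finRestrict_lt_top (fun _ hx => ⟨hx.1, h hx.1⟩) hω

lemma diff_lt_top (hH : IsAdmissible H R) {Λ : Window d} {ω : Config d}
    (h : restrict Λ.1ᶜ ω ∈ finiteEnergy H) (Λ' : Window d) :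
    H (finRestrict (Λ'.diff Λ) ω) < ⊤ :=
  hH.finRestrict_lt_top (ω := ω) (ω' := restrict Λ.1ᶜ ω)
    (fun _ hx => ⟨⟨hx.1, hx.2.2⟩, hx.2.1⟩) (h Λ')

lemma mem_finiteEnergy_iff (hH : IsAdmissible H R) {ω : Config d} :
    ω ∈ finiteEnergy H ↔ ∀ n : ℕ, H (finRestrict (cube d n) ω) < ⊤ := by
  refine ⟨fun h n => h _, fun h Λ => ?_⟩
  obtain ⟨n, hn⟩ := exists_subset_cube Λ
  exact hH.finRestrict_lt_top (Set.inter_subset_inter_right _ hn) (h n)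

lemma boltz_ne_top (hH : IsAdmissible H R) (Λ : Window d) (ω : Config d) : boltz H Λ ω ≠ ⊤ := by
  rw [boltz, ne_eq, EReal.exp_eq_top_iff, EReal.neg_eq_top_iff]
  exact hH.ne_bot _

lemma measurable_boltz (hH : IsAdmissible H R) (Λ : Window d) : Measurable (boltz H Λ) :=
  measurable_exp_neg (measurable_energy hH.meas Λ)

lemma boltz_eq_one (hH : IsAdmissible H R) {Λ : Window d} {ω : Config d}
    (h : ω.1 ∩ Λ.1 = ∅) : boltz H Λ ω = 1 := by
  rw [boltz, hH.map_eq_zero h, neg_zero, EReal.exp_zero]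

lemma boltz_mul_exp (hH : IsAdmissible H R) {Λ Λ' : Window d} {ω : Config d}
    (h : H (finRestrict (Λ'.diff Λ) ω) < ⊤) :
    boltz H Λ' ω = boltz H (Λ'.diff Λ) ω * EReal.exp (-energyDiff H Λ Λ' ω) := by
  have hbot := hH.ne_bot (finRestrict (Λ'.diff Λ) ω)
  rw [boltz, boltz, energyDiff, esub, if_neg (fun h' => h.ne h'.2), ← EReal.exp_add]
  congr 1
  generalize H (finRestrict (Λ'.diff Λ) ω) = b at h hbot
  generalize H (finRestrict Λ' ω) = a
  lift b to ℝ using ⟨h.ne, hbot⟩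
  induction a with
  | bot => simp
  | top => simp
  | coe a =>
    norm_cast
    ring

lemma boltz_eq_mul (hH : IsAdmissible H R) {Λ Λ' : Window d} {ω : Config d}
    (h : restrict Λ.1ᶜ ω ∈ finiteEnergy H) (hΛ : (Λ.thicken R).1 ⊆ Λ'.1) :
    boltz H Λ' ω = boltz H (Λ'.diff Λ) ω * EReal.exp (-localEnergy H R Λ ω) := by
  rw [localEnergy, hH.range ω Λ (Λ.thicken R) Λ' h (add_closedBall_subset_thicken Λ R)
    ((add_closedBall_subset_thicken Λ R).trans hΛ)]
  exact hH.boltz_mul_exp (hH.diff_lt_top h Λ')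

lemma energyDiff_isolated (hH : IsAdmissible H R) {B Λ' : Window d} {ω : Config d}
    (h : restrict B.1ᶜ ω ∈ finiteEnergy H) (hΛ : (B.thicken R).1 ⊆ Λ'.1)
    (hiso : ω.1 ∩ (B.thicken R).1 ⊆ B.1) :
    energyDiff H B Λ' ω = H (finRestrict B ω) := by
  rw [hH.range ω B Λ' (B.thicken R) h ((add_closedBall_subset_thicken B R).trans hΛ)
    (add_closedBall_subset_thicken B R), energyDiff]
  have hinside : finRestrict (B.thicken R) ω = finRestrict B ω := finRestrict_congr fun x =>
    ⟨fun hx => ⟨hx.1, hiso hx⟩, fun hx => ⟨hx.1, subset_thicken B R hx.2⟩⟩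
  have hgap : H (finRestrict ((B.thicken R).diff B) ω) = 0 :=
    hH.map_eq_zero (Set.eq_empty_iff_forall_notMem.2 fun x hx =>
      hx.2.2 (hiso ⟨hx.1, hx.2.1⟩))
  rw [hinside, hgap, esub, if_neg (by simp), sub_zero]

lemma boltz_isolated (hH : IsAdmissible H R) {B Λ : Window d} {ω : Config d}
    (h : restrict B.1ᶜ ω ∈ finiteEnergy H) (hΛ : (B.thicken R).1 ⊆ Λ.1)
    (hiso : ω.1 ∩ (B.thicken R).1 ⊆ B.1) :
    boltz H Λ ω = boltz H (Λ.diff B) ω * boltz H B ω := by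
  rw [hH.boltz_mul_exp (hH.diff_lt_top h Λ), hH.energyDiff_isolated h hΛ hiso, boltz, boltz]

lemma boltz_glue_isolated (hH : IsAdmissible H R) {B Λ : Window d} (hB : B.1 ⊆ Λ.1)
    {η ξ : Config d} (hξ : ξ.1 ⊆ (Λ.diff (B.thicken R)).1) :
    boltz H Λ (glue B η ξ) = boltz H (Λ.diff (B.thicken R)) ξ * boltz H B η := by
  have hξB {x : Space d} (hx : x ∈ ξ.1) : x ∉ B.1 := fun hxB =>
    (hξ hx).2 (subset_thicken B R hxB)
  by_cases htop : H (finRestrict (Λ.diff (B.thicken R)) ξ) = ⊤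
  · rw [boltz_eq_zero_iff.2 htop, zero_mul, boltz_eq_zero_iff]
    exact hH.eq_top_of_subset (ω := finRestrict (Λ.diff (B.thicken R)) ξ)
      (fun x hx => ⟨Or.inr ⟨hx.1, hξB hx.1⟩, (hξ hx.1).1⟩) htop
  have hfin : restrict B.1ᶜ (glue B η ξ) ∈ finiteEnergy H := by
    rw [restrict_compl_glue]
    exact hH.finiteEnergy_of_subset Set.inter_subset_left
      (hH.finiteEnergy_of_window hξ (lt_top_iff_ne_top.2 htop))
  have hiso : (glue B η ξ).1 ∩ (B.thicken R).1 ⊆ B.1 := by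
    rintro x ⟨hx | hx, hxt⟩
    · exact hx.2
    · exact absurd hxt (hξ hx.1).2
  calc boltz H Λ (glue B η ξ) = boltz H (Λ.union (B.thicken R)) (glue B η ξ) :=
        boltz_congr H fun x => and_congr_right fun hx =>
          ⟨Or.inl, fun _ => hx.elim (fun hx => hB hx.2) fun hx => (hξ hx.1).1⟩
    _ = boltz H ((Λ.union (B.thicken R)).diff B) (glue B η ξ) * boltz H B (glue B η ξ) :=
        hH.boltz_isolated hfin Set.subset_union_right hiso
    _ = _ := by
        congr 1 <;> refine boltz_congr H fun x => ?_
        · have := @hξ x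
          have := @hξB x
          simp only [mem_glue, Window.mem_diff, Window.mem_union] at *
          tauto
        · simp only [mem_glue]
          tauto

lemma localEnergy_glue_isolated (hH : IsAdmissible H R) {B Λ : Window d}
    (hB : (B.thicken R).1 ⊆ Λ.1) {η ω : Config d} (hη : η.1 ⊆ B.1)
    (hω : restrict Λ.1ᶜ ω ∈ finiteEnergy H) :
    localEnergy H R Λ (glue Λ η ω) = H (finRestrict B η) := by
  have hBΛ : B.1 ⊆ Λ.1 := (subset_thicken B R).trans hB
  have hout : restrict B.1ᶜ (glue Λ η ω) = restrict Λ.1ᶜ ω := Config.ext fun x => by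
    have := @hη x
    have := @hBΛ x
    simp only [mem_restrict, mem_glue, Set.mem_compl_iff]
    tauto
  have hiso : (glue Λ η ω).1 ∩ (B.thicken R).1 ⊆ B.1 := by
    rintro x ⟨hx | hx, hxt⟩
    · exact hη hx.1
    · exact absurd (hB hxt) hx.2
  have hdiff : finRestrict ((Λ.thicken R).diff Λ) (glue Λ η ω) =
      finRestrict ((Λ.thicken R).diff B) (glue Λ η ω) := finRestrict_congr fun x => by
    have := @hη x
    have := @hBΛ x
    simp only [mem_glue, Window.mem_diff]
    tauto
  calc localEnergy H R Λ (glue Λ η ω) = energyDiff H B (Λ.thicken R) (glue Λ η ω) := by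
        rw [localEnergy, energyDiff, hdiff, energyDiff]
    _ = H (finRestrict B (glue Λ η ω)) :=
        hH.energyDiff_isolated (hout ▸ hω) (hB.trans (subset_thicken Λ R)) hiso
    _ = H (finRestrict B η) := congrArg H <| Subtype.ext <| restrict_glue_of_subset hBΛ η ω

lemma exists_boltz_le (hH : IsAdmissible H R) : ∃ A : ℝ, 0 < A ∧
    ∀ (Λ : Window d) (ω : Config d), boltz H Λ ω ≤ ENNReal.ofReal (Real.exp A) ^ count Λ.1 ω := by
  obtain ⟨A, hA0, hA⟩ := hH.stable
  refine ⟨A, hA0, fun Λ ω => ?_⟩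
  rw [boltz, ← ENNReal.ofReal_pow (Real.exp_pos _).le, ← Real.exp_nat_mul, ← EReal.exp_coe]
  refine EReal.exp_monotone ?_
  rw [EReal.neg_le, ← EReal.coe_neg, mul_comm]
  exact hA (finRestrict Λ ω)

end IsAdmissible

/-! ### The Donsker–Varadhan formula -/

section DonskerVaradhan

open InformationTheory

variable {α : Type*} [MeasurableSpace α] {μ ν : Measure α}

lemma integral_nonpos_of_le_sub_one [IsProbabilityMeasure μ] {Y : α → ℝ≥0∞}
    (hY : AEMeasurable Y μ) (hY1 : ∫⁻ x, Y x ∂μ ≤ 1) {u : α → ℝ} (hu : Integrable u μ)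
    (h : ∀ᵐ x ∂μ, u x ≤ (Y x).toReal - 1) : ∫ x, u x ∂μ ≤ 0 := by
  have hfin : ∫⁻ x, Y x ∂μ ≠ ⊤ := ne_top_of_le_ne_top ENNReal.one_ne_top hY1
  have hint := integrable_toReal_of_lintegral_ne_top hY hfin
  calc ∫ x, u x ∂μ ≤ ∫ x, ((Y x).toReal - 1) ∂μ :=
        integral_mono_ae hu (hint.sub (integrable_const 1)) h
    _ = (∫⁻ x, Y x ∂μ).toReal - 1 := by
        rw [integral_sub hint (integrable_const 1), integral_toReal hY (ae_lt_top' hY hfin)]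
        simp
    _ ≤ 0 := by simpa using ENNReal.toReal_mono ENNReal.one_ne_top hY1

lemma lintegral_div_mul_rnDeriv_le_one [SigmaFinite μ] [SigmaFinite ν] (hac : μ ≪ ν)
    {W : α → ℝ≥0∞} (hW : Measurable W) (hZ : ∫⁻ x, W x ∂ν ≠ 0) (hZ' : ∫⁻ x, W x ∂ν ≠ ⊤) :
    ∫⁻ x, W x / ((∫⁻ y, W y ∂ν) * μ.rnDeriv ν x) ∂μ ≤ 1 := by
  set Z := ∫⁻ y, W y ∂ν
  have hY : Measurable fun x => W x / (Z * μ.rnDeriv ν x) :=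
    hW.div ((Measure.measurable_rnDeriv μ ν).const_mul Z)
  calc ∫⁻ x, W x / (Z * μ.rnDeriv ν x) ∂μ
      = ∫⁻ x, μ.rnDeriv ν x * (W x / (Z * μ.rnDeriv ν x)) ∂ν :=
        (lintegral_rnDeriv_mul hac hY.aemeasurable).symm
    _ ≤ ∫⁻ x, W x * Z⁻¹ ∂ν := by
        refine lintegral_mono fun x => ?_
        rw [div_eq_mul_inv, ENNReal.mul_inv (Or.inl hZ) (Or.inl hZ')]
        calc μ.rnDeriv ν x * (W x * (Z⁻¹ * (μ.rnDeriv ν x)⁻¹))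
            = W x * Z⁻¹ * (μ.rnDeriv ν x * (μ.rnDeriv ν x)⁻¹) := by ring
          _ ≤ W x * Z⁻¹ := mul_le_of_le_one_right zero_le (ENNReal.mul_inv_le_one _)
    _ = 1 := by rw [lintegral_mul_const _ hW, ENNReal.mul_inv_cancel hZ hZ']

lemma log_sub_log_sub_log_le {w z f : ℝ≥0∞} (hw : w ≠ 0) (hw' : w ≠ ⊤) (hz : z ≠ 0) (hz' : z ≠ ⊤)
    (hf : f ≠ 0) (hf' : f ≠ ⊤) :
    Real.log w.toReal - Real.log z.toReal - Real.log f.toReal ≤ (w / (z * f)).toReal - 1 := by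
  have hw0 := ENNReal.toReal_pos hw hw'
  have hz0 := ENNReal.toReal_pos hz hz'
  have hf0 := ENNReal.toReal_pos hf hf'
  rw [ENNReal.toReal_div, ENNReal.toReal_mul, sub_sub, ← Real.log_mul hz0.ne' hf0.ne',
    ← Real.log_div hw0.ne' (mul_pos hz0 hf0).ne']
  exact Real.log_le_sub_one_of_pos (by positivity)

theorem integral_log_le_klDiv_add_log [IsProbabilityMeasure μ] [IsProbabilityMeasure ν]
    (hkl : klDiv μ ν ≠ ⊤) {W : α → ℝ≥0∞} (hW : Measurable W)
    (hZ : ∫⁻ x, W x ∂ν ≠ 0) (hZ' : ∫⁻ x, W x ∂ν ≠ ⊤)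
    (hWpos : ∀ᵐ x ∂μ, W x ≠ 0 ∧ W x ≠ ⊤) (hint : Integrable (fun x => Real.log (W x).toReal) μ) :
    ∫ x, Real.log (W x).toReal ∂μ ≤
      (klDiv μ ν).toReal + Real.log (∫⁻ x, W x ∂ν).toReal := by
  obtain ⟨hac, hllr⟩ := klDiv_ne_top_iff.1 hkl
  set Z := ∫⁻ x, W x ∂ν
  have hintZ : Integrable (fun x => Real.log (W x).toReal - Real.log Z.toReal) μ :=
    hint.sub (integrable_const _)
  have hnonpos : ∫ x, (Real.log (W x).toReal - Real.log Z.toReal - llr μ ν x) ∂μ ≤ 0 := by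
    refine integral_nonpos_of_le_sub_one
      (hW.div ((Measure.measurable_rnDeriv μ ν).const_mul Z)).aemeasurable
      (lintegral_div_mul_rnDeriv_le_one hac hW hZ hZ') (hintZ.sub hllr) ?_
    filter_upwards [hWpos, Measure.rnDeriv_pos hac, hac (Measure.rnDeriv_lt_top μ ν)]
      with x hx hf0 hft
    exact log_sub_log_sub_log_le hx.1 hx.2 hZ hZ' hf0.ne' hft.ne
  rw [integral_sub hintZ hllr, integral_sub hint (integrable_const _), integral_const,
    probReal_univ, one_smul] at hnonpos
  rw [toReal_klDiv_of_measure_eq hac (by simp)]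
  linarith

/-- Truncation of a density at the levels `exp (-n)` and `exp n`, which makes its logarithm
bounded. -/
def clampExp (n : ℕ) (y : ℝ) : ℝ := max (Real.exp (-n)) (min y (Real.exp n))

lemma clampExp_pos (n : ℕ) (y : ℝ) : 0 < clampExp n y := lt_max_of_lt_left (Real.exp_pos _)

lemma exp_neg_le_clampExp (n : ℕ) (y : ℝ) : Real.exp (-n) ≤ clampExp n y := le_max_left _ _

lemma clampExp_le_exp (n : ℕ) (y : ℝ) : clampExp n y ≤ Real.exp n :=
  max_le (Real.exp_le_exp.2 (by linarith [Nat.cast_nonneg (α := ℝ) n])) (min_le_right _ _)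

lemma clampExp_of_le {n : ℕ} {y : ℝ} (h : y ≤ Real.exp (-n)) : clampExp n y = Real.exp (-n) :=
  max_eq_left ((min_le_left _ _).trans h)

lemma clampExp_of_mem {n : ℕ} {y : ℝ} (h : y ∈ Set.Icc (Real.exp (-n)) (Real.exp n)) :
    clampExp n y = y := by
  rw [clampExp, min_eq_left h.2, max_eq_right h.1]

lemma clampExp_of_ge {n : ℕ} {y : ℝ} (h : Real.exp n ≤ y) : clampExp n y = Real.exp n := by
  rw [clampExp, min_eq_right h,
    max_eq_right (Real.exp_le_exp.2 (by linarith [Nat.cast_nonneg (α := ℝ) n]))]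

lemma measurable_clampExp (n : ℕ) : Measurable (clampExp n) :=
  measurable_const.max (measurable_id.min measurable_const)

lemma abs_log_clampExp_le (n : ℕ) (y : ℝ) : |Real.log (clampExp n y)| ≤ n :=
  abs_le.2 ⟨(Real.le_log_iff_exp_le (clampExp_pos n y)).2 (exp_neg_le_clampExp n y),
    (Real.log_le_iff_le_exp (clampExp_pos n y)).2 (clampExp_le_exp n y)⟩

/-- The relative entropy integrand `klFun y = y log y - y + 1` with `y` truncated in all places
but the first, where the change of measure from `ν` to `μ` needs the density itself. -/
def klFunClamp (n : ℕ) (y : ℝ) : ℝ := y * Real.log (clampExp n y) - clampExp n y + 1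

lemma measurable_klFunClamp (n : ℕ) : Measurable (klFunClamp n) :=
  ((measurable_id.mul (measurable_clampExp n).log).sub (measurable_clampExp n)).add_const 1

lemma klFunClamp_nonneg (n : ℕ) (y : ℝ) : 0 ≤ klFunClamp n y := by
  have hkl := klFun_nonneg (clampExp_pos n y).le
  suffices clampExp n y * Real.log (clampExp n y) ≤ y * Real.log (clampExp n y) by
    rw [klFun] at hkl
    rw [klFunClamp]
    linarith
  rcases le_total y (Real.exp (-n)) with h₁ | h₁
  · rw [clampExp_of_le h₁, Real.log_exp]
    nlinarith
  rcases le_total y (Real.exp n) with h₂ | h₂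
  · rw [clampExp_of_mem ⟨h₁, h₂⟩]
  · rw [clampExp_of_ge h₂, Real.log_exp]
    nlinarith

lemma tendsto_klFunClamp {y : ℝ} (hy : 0 ≤ y) :
    Tendsto (fun n => klFunClamp n y) atTop (𝓝 (klFun y)) := by
  have hexp : Tendsto (fun n : ℕ => Real.exp (-(n : ℝ))) atTop (𝓝 0) :=
    Real.tendsto_exp_neg_atTop_nhds_zero.comp tendsto_natCast_atTop_atTop
  rcases hy.eq_or_lt with rfl | hy
  · have hzero (n : ℕ) : klFunClamp n 0 = 1 - Real.exp (-n) := by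
      rw [klFunClamp, clampExp_of_le (Real.exp_pos _).le]
      ring
    simp only [hzero, klFun_zero]
    simpa using hexp.const_sub 1
  · have hlarge : ∀ᶠ n : ℕ in atTop, y ≤ Real.exp n := (Real.tendsto_exp_atTop.comp
      (tendsto_natCast_atTop_atTop (R := ℝ))).eventually_ge_atTop y
    refine tendsto_const_nhds.congr' ?_
    filter_upwards [hexp.eventually_le_const hy, hlarge] with n h₁ h₂
    rw [klFunClamp, clampExp_of_mem ⟨h₁, h₂⟩, klFun]
    ring

lemma integrable_clampExp [IsFiniteMeasure ν] {f : α → ℝ} (hf : Measurable f) (n : ℕ) :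
    Integrable (fun x => clampExp n (f x)) ν :=
  Integrable.of_bound ((measurable_clampExp n).comp hf).aestronglyMeasurable (Real.exp n)
    (ae_of_all _ fun x => by
      rw [Real.norm_eq_abs, abs_of_pos (clampExp_pos n _)]
      exact clampExp_le_exp n _)

lemma integrable_mul_log_clampExp {f : α → ℝ} (hf : Measurable f) (hint : Integrable f ν) (n : ℕ) :
    Integrable (fun x => f x * Real.log (clampExp n (f x))) ν :=
  hint.mul_bdd (c := n) ((measurable_clampExp n).comp hf).log.aestronglyMeasurable
    (ae_of_all _ fun _ => abs_log_clampExp_le n _)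

lemma integrable_klFunClamp [IsFiniteMeasure ν] {f : α → ℝ} (hf : Measurable f)
    (hint : Integrable f ν) (n : ℕ) : Integrable (fun x => klFunClamp n (f x)) ν :=
  ((integrable_mul_log_clampExp hf hint n).sub (integrable_clampExp hf n)).add
    (integrable_const 1)

lemma klDiv_le_liminf_klFunClamp [IsFiniteMeasure μ] [IsFiniteMeasure ν] (hac : μ ≪ ν) :
    klDiv μ ν ≤ liminf
      (fun n => ∫⁻ x, ENNReal.ofReal (klFunClamp n (μ.rnDeriv ν x).toReal) ∂ν) atTop := by
  have hf : Measurable fun x => (μ.rnDeriv ν x).toReal :=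
    (Measure.measurable_rnDeriv μ ν).ennreal_toReal
  rw [klDiv_eq_lintegral_klFun_of_ac hac]
  refine le_of_eq_of_le (lintegral_congr fun _ => ?_)
    (lintegral_liminf_le fun n => ((measurable_klFunClamp n).comp hf).ennreal_ofReal)
  exact ((ENNReal.continuous_ofReal.tendsto _).comp
    (tendsto_klFunClamp ENNReal.toReal_nonneg)).liminf_eq.symm

lemma integral_klFunClamp_rnDeriv [IsFiniteMeasure μ] [IsProbabilityMeasure ν] (hac : μ ≪ ν)
    (n : ℕ) :
    ∫ x, klFunClamp n (μ.rnDeriv ν x).toReal ∂ν =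
      ∫ x, Real.log (clampExp n (μ.rnDeriv ν x).toReal) ∂μ -
        ∫ x, clampExp n (μ.rnDeriv ν x).toReal ∂ν + 1 := by
  have hf : Measurable fun x => (μ.rnDeriv ν x).toReal :=
    (Measure.measurable_rnDeriv μ ν).ennreal_toReal
  have hlog := integrable_mul_log_clampExp hf Measure.integrable_toReal_rnDeriv n
  have hclamp : Integrable (fun x => clampExp n (μ.rnDeriv ν x).toReal) ν :=
    integrable_clampExp hf n
  have hchange := integral_rnDeriv_smul (μ := μ) (ν := ν) hac
    (f := fun x => Real.log (clampExp n (μ.rnDeriv ν x).toReal))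
  simp only [smul_eq_mul] at hchange
  have hdiff : Integrable (fun x => (μ.rnDeriv ν x).toReal *
      Real.log (clampExp n (μ.rnDeriv ν x).toReal) - clampExp n (μ.rnDeriv ν x).toReal) ν :=
    hlog.sub hclamp
  simp only [klFunClamp]
  rw [integral_add hdiff (integrable_const 1), integral_sub hlog hclamp, hchange]
  simp

lemma exists_bounded_of_not_ac [IsProbabilityMeasure μ] [IsProbabilityMeasure ν]
    (h : ¬ μ ≪ ν) (c : ℝ) :
    ∃ F : α → ℝ, Measurable F ∧ (∃ C, ∀ x, |F x| ≤ C) ∧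
      c ≤ ∫ x, F x ∂μ - Real.log (∫ x, Real.exp (F x) ∂ν) := by
  obtain ⟨s, hs, hν, hμ⟩ : ∃ s, MeasurableSet s ∧ ν s = 0 ∧ μ s ≠ 0 := by
    by_contra! hcon
    exact h (Measure.AbsolutelyContinuous.mk hcon)
  have hpos : 0 < μ.real s := ENNReal.toReal_pos hμ (measure_ne_top μ s)
  refine ⟨s.indicator fun _ => c / μ.real s, measurable_const.indicator hs,
    ⟨|c / μ.real s|, fun x => norm_indicator_le_norm_self (fun _ => c / μ.real s) x⟩, ?_⟩
  have hexp : ∫ x, Real.exp (s.indicator (fun _ => c / μ.real s) x) ∂ν = 1 := by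
    refine integral_eq_const ?_
    filter_upwards [measure_eq_zero_iff_ae_notMem.1 hν] with x hx
    rw [Set.indicator_of_notMem hx, Real.exp_zero]
  rw [hexp, Real.log_one, sub_zero, integral_indicator_const _ hs, smul_eq_mul,
    mul_div_cancel₀ _ hpos.ne']

lemma exists_bounded_of_lt_klDiv [IsProbabilityMeasure μ] [IsProbabilityMeasure ν] {c : ℝ}
    (hc : ENNReal.ofReal c < klDiv μ ν) :
    ∃ F : α → ℝ, Measurable F ∧ (∃ C, ∀ x, |F x| ≤ C) ∧
      c ≤ ∫ x, F x ∂μ - Real.log (∫ x, Real.exp (F x) ∂ν) := by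
  by_cases hac : μ ≪ ν
  swap
  · exact exists_bounded_of_not_ac hac c
  set f : α → ℝ := fun x => (μ.rnDeriv ν x).toReal
  have hf : Measurable f := (Measure.measurable_rnDeriv μ ν).ennreal_toReal
  obtain ⟨n, hn⟩ := (eventually_lt_of_lt_liminf
    (hc.trans_le (klDiv_le_liminf_klFunClamp hac))).exists
  rw [← ofReal_integral_eq_lintegral_ofReal
    (integrable_klFunClamp hf Measure.integrable_toReal_rnDeriv n)
    (ae_of_all _ fun x => klFunClamp_nonneg n (f x))] at hn
  have hcn : c < ∫ x, klFunClamp n (f x) ∂ν := (ENNReal.ofReal_lt_ofReal_iff'.1 hn).1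
  rw [integral_klFunClamp_rnDeriv hac] at hcn
  refine ⟨fun x => Real.log (clampExp n (f x)), ((measurable_clampExp n).comp hf).log,
    ⟨n, fun x => abs_log_clampExp_le n _⟩, ?_⟩
  have hpos : 0 < ∫ x, clampExp n (f x) ∂ν := by
    refine (Real.exp_pos (-n)).trans_le ?_
    simpa using integral_mono (μ := ν) (integrable_const (Real.exp (-n)))
      (integrable_clampExp hf n) fun x => exp_neg_le_clampExp n (f x)
  simp only [Real.exp_log (clampExp_pos _ _)]
  linarith [Real.log_le_sub_one_of_pos hpos]

theorem klDiv_le_of_forall_bounded [IsProbabilityMeasure μ] [IsProbabilityMeasure ν] {M : ℝ}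
    (h : ∀ F : α → ℝ, Measurable F → (∃ C, ∀ x, |F x| ≤ C) →
      ∫ x, F x ∂μ - Real.log (∫ x, Real.exp (F x) ∂ν) ≤ M) : klDiv μ ν ≤ ENNReal.ofReal M := by
  by_contra! hlt
  obtain ⟨c, -, hMc, hc⟩ := ENNReal.lt_iff_exists_real_btwn.1 hlt
  obtain ⟨F, hF, hb, hcF⟩ := exists_bounded_of_lt_klDiv hc
  exact ((ENNReal.ofReal_lt_ofReal_iff'.1 hMc).1.trans_le hcF).not_ge (h F hF hb)

end DonskerVaradhan

/-! ### Limits along cubes -/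

lemma tendsto_div_mul_pow (d : ℕ) {s : ℕ} (hs : 0 < s) :
    Tendsto (fun n : ℕ => (((2 * n / s : ℕ) : ℝ) / (2 * n : ℝ) * s) ^ d) atTop (𝓝 1) := by
  have hs' : (s : ℝ) ≠ 0 := by exact_mod_cast hs.ne'
  have hfloor := (tendsto_nat_floor_mul_div_atTop (R := ℝ) (a := 1 / s) (by positivity)).comp
    ((tendsto_natCast_atTop_atTop (R := ℝ)).comp
      (tendsto_id.const_mul_atTop' (r := 2) two_pos : Tendsto (fun n : ℕ => 2 * n) atTop atTop))
  have hone := (hfloor.mul_const (s : ℝ)).pow d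
  rw [one_div_mul_cancel hs', one_pow] at hone
  refine hone.congr fun n => ?_
  simp only [Function.comp_apply]
  rw [one_div_mul_eq_div, Nat.floor_div_eq_div]
  push_cast
  rfl

lemma tendsto_add_div_pow (d g : ℕ) :
    Tendsto (fun n : ℕ => ((2 * n + g : ℝ) / (2 * n)) ^ d) atTop (𝓝 1) := by
  have hone : Tendsto (fun n : ℕ => (1 + (g / 2 : ℝ) / n) ^ d) atTop (𝓝 ((1 + 0) ^ d)) :=
    ((tendsto_const_div_atTop_nhds_zero_nat _).const_add 1).pow d
  rw [add_zero, one_pow] at hone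
  refine hone.congr' ?_
  filter_upwards [eventually_gt_atTop 0] with n hn
  have : (0 : ℝ) < n := by exact_mod_cast hn
  congr 1
  field_simp

lemma ofReal_div_pow_mul {x y : ℝ} (hy : 0 < y) (d : ℕ) (c : ℝ≥0∞) :
    ENNReal.ofReal ((x / y) ^ d) * c =
      ENNReal.ofReal (x ^ d) * c / ENNReal.ofReal (y ^ d) := by
  rw [div_pow, ENNReal.ofReal_div_of_pos (by positivity)]
  simp only [div_eq_mul_inv]
  ring

lemma tendsto_ofReal_mul_of_tendsto_one {u : ℕ → ℝ} (hu : Tendsto u atTop (𝓝 1)) (c : ℝ≥0∞) :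
    Tendsto (fun n => ENNReal.ofReal (u n) * c) atTop (𝓝 c) := by
  simpa using ENNReal.Tendsto.mul_const (b := c)
    ((ENNReal.continuous_ofReal.tendsto _).comp hu) (Or.inl (by simp))

lemma le_ofReal_mul_liminf_of_block_le (d : ℕ) {s : ℕ} (hs : 0 < s) {a : ℕ → ℝ≥0∞} {c : ℝ≥0∞}
    (h : ∀ n q : ℕ, q * s ≤ 2 * n → (q : ℝ≥0∞) ^ d * c ≤ a n) :
    c ≤ ENNReal.ofReal ((s : ℝ) ^ d) *
      liminf (fun n : ℕ => a n / ENNReal.ofReal ((2 * n : ℝ) ^ d)) atTop := by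
  have : ENNReal.ofReal ((s : ℝ) ^ d) ≠ 0 := by
    rw [ne_eq, ENNReal.ofReal_eq_zero, not_le]
    positivity
  rw [← ENNReal.liminf_const_mul_of_ne_top ENNReal.ofReal_ne_top,
    ← (tendsto_ofReal_mul_of_tendsto_one (tendsto_div_mul_pow d hs) c).liminf_eq]
  refine liminf_le_liminf ?_
  filter_upwards [eventually_gt_atTop 0] with n hn
  rw [mul_pow, ENNReal.ofReal_mul (by positivity), mul_comm (ENNReal.ofReal _), mul_assoc,
    ofReal_div_pow_mul (by positivity)]
  gcongr
  rw [ENNReal.ofReal_pow (by positivity), ENNReal.ofReal_natCast]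
  exact h n _ (Nat.div_mul_le_self _ _)

theorem exists_tendsto_of_block_le (d g : ℕ) (hg : 0 < g) (a : ℕ → ℝ≥0∞)
    (h : ∀ m n q : ℕ, q * (2 * m + g) ≤ 2 * n → (q : ℝ≥0∞) ^ d * a m ≤ a n) :
    ∃ L : ℝ≥0∞, Tendsto (fun n : ℕ => a n / ENNReal.ofReal ((2 * n : ℝ) ^ d)) atTop (𝓝 L) := by
  set b : ℕ → ℝ≥0∞ := fun n => a n / ENNReal.ofReal ((2 * n : ℝ) ^ d)
  have hle (m : ℕ) : a m ≤ ENNReal.ofReal ((2 * m + g : ℝ) ^ d) * liminf b atTop := by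
    have hm := le_ofReal_mul_liminf_of_block_le d (s := 2 * m + g) (by lia) (h m)
    push_cast at hm
    exact hm
  refine ⟨liminf b atTop, tendsto_of_le_liminf_of_limsup_le le_rfl ?_⟩
  rw [← (tendsto_ofReal_mul_of_tendsto_one (tendsto_add_div_pow d g) (liminf b atTop)).limsup_eq]
  refine limsup_le_limsup ?_
  filter_upwards [eventually_gt_atTop 0] with n hn
  rw [ofReal_div_pow_mul (by positivity)]
  exact ENNReal.div_le_div_right (hle n) _

lemma vol_cube (d n : ℕ) : vol (cube d n) = (2 * n : ℝ) ^ d := by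
  have hpre : (cube d n).1 = (WithLp.ofLp : Space d → (Fin d → ℝ)) ⁻¹'
      (Set.Icc (fun _ => -(n : ℝ)) fun _ => (n : ℝ)) := by
    ext x
    simp [cube, Pi.le_def, forall_and]
  have : (0 : ℝ) ≤ n := Nat.cast_nonneg n
  rw [vol, hpre, (PiLp.volume_preserving_ofLp (Fin d)).measure_preimage
    measurableSet_Icc.nullMeasurableSet, Real.volume_Icc_pi_toReal fun _ => by linarith]
  simp only [sub_neg_eq_add, Finset.prod_const, Finset.card_univ, Fintype.card_fin]
  ring

lemma vol_cube_pos (d : ℕ) {n : ℕ} (hn : 0 < n) : 0 < vol (cube d n) := by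
  rw [vol_cube]
  positivity

/-! ### Arrays of blocks -/

/-- The centers of an array of `q ^ d` cubes of side `2 m` in `[-n, n]^d`, separated by gaps of
width `g`. -/
def blockCenter (n m g : ℕ) {q : ℕ} (z : Fin d → Fin q) : Space d :=
  WithLp.toLp 2 fun i => -(n : ℝ) + m + (z i : ℕ) * (2 * m + g)

/-- The cubes of side `2 m` around the centers `blockCenter`. -/
def block (n m g : ℕ) {q : ℕ} (z : Fin d → Fin q) : Window d :=
  (cube d m).translate (blockCenter n m g z)

lemma mem_block {n m g q : ℕ} {z : Fin d → Fin q} {x : Space d} :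
    x ∈ (block n m g z).1 ↔ ∀ i, |x i - (-(n : ℝ) + m + (z i : ℕ) * (2 * m + g))| ≤ m := by
  simp [block, Window.translate, cube, blockCenter, abs_le, sub_eq_add_neg]

lemma block_subset {n m g q : ℕ} (h : q * (2 * m + g) ≤ 2 * n) (z : Fin d → Fin q) :
    (block n m g z).1 ⊆ (cube d n).1 := by
  intro x hx i
  have hxi := abs_le.1 (mem_block.1 hx i)
  have hright : (((z i : ℕ) : ℝ) + 1) * (2 * m + g) ≤ 2 * n := by
    exact_mod_cast (Nat.mul_le_mul_right _ (z i).2).trans h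
  have hleft : (0 : ℝ) ≤ (z i : ℕ) * (2 * m + g) := by positivity
  have : (0 : ℝ) ≤ g := Nat.cast_nonneg g
  constructor <;> nlinarith

lemma exists_dist_le_of_mem_thicken {Λ : Window d} {R R' : ℝ} (hR : 0 ≤ R) (hR' : R < R')
    {x : Space d} (hx : x ∈ (Λ.thicken R).1) : ∃ y ∈ Λ.1, dist x y ≤ R' := by
  simpa only [Set.mem_iUnion, exists_prop, Metric.mem_closedBall] using
    Metric.cthickening_subset_iUnion_closedBall_of_lt Λ.1 (hR.trans_lt hR') hR' hx

lemma le_abs_sub_mul {q : ℕ} {k l : Fin q} (h : k ≠ l) {s : ℝ} (hs : 0 ≤ s) :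
    s ≤ |((k : ℕ) * s - (l : ℕ) * s : ℝ)| := by
  have hkl : ((k : ℕ) : ℤ) - ((l : ℕ) : ℤ) ≠ 0 := fun h0 => h (Fin.ext (by lia))
  have hone : (1 : ℝ) ≤ |((k : ℕ) : ℝ) - ((l : ℕ) : ℝ)| := by
    exact_mod_cast Int.one_le_abs hkl
  rw [← sub_mul, abs_mul, abs_of_nonneg hs]
  exact le_mul_of_one_le_left hs hone

lemma disjoint_thicken_block {n m g q : ℕ} {R : ℝ} (hR : 0 ≤ R) (hg : R < g)
    {z z' : Fin d → Fin q} (hz : z ≠ z') :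
    Disjoint ((block n m g z).thicken R).1 (block n m g z').1 := by
  rw [Set.disjoint_left]
  intro x hx hx'
  obtain ⟨R', hR', hRg⟩ := exists_between hg
  obtain ⟨y, hy, hxy⟩ := exists_dist_le_of_mem_thicken hR hR' hx
  obtain ⟨i, hi⟩ := Function.ne_iff.1 hz
  have hxyi : |x i - y i| ≤ R' := by
    rw [dist_eq_norm] at hxy
    exact (PiLp.norm_apply_le (x - y) i).trans hxy
  have hyi := mem_block.1 hy i
  have hxi := mem_block.1 hx' i
  have hsep := le_abs_sub_mul hi (s := 2 * m + g) (by positivity)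
  rw [abs_le] at hxyi hyi hxi
  rcases le_abs.1 hsep with h | h <;> linarith

lemma disjoint_block {n m g q : ℕ} (hg : 0 < g) {z z' : Fin d → Fin q} (hz : z ≠ z') :
    Disjoint (block n m g z).1 (block n m g z').1 :=
  (disjoint_thicken_block le_rfl (by exact_mod_cast hg) hz).mono_left (subset_thicken _ _)

/-! ### The pressure -/

lemma exp_vol_mul_lintegral_poisson_mono {Λ Λ' : Window d} (h : Λ'.1 ⊆ Λ.1)
    {F : Config d → ℝ≥0∞} (hF : Measurable F) :
    ENNReal.ofReal (Real.exp (vol Λ')) * ∫⁻ ω, F ω ∂poisson Λ' ≤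
      ENNReal.ofReal (Real.exp (vol Λ)) * ∫⁻ ω, F ω ∂poisson Λ := by
  have hempty : ∫⁻ η, F (glue Λ' η (emptyConfig d)) ∂poisson Λ' = ∫⁻ ω, F ω ∂poisson Λ' := by
    refine lintegral_congr_ae ?_
    filter_upwards [ae_poisson_subset Λ'] with ω hω
    rw [glue_emptyConfig_right hω]
  calc ENNReal.ofReal (Real.exp (vol Λ')) * ∫⁻ ω, F ω ∂poisson Λ'
      = ENNReal.ofReal (Real.exp (vol Λ)) * (ENNReal.ofReal (Real.exp (-vol (Λ.diff Λ'))) *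
          ∫⁻ η, F (glue Λ' η (emptyConfig d)) ∂poisson Λ') := by
        rw [hempty, ← mul_assoc, ← ENNReal.ofReal_mul (Real.exp_pos _).le, ← Real.exp_add,
          ← vol_add_vol_diff h, add_neg_cancel_right]
    _ ≤ ENNReal.ofReal (Real.exp (vol Λ)) *
          ∫⁻ ξ, ∫⁻ η, F (glue Λ' η ξ) ∂poisson Λ' ∂poisson (Λ.diff Λ') := by
        gcongr
        exact exp_neg_vol_mul_le_lintegral_poisson (Λ.diff Λ') (measurable_lintegral_glue _ _ hF)
    _ = ENNReal.ofReal (Real.exp (vol Λ)) * ∫⁻ ω, F ω ∂poisson Λ := by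
        rw [lintegral_poisson_split h hF]

/-- The partition function with free boundary condition, with respect to the unnormalized
Poisson process `exp(|Λ|) π_Λ`, for which the empty configuration has mass one. -/
def freeZ (H : Energy d) (Λ : Window d) : ℝ≥0∞ :=
  ENNReal.ofReal (Real.exp (vol Λ)) * ∫⁻ ω, boltz H Λ ω ∂poisson Λ

/-- The logarithm of the partition function in `Λ` with empty boundary condition. -/
def logZ (H : Energy d) (Λ : Window d) : ℝ := Real.log (∫⁻ ω, boltz H Λ ω ∂poisson Λ).toReal

lemma lintegral_boltz (H : Energy d) (Λ : Window d) :
    ∫⁻ ω, boltz H Λ ω ∂poisson Λ = ENNReal.ofReal (Real.exp (-vol Λ)) * freeZ H Λ := by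
  rw [freeZ, ← mul_assoc, ← ENNReal.ofReal_mul (Real.exp_pos _).le, ← Real.exp_add,
    neg_add_cancel, Real.exp_zero, ENNReal.ofReal_one, one_mul]

namespace IsAdmissible

variable {H : Energy d} {R : ℝ}

lemma one_le_freeZ (hH : IsAdmissible H R) (Λ : Window d) : 1 ≤ freeZ H Λ := by
  have h := exp_neg_vol_mul_le_lintegral_poisson Λ (hH.measurable_boltz Λ)
  rw [hH.boltz_eq_one (ω := emptyConfig d) (Set.empty_inter _), mul_one] at h
  calc (1 : ℝ≥0∞)
      = ENNReal.ofReal (Real.exp (vol Λ)) * ENNReal.ofReal (Real.exp (-vol Λ)) := by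
        rw [← ENNReal.ofReal_mul (Real.exp_pos _).le, ← Real.exp_add]
        simp
    _ ≤ freeZ H Λ := mul_le_mul_right h _

lemma exists_freeZ_le (hH : IsAdmissible H R) :
    ∃ C : ℝ, ∀ Λ, freeZ H Λ ≤ ENNReal.ofReal (Real.exp (vol Λ * C)) := by
  obtain ⟨A, hA0, hA⟩ := hH.exists_boltz_le
  refine ⟨Real.exp A, fun Λ => ?_⟩
  calc freeZ H Λ ≤ ENNReal.ofReal (Real.exp (vol Λ)) *
        ENNReal.ofReal (Real.exp (vol Λ * (Real.exp A - 1))) :=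
        mul_le_mul_right ((lintegral_mono (hA Λ)).trans
          (lintegral_pow_count_poisson_le Λ (Real.one_le_exp hA0.le))) _
    _ = ENNReal.ofReal (Real.exp (vol Λ * Real.exp A)) := by
        rw [← ENNReal.ofReal_mul (Real.exp_pos _).le, ← Real.exp_add]
        ring_nf

lemma freeZ_ne_top (hH : IsAdmissible H R) (Λ : Window d) : freeZ H Λ ≠ ⊤ := by
  obtain ⟨C, hC⟩ := hH.exists_freeZ_le
  exact ne_top_of_le_ne_top ENNReal.ofReal_ne_top (hC Λ)

lemma toReal_freeZ_pos (hH : IsAdmissible H R) (Λ : Window d) : 0 < (freeZ H Λ).toReal :=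
  ENNReal.toReal_pos (zero_lt_one.trans_le (hH.one_le_freeZ Λ)).ne' (hH.freeZ_ne_top Λ)

lemma boltz_translate (hH : IsAdmissible H R) (u : Space d) (Λ : Window d) (ω : Config d) :
    boltz H (Λ.translate u) (shift u ω) = boltz H Λ ω := by
  have hshift : finRestrict (Λ.translate u) (shift u ω) = (finRestrict Λ ω).shift u :=
    Subtype.ext <| Config.ext fun x => by
      change x ∈ (restrict (Λ.translate u).1 (shift u ω)).1 ↔ x ∈ (shift u (restrict Λ.1 ω)).1
      simp only [mem_restrict, mem_shift, Window.mem_translate]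
  rw [boltz, boltz, hshift, hH.stat (finRestrict Λ ω) u]

lemma freeZ_translate (hH : IsAdmissible H R) (u : Space d) (Λ : Window d) :
    freeZ H (Λ.translate u) = freeZ H Λ := by
  rw [freeZ, freeZ, vol_translate, lintegral_poisson_translate u Λ (hH.measurable_boltz _)]
  simp only [hH.boltz_translate]

lemma freeZ_mul_le (hH : IsAdmissible H R) {B Λ : Window d} (hB : B.1 ⊆ Λ.1) :
    freeZ H B * freeZ H (Λ.diff (B.thicken R)) ≤ freeZ H Λ := by
  set Λ' := Λ.diff (B.thicken R)
  have hsub : Λ'.1 ⊆ (Λ.diff B).1 := Set.sdiff_subset_sdiff_right (subset_thicken B R)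
  have hfactor : ∫⁻ ξ, ∫⁻ η, boltz H Λ (glue B η ξ) ∂poisson B ∂poisson Λ' =
      (∫⁻ ω, boltz H Λ' ω ∂poisson Λ') * ∫⁻ ω, boltz H B ω ∂poisson B := by
    rw [← lintegral_mul_const _ (hH.measurable_boltz Λ')]
    refine lintegral_congr_ae ?_
    filter_upwards [ae_poisson_subset Λ'] with ξ hξ
    rw [← lintegral_const_mul _ (hH.measurable_boltz B)]
    exact lintegral_congr fun η => hH.boltz_glue_isolated hB hξ
  calc freeZ H B * freeZ H Λ' = ENNReal.ofReal (Real.exp (vol B)) *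
        (ENNReal.ofReal (Real.exp (vol Λ')) *
          ∫⁻ ξ, ∫⁻ η, boltz H Λ (glue B η ξ) ∂poisson B ∂poisson Λ') := by
        rw [hfactor, freeZ, freeZ]
        ring
    _ ≤ ENNReal.ofReal (Real.exp (vol B)) * (ENNReal.ofReal (Real.exp (vol (Λ.diff B))) *
          ∫⁻ ξ, ∫⁻ η, boltz H Λ (glue B η ξ) ∂poisson B ∂poisson (Λ.diff B)) :=
        mul_le_mul_right (exp_vol_mul_lintegral_poisson_mono hsub
          (measurable_lintegral_glue _ _ (hH.measurable_boltz Λ))) _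
    _ = freeZ H Λ := by
        rw [← lintegral_poisson_split hB (hH.measurable_boltz Λ), ← mul_assoc,
          ← ENNReal.ofReal_mul (Real.exp_pos _).le, ← Real.exp_add, vol_add_vol_diff hB, freeZ]

lemma prod_freeZ_le (hH : IsAdmissible H R) {ι : Type*} {B : ι → Window d}
    (hB : Pairwise fun i j => Disjoint ((B i).thicken R).1 (B j).1) (J : Finset ι) {Λ : Window d}
    (hΛ : ∀ i ∈ J, (B i).1 ⊆ Λ.1) : ∏ i ∈ J, freeZ H (B i) ≤ freeZ H Λ := by
  classical
  induction J using Finset.induction_on generalizing Λ with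
  | empty => simpa using hH.one_le_freeZ Λ
  | insert i J hi ih =>
    have hJ : ∀ j ∈ J, (B j).1 ⊆ (Λ.diff ((B i).thicken R)).1 := fun j hj =>
      Set.subset_sdiff.2 ⟨hΛ j (Finset.mem_insert_of_mem hj),
        (hB (ne_of_mem_of_not_mem hj hi).symm).symm⟩
    rw [Finset.prod_insert hi]
    exact (mul_le_mul_right (ih hJ) _).trans
      (hH.freeZ_mul_le (hΛ i (Finset.mem_insert_self i J)))

lemma log_freeZ_nonneg (hH : IsAdmissible H R) (Λ : Window d) :
    0 ≤ Real.log (freeZ H Λ).toReal :=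
  Real.log_nonneg (by simpa using ENNReal.toReal_mono (hH.freeZ_ne_top Λ) (hH.one_le_freeZ Λ))

lemma log_freeZ_le_log (hH : IsAdmissible H R) {Λ : Window d} {z : ℝ≥0∞} (h : freeZ H Λ ≤ z)
    (hz : z ≠ ⊤) : Real.log (freeZ H Λ).toReal ≤ Real.log z.toReal :=
  Real.log_le_log (hH.toReal_freeZ_pos Λ) (ENNReal.toReal_mono hz h)

lemma pow_mul_log_freeZ_le (hH : IsAdmissible H R) {g : ℕ} (hg : R < g) {m n q : ℕ}
    (hq : q * (2 * m + g) ≤ 2 * n) :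
    (q : ℝ) ^ d * Real.log (freeZ H (cube d m)).toReal ≤
      Real.log (freeZ H (cube d n)).toReal := by
  have hprod := hH.prod_freeZ_le (B := fun z : Fin d → Fin q => block n m g z)
    (fun z z' hz => disjoint_thicken_block hH.range_nonneg hg hz) Finset.univ
    (fun z _ => block_subset hq z)
  simp only [block, hH.freeZ_translate, Finset.prod_const, Finset.card_univ,
    Fintype.card_pi, Fintype.card_fin] at hprod
  have hpow := ENNReal.toReal_mono (hH.freeZ_ne_top _) hprod
  rw [ENNReal.toReal_pow] at hpow
  have hlog := Real.log_le_log (pow_pos (hH.toReal_freeZ_pos _) _) hpow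
  rw [Real.log_pow] at hlog
  exact_mod_cast hlog

theorem exists_tendsto_log_freeZ (hH : IsAdmissible H R) :
    ∃ L : ℝ, Tendsto (fun n : ℕ => Real.log (freeZ H (cube d n)).toReal / vol (cube d n)) atTop
      (𝓝 L) := by
  obtain ⟨g, hg⟩ := exists_nat_gt R
  have hg0 : 0 < g := by exact_mod_cast hH.range_nonneg.trans_lt hg
  obtain ⟨L, hL⟩ := exists_tendsto_of_block_le d g hg0
    (fun n => ENNReal.ofReal (Real.log (freeZ H (cube d n)).toReal)) fun m n q hq => by
      rw [← ENNReal.ofReal_natCast, ← ENNReal.ofReal_pow (Nat.cast_nonneg q),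
        ← ENNReal.ofReal_mul (by positivity)]
      exact ENNReal.ofReal_le_ofReal (hH.pow_mul_log_freeZ_le hg hq)
  obtain ⟨C, hC⟩ := hH.exists_freeZ_le
  have hL' : L ≤ ENNReal.ofReal C := by
    refine le_of_tendsto hL ?_
    filter_upwards [eventually_gt_atTop 0] with n hn
    rw [← vol_cube, ← ENNReal.ofReal_div_of_pos (vol_cube_pos d hn)]
    refine ENNReal.ofReal_le_ofReal ((div_le_iff₀ (vol_cube_pos d hn)).2 ?_)
    refine (hH.log_freeZ_le_log (hC _) ENNReal.ofReal_ne_top).trans ?_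
    rw [ENNReal.toReal_ofReal (Real.exp_pos _).le, Real.log_exp, mul_comm]
  refine ⟨L.toReal, ((ENNReal.tendsto_toReal
    (ne_top_of_le_ne_top ENNReal.ofReal_ne_top hL')).comp hL).congr fun n => ?_⟩
  rw [Function.comp_apply, ENNReal.toReal_div, ENNReal.toReal_ofReal (hH.log_freeZ_nonneg _),
    ENNReal.toReal_ofReal (by positivity), vol_cube]

lemma partitionFn_emptyConfig (hH : IsAdmissible H R) (Λ : Window d) :
    partitionFn H R Λ (emptyConfig d) = ∫⁻ ω, boltz H Λ ω ∂poisson Λ := by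
  rw [partitionFn]
  refine lintegral_congr fun η => ?_
  have hinside : finRestrict (Λ.thicken R) (glue Λ η (emptyConfig d)) = finRestrict Λ η :=
    finRestrict_congr fun x => by
      have := @subset_thicken d Λ R x
      simp only [mem_glue, notMem_emptyConfig, false_and, or_false]
      tauto
  have houtside : H (finRestrict ((Λ.thicken R).diff Λ) (glue Λ η (emptyConfig d))) = 0 := by
    refine hH.map_eq_zero (Set.eq_empty_iff_forall_notMem.2 ?_)
    rintro x ⟨hx | hx, hxΛ⟩
    · exact hxΛ.2 hx.2
    · exact hx.1
  rw [localEnergy, energyDiff, hinside, houtside, esub, if_neg (by simp), sub_zero, boltz]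

lemma lintegral_boltz_ne_zero (hH : IsAdmissible H R) (Λ : Window d) :
    ∫⁻ ω, boltz H Λ ω ∂poisson Λ ≠ 0 := by
  rw [lintegral_boltz]
  exact mul_ne_zero (by simpa using Real.exp_pos _)
    (zero_lt_one.trans_le (hH.one_le_freeZ Λ)).ne'

lemma lintegral_boltz_ne_top (hH : IsAdmissible H R) (Λ : Window d) :
    ∫⁻ ω, boltz H Λ ω ∂poisson Λ ≠ ⊤ := by
  rw [lintegral_boltz]
  exact ENNReal.mul_ne_top ENNReal.ofReal_ne_top (hH.freeZ_ne_top Λ)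

lemma logZ_eq (hH : IsAdmissible H R) (Λ : Window d) :
    logZ H Λ = Real.log (freeZ H Λ).toReal - vol Λ := by
  rw [logZ, lintegral_boltz, ENNReal.toReal_mul, ENNReal.toReal_ofReal (Real.exp_pos _).le,
    Real.log_mul (Real.exp_pos _).ne' (hH.toReal_freeZ_pos Λ).ne', Real.log_exp]
  ring

theorem exists_tendsto_logZ (hH : IsAdmissible H R) :
    ∃ p : ℝ, Tendsto (fun n : ℕ => logZ H (cube d n) / vol (cube d n)) atTop (𝓝 p) := by
  obtain ⟨L, hL⟩ := hH.exists_tendsto_log_freeZ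
  refine ⟨L - 1, (hL.sub_const 1).congr' ?_⟩
  filter_upwards [eventually_gt_atTop 0] with n hn
  rw [hH.logZ_eq, sub_div, div_self (vol_cube_pos d hn).ne']

lemma hasPressure (hH : IsAdmissible H R) {p : ℝ}
    (hp : Tendsto (fun n : ℕ => logZ H (cube d n) / vol (cube d n)) atTop (𝓝 p)) :
    HasPressure H R p := by
  refine (EReal.tendsto_coe.2 hp).congr fun n => ?_
  change _ = ENNReal.log (partitionFn H R (cube d n) (emptyConfig d)) / (vol (cube d n) : EReal)
  rw [hH.partitionFn_emptyConfig, ENNReal.log_pos_real (hH.lintegral_boltz_ne_zero _)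
    (hH.lintegral_boltz_ne_top _), ← EReal.coe_div, logZ]

end IsAdmissible

/-! ### Specific entropy -/

lemma IsStationaryFI.integral_shift {P : Measure (Config d)} (hP : IsStationaryFI P)
    {f : Config d → ℝ} (hf : Measurable f) (u : Space d) :
    ∫ ω, f (shift u ω) ∂P = ∫ ω, f ω ∂P := by
  conv_rhs => rw [← hP.stationary u]
  rw [integral_map (measurable_shift u).aemeasurable hf.aestronglyMeasurable]

/-- The law of the restriction to the cube `[-n, n]^d` of a random configuration with law `P`. -/
abbrev cubeLaw (P : Measure (Config d)) (n : ℕ) : Measure (Config d) :=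
  P.map (restrict (cube d n).1)

lemma isProbabilityMeasure_cubeLaw (P : Measure (Config d)) [IsProbabilityMeasure P] (n : ℕ) :
    IsProbabilityMeasure (cubeLaw P n) :=
  Measure.isProbabilityMeasure_map (measurable_restrict (cube d n).2.1).aemeasurable

lemma integral_cubeLaw {P : Measure (Config d)} {n : ℕ} {f : Config d → ℝ} (hf : Measurable f)
    (hloc : IsLocalOn (cube d n).1 f) : ∫ ω, f ω ∂cubeLaw P n = ∫ ω, f ω ∂P := by
  rw [integral_map (measurable_restrict (cube d n).2.1).aemeasurable hf.aestronglyMeasurable]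
  exact integral_congr_ae (ae_of_all _ hloc)

section Blocks

variable {m n g q : ℕ}

lemma integral_sum_shift {P : Measure (Config d)} (hP : IsStationaryFI P)
    (hq : q * (2 * m + g) ≤ 2 * n) {f : Config d → ℝ} (hf : Measurable f)
    (hb : ∃ C, ∀ ω, |f ω| ≤ C) (hloc : IsLocalOn (cube d m).1 f) :
    Integrable (fun ω => ∑ z : Fin d → Fin q, f (shift (-blockCenter n m g z) ω)) (cubeLaw P n) ∧
    ∫ ω, ∑ z : Fin d → Fin q, f (shift (-blockCenter n m g z) ω) ∂cubeLaw P n =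
      (q : ℝ) ^ d * ∫ ω, f ω ∂P := by
  have := hP.prob
  have := isProbabilityMeasure_cubeLaw P n
  obtain ⟨C, hC⟩ := hb
  have hm (u : Space d) : Measurable fun ω => f (shift u ω) := hf.comp (measurable_shift u)
  have hint (u : Space d) : Integrable (fun ω => f (shift u ω)) (cubeLaw P n) :=
    Integrable.of_bound (hm u).aestronglyMeasurable C (ae_of_all _ fun _ => hC _)
  have hterm (z : Fin d → Fin q) :
      ∫ ω, f (shift (-blockCenter n m g z) ω) ∂cubeLaw P n = ∫ ω, f ω ∂P := by
    rw [integral_cubeLaw (hm _)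
      ((hloc.comp_shift_neg (blockCenter n m g z)).mono (block_subset hq z)),
      hP.integral_shift hf]
  refine ⟨integrable_finsetSum _ fun z _ => hint _, ?_⟩
  simp [integral_finsetSum _ fun z _ => hint (-blockCenter n m g z), hterm]

lemma lintegral_prod_shift_poisson (hg : 0 < g) (hq : q * (2 * m + g) ≤ 2 * n)
    {W : Config d → ℝ≥0∞} (hW : Measurable W) (hloc : IsLocalOn (cube d m).1 W) :
    ∫⁻ ω, ∏ z : Fin d → Fin q, W (shift (-blockCenter n m g z) ω) ∂poisson (cube d n) =
      (∫⁻ ω, W ω ∂poisson (cube d m)) ^ q ^ d := by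
  have hWm (z : Fin d → Fin q) : Measurable fun ω => W (shift (-blockCenter n m g z) ω) :=
    hW.comp (measurable_shift _)
  rw [lintegral_prod_poisson (B := fun z => block n m g z) (fun _ _ hz => disjoint_block hg hz) hWm
    (fun z => hloc.comp_shift_neg (blockCenter n m g z)) Finset.univ
    (fun z _ => block_subset hq z)]
  have hterm (z : Fin d → Fin q) :
      ∫⁻ ω, W (shift (-blockCenter n m g z) ω) ∂poisson (block n m g z) =
        ∫⁻ ω, W ω ∂poisson (cube d m) := by
    rw [block, lintegral_poisson_translate _ _ (hWm z)]
    simp only [shift_neg_shift]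
  simp [hterm]

lemma pow_mul_integral_le_klDiv_add {P : Measure (Config d)} (hP : IsStationaryFI P)
    (hg : 0 < g) (hq : q * (2 * m + g) ≤ 2 * n)
    (hkl : InformationTheory.klDiv (cubeLaw P n) (poisson (cube d n)) ≠ ⊤)
    {f : Config d → ℝ} (hf : Measurable f) (hb : ∃ C, ∀ ω, |f ω| ≤ C)
    (hloc : IsLocalOn (cube d m).1 f) :
    (q : ℝ) ^ d * ∫ ω, f ω ∂P ≤
      (InformationTheory.klDiv (cubeLaw P n) (poisson (cube d n))).toReal +
        (q : ℝ) ^ d * Real.log (∫ ω, Real.exp (f ω) ∂poisson (cube d m)) := by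
  have := hP.prob
  have := isProbabilityMeasure_cubeLaw P n
  obtain ⟨hint, hsum⟩ := integral_sum_shift hP hq hf hb hloc
  have hexp : Integrable (fun ω => Real.exp (f ω)) (poisson (cube d m)) := by
    obtain ⟨C, hC⟩ := hb
    refine Integrable.of_bound hf.exp.aestronglyMeasurable (Real.exp C) (ae_of_all _ fun ω => ?_)
    rw [Real.norm_eq_abs, Real.abs_exp]
    exact Real.exp_le_exp.2 ((le_abs_self _).trans (hC ω))
  have hpos : 0 < ∫ ω, Real.exp (f ω) ∂poisson (cube d m) := integral_exp_pos hexp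
  set W : Config d → ℝ≥0∞ := fun ω => ENNReal.ofReal (Real.exp (f ω)) with hWdef
  have hW : Measurable W := hf.exp.ennreal_ofReal
  have hlog (ω : Config d) :
      Real.log (∏ z : Fin d → Fin q, W (shift (-blockCenter n m g z) ω)).toReal =
        ∑ z : Fin d → Fin q, f (shift (-blockCenter n m g z) ω) := by
    rw [hWdef, ← ENNReal.ofReal_prod_of_nonneg fun _ _ => (Real.exp_pos _).le, ← Real.exp_sum,
      ENNReal.toReal_ofReal (Real.exp_pos _).le, Real.log_exp]
  have hZ := lintegral_prod_shift_poisson hg hq hW fun ω => by simp only [hWdef, hloc ω]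
  rw [← ofReal_integral_eq_lintegral_ofReal hexp (ae_of_all _ fun _ => (Real.exp_pos _).le)] at hZ
  have hDV := integral_log_le_klDiv_add_log hkl
    (W := fun ω => ∏ z : Fin d → Fin q, W (shift (-blockCenter n m g z) ω))
    (Finset.measurable_fun_prod _ fun z _ => hW.comp (measurable_shift _))
    (by rw [hZ]; exact pow_ne_zero _ (ENNReal.ofReal_pos.2 hpos).ne')
    (by rw [hZ]; exact ENNReal.pow_ne_top ENNReal.ofReal_ne_top)
    (ae_of_all _ fun ω => ⟨Finset.prod_ne_zero_iff.2 fun z _ =>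
      (ENNReal.ofReal_pos.2 (Real.exp_pos _)).ne', ENNReal.prod_ne_top fun z _ =>
      ENNReal.ofReal_ne_top⟩)
    (by simpa only [hlog] using hint)
  simp only [hlog] at hDV
  rwa [hsum, hZ, ENNReal.toReal_pow, ENNReal.toReal_ofReal hpos.le, Real.log_pow,
    Nat.cast_pow] at hDV

theorem block_mul_klDiv_le {P : Measure (Config d)} (hP : IsStationaryFI P)
    (hg : 0 < g) (hq : q * (2 * m + g) ≤ 2 * n) :
    (q : ℝ≥0∞) ^ d * InformationTheory.klDiv (cubeLaw P m) (poisson (cube d m)) ≤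
      InformationTheory.klDiv (cubeLaw P n) (poisson (cube d n)) := by
  have := hP.prob
  have := isProbabilityMeasure_cubeLaw P m
  by_contra! hlt
  set K := InformationTheory.klDiv (cubeLaw P n) (poisson (cube d n))
  have hN0 : (q : ℝ≥0∞) ^ d ≠ 0 := left_ne_zero_of_mul (pos_of_gt hlt).ne'
  have hN : (0 : ℝ) < (q : ℝ) ^ d := by
    have : q ^ d ≠ 0 := by exact_mod_cast hN0
    exact_mod_cast Nat.pos_of_ne_zero this
  have hquot : K / (q : ℝ≥0∞) ^ d <
      InformationTheory.klDiv (cubeLaw P m) (poisson (cube d m)) :=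
    ENNReal.div_lt_of_lt_mul' hlt
  obtain ⟨c, -, hKc, hc⟩ := ENNReal.lt_iff_exists_real_btwn.1 hquot
  obtain ⟨F, hFm, ⟨C, hC⟩, hF⟩ := exists_bounded_of_lt_klDiv hc
  have hG : Measurable fun ω => F (restrict (cube d m).1 ω) :=
    hFm.comp (measurable_restrict (cube d m).2.1)
  have hblock := pow_mul_integral_le_klDiv_add hP hg hq hlt.ne_top hG ⟨C, fun _ => hC _⟩
    (isLocalOn_comp_restrict _ F)
  rw [← integral_map (measurable_restrict (cube d m).2.1).aemeasurable hFm.aestronglyMeasurable,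
    integral_congr_ae (g := fun ω => Real.exp (F ω)) ((ae_poisson_subset (cube d m)).mono
      fun ω hω => by simp only [restrict_of_subset hω])] at hblock
  have hKlt : K.toReal < c * (q : ℝ) ^ d := by
    rw [ENNReal.div_lt_iff (Or.inl hN0) (Or.inl (by finiteness)), ← ENNReal.ofReal_natCast,
      ← ENNReal.ofReal_pow (Nat.cast_nonneg q), ← ENNReal.ofReal_mul' hN.le] at hKc
    exact ENNReal.toReal_lt_of_lt_ofReal hKc
  have := mul_le_mul_of_nonneg_left hF hN.le
  linarith

end Blocks

lemma coe_div_ofReal {v : ℝ} (hv : 0 < v) (a : ℝ≥0∞) :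
    ((a / ENNReal.ofReal v : ℝ≥0∞) : EReal) = (a : EReal) / (v : EReal) := by
  induction a with
  | top =>
    rw [ENNReal.top_div_of_ne_top ENNReal.ofReal_ne_top, EReal.coe_ennreal_top,
      EReal.top_div_of_pos_ne_top (by exact_mod_cast hv) (EReal.coe_ne_top v)]
  | coe a =>
    have hreal : ((a : ℝ≥0∞) / ENNReal.ofReal v) = ENNReal.ofReal ((a : ℝ) / v) := by
      rw [ENNReal.ofReal_div_of_pos hv, ENNReal.ofReal_coe_nnreal]
    rw [hreal, EReal.coe_ennreal_ofReal, max_eq_left (by positivity), EReal.coe_div]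
    rfl

theorem exists_hasSpecificEntropy {P : Measure (Config d)} (hP : IsStationaryFI P) :
    ∃ I : EReal, 0 ≤ I ∧ HasSpecificEntropy P I := by
  obtain ⟨L, hL⟩ := exists_tendsto_of_block_le d 1 one_pos
    (fun n => InformationTheory.klDiv (cubeLaw P n) (poisson (cube d n)))
    fun m n q hq => block_mul_klDiv_le hP one_pos hq
  refine ⟨L, EReal.coe_ennreal_nonneg L, (EReal.tendsto_coe_ennreal.2 hL).congr' ?_⟩
  filter_upwards [eventually_gt_atTop 0] with n hn
  rw [← vol_cube, coe_div_ofReal (vol_cube_pos d hn)]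

/-! ### Mean energy -/

lemma measurableSet_unitCube (d : ℕ) : MeasurableSet (unitCube d) := by
  simp only [unitCube, Set.ofPred_forall]
  exact MeasurableSet.iInter fun i =>
    measurableSet_Icc.preimage (EuclideanSpace.proj (𝕜 := ℝ) i).continuous.measurable

lemma unitCube_subset_cube (d : ℕ) : unitCube d ⊆ (cube d 1).1 := fun x hx i => by
  have := hx i
  simp only [Nat.cast_one]
  exact ⟨by linarith [this.1], this.2⟩

/-- The unit cube as a window. -/
def unitWindow (d : ℕ) : Window d :=
  ⟨unitCube d, measurableSet_unitCube d, (cube d 1).2.2.subset (unitCube_subset_cube d)⟩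

/-- The lower corners of the unit cubes that tile `[-n, n]^d`. -/
def corner (n : ℕ) (z : Fin d → Fin (2 * n)) : Space d :=
  WithLp.toLp 2 fun i => -(n : ℝ) + (z i : ℕ)

lemma exists_mem_translate_corner {n : ℕ} (hn : 0 < n) {x : Space d} (hx : x ∈ (cube d n).1) :
    ∃ z : Fin d → Fin (2 * n), x ∈ ((unitWindow d).translate (corner n z)).1 := by
  refine ⟨fun i => ⟨min ⌊x i + n⌋₊ (2 * n - 1), by lia⟩, fun i => ?_⟩
  have hxi := hx i
  have hfloor := Nat.floor_le (show 0 ≤ x i + n by linarith [hxi.1])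
  have hceil := Nat.lt_floor_add_one (x i + n)
  have hlast : ((2 * n - 1 : ℕ) : ℝ) = 2 * n - 1 := by
    rw [Nat.cast_sub (by lia)]
    push_cast
    ring
  simp only [corner, PiLp.sub_apply, Nat.cast_min, hlast, Set.mem_Icc]
  rcases le_total (⌊x i + n⌋₊ : ℝ) (2 * n - 1) with h | h
  · rw [min_eq_left h]
    constructor <;> linarith
  · rw [min_eq_right h]
    constructor <;> linarith [hxi.2]

lemma count_cube_le_sum {n : ℕ} (hn : 0 < n) (ω : Config d) :
    count (cube d n).1 ω ≤
      ∑ z : Fin d → Fin (2 * n), count ((unitWindow d).translate (corner n z)).1 ω := by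
  have hcover : ω.1 ∩ (cube d n).1 ⊆ ⋃ z ∈ (Finset.univ : Finset (Fin d → Fin (2 * n))),
      (ω.1 ∩ ((unitWindow d).translate (corner n z)).1) := by
    rintro x ⟨hx, hxn⟩
    obtain ⟨z, hz⟩ := exists_mem_translate_corner hn hxn
    exact Set.mem_biUnion (Finset.mem_univ z) ⟨hx, hz⟩
  exact (Set.ncard_le_ncard hcover (Set.Finite.biUnion (Finset.finite_toSet _)
    fun z _ => finite_inter_window ω _)).trans (Finset.set_ncard_biUnion_le _ _)

lemma measurable_natCast_count (Λ : Window d) : Measurable fun ω => (count Λ.1 ω : ℝ≥0∞) :=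
  (measurable_from_top (f := fun k : ℕ => (k : ℝ≥0∞))).comp (measurable_count Λ)

lemma IsStationaryFI.lintegral_count_translate {P : Measure (Config d)} (hP : IsStationaryFI P)
    (Λ : Window d) (u : Space d) :
    ∫⁻ ω, (count (Λ.translate u).1 ω : ℝ≥0∞) ∂P = ∫⁻ ω, (count Λ.1 ω : ℝ≥0∞) ∂P := by
  conv_rhs => rw [← hP.stationary (-u),
    lintegral_map (measurable_natCast_count _) (measurable_shift (-u))]
  simp only [count_shift, neg_neg]

lemma IsStationaryFI.lintegral_count_cube_le {P : Measure (Config d)} (hP : IsStationaryFI P)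
    {n : ℕ} (hn : 0 < n) :
    ∫⁻ ω, (count (cube d n).1 ω : ℝ≥0∞) ∂P ≤
      ENNReal.ofReal (vol (cube d n)) * ∫⁻ ω, (count (unitCube d) ω : ℝ≥0∞) ∂P := calc
  _ ≤ ∫⁻ ω, ∑ z : Fin d → Fin (2 * n),
        (count ((unitWindow d).translate (corner n z)).1 ω : ℝ≥0∞) ∂P :=
    lintegral_mono fun ω => by
      rw [← Nat.cast_sum]
      exact Nat.cast_le.2 (count_cube_le_sum hn ω)
  _ = ((2 * n : ℕ) : ℝ≥0∞) ^ d * ∫⁻ ω, (count (unitCube d) ω : ℝ≥0∞) ∂P := by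
    rw [lintegral_finsetSum _ fun z _ => measurable_natCast_count _]
    simp [hP.lintegral_count_translate, unitWindow]
  _ = _ := by
    rw [vol_cube, ENNReal.ofReal_pow (by positivity), ← ENNReal.ofReal_natCast, Nat.cast_mul,
      Nat.cast_ofNat]

section EIntegral

variable {P : Measure (Config d)} {f : Config d → EReal}

lemma lintegral_ne_top_of_eintegral (h : eintegral P f ≠ ⊤) (h' : eintegral P f ≠ ⊥) :
    ∫⁻ ω, (f ω).toENNReal ∂P ≠ ⊤ ∧ ∫⁻ ω, (-f ω).toENNReal ∂P ≠ ⊤ := by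
  rw [eintegral] at h h'
  have hneg : ∫⁻ ω, (-f ω).toENNReal ∂P ≠ ⊤ := fun hneg => by simp [hneg] at h'
  refine ⟨fun hpos => ?_, hneg⟩
  rw [hpos, ← EReal.coe_ennreal_toReal hneg] at h
  simp at h

lemma ae_ne_top_and_ne_bot (hf : Measurable f) (hpos : ∫⁻ ω, (f ω).toENNReal ∂P ≠ ⊤)
    (hneg : ∫⁻ ω, (-f ω).toENNReal ∂P ≠ ⊤) : ∀ᵐ ω ∂P, f ω ≠ ⊤ ∧ f ω ≠ ⊥ := by
  filter_upwards [ae_lt_top hf.ereal_toENNReal hpos,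
    ae_lt_top (continuous_neg.measurable.comp hf).ereal_toENNReal hneg] with ω hω hω'
  exact ⟨fun h => by simp [h] at hω, fun h => by simp [h] at hω'⟩

lemma toReal_eq_toReal_toENNReal_sub (x : EReal) :
    x.toReal = x.toENNReal.toReal - (-x).toENNReal.toReal := by
  induction x with
  | bot => simp
  | top => simp
  | coe x =>
    rw [← EReal.coe_neg, EReal.toENNReal_of_ne_top (EReal.coe_ne_top _),
      EReal.toENNReal_of_ne_top (EReal.coe_ne_top _), EReal.toReal_coe, EReal.toReal_coe,
      ENNReal.toReal_ofReal', ENNReal.toReal_ofReal', max_zero_sub_max_neg_zero_eq_self]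

lemma integrable_toReal_and_eintegral_eq (hf : Measurable f)
    (hpos : ∫⁻ ω, (f ω).toENNReal ∂P ≠ ⊤) (hneg : ∫⁻ ω, (-f ω).toENNReal ∂P ≠ ⊤) :
    Integrable (fun ω => (f ω).toReal) P ∧
      eintegral P f = ((∫ ω, (f ω).toReal ∂P : ℝ) : EReal) := by
  have hmpos : Measurable fun ω => (f ω).toENNReal := hf.ereal_toENNReal
  have hmneg : Measurable fun ω => (-f ω).toENNReal :=
    (continuous_neg.measurable.comp hf).ereal_toENNReal
  have hipos := integrable_toReal_of_lintegral_ne_top hmpos.aemeasurable hpos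
  have hineg := integrable_toReal_of_lintegral_ne_top hmneg.aemeasurable hneg
  simp only [toReal_eq_toReal_toENNReal_sub]
  refine ⟨hipos.sub hineg, ?_⟩
  rw [integral_sub hipos hineg,
    integral_toReal hmpos.aemeasurable (ae_lt_top hmpos hpos),
    integral_toReal hmneg.aemeasurable (ae_lt_top hmneg hneg), EReal.coe_sub,
    EReal.coe_ennreal_toReal hpos, EReal.coe_ennreal_toReal hneg, eintegral]

end EIntegral

namespace IsAdmissible

variable {H : Energy d} {R : ℝ}

lemma exists_toENNReal_neg_le (hH : IsAdmissible H R) : ∃ A : ℝ, 0 < A ∧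
    ∀ (Λ : Window d) (ω : Config d),
      (-H (finRestrict Λ ω)).toENNReal ≤ ENNReal.ofReal A * (count Λ.1 ω : ℝ≥0∞) := by
  obtain ⟨A, hA0, hA⟩ := hH.stable
  refine ⟨A, hA0, fun Λ ω => ?_⟩
  have hle : -H (finRestrict Λ ω) ≤ ((A * (count Λ.1 ω : ℝ) : ℝ) : EReal) := by
    rw [EReal.neg_le, ← EReal.coe_neg]
    exact hA (finRestrict Λ ω)
  refine (EReal.toENNReal_le_toENNReal hle).trans_eq ?_
  rw [EReal.toENNReal_of_ne_top (EReal.coe_ne_top _), EReal.toReal_coe,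
    ENNReal.ofReal_mul hA0.le, ENNReal.ofReal_natCast]

lemma exists_lintegral_toENNReal_neg_le (hH : IsAdmissible H R) {P : Measure (Config d)}
    (hP : IsStationaryFI P) : ∃ C : ℝ, 0 ≤ C ∧ ∀ n : ℕ, 0 < n →
      ∫⁻ ω, (-H (finRestrict (cube d n) ω)).toENNReal ∂P ≤
        ENNReal.ofReal (vol (cube d n) * C) := by
  obtain ⟨A, hA0, hA⟩ := hH.exists_toENNReal_neg_le
  set ρ := ∫⁻ ω, (count (unitCube d) ω : ℝ≥0∞) ∂P
  refine ⟨A * ρ.toReal, by positivity, fun n hn => ?_⟩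
  calc ∫⁻ ω, (-H (finRestrict (cube d n) ω)).toENNReal ∂P
      ≤ ENNReal.ofReal A * ∫⁻ ω, (count (cube d n).1 ω : ℝ≥0∞) ∂P := by
        rw [← lintegral_const_mul _ (measurable_natCast_count (cube d n))]
        exact lintegral_mono (hA _)
    _ ≤ ENNReal.ofReal A * (ENNReal.ofReal (vol (cube d n)) * ρ) := by
        gcongr
        exact hP.lintegral_count_cube_le hn
    _ = ENNReal.ofReal (vol (cube d n) * (A * ρ.toReal)) := by
        rw [ENNReal.ofReal_mul (vol_nonneg _), ENNReal.ofReal_mul hA0.le,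
          ENNReal.ofReal_toReal hP.intensity.ne]
        ring

lemma meanEnergy_ne_bot (hH : IsAdmissible H R) {P : Measure (Config d)}
    (hP : IsStationaryFI P) {h : EReal} (hh : HasMeanEnergy H P h) : h ≠ ⊥ := by
  obtain ⟨C, hC0, hC⟩ := hH.exists_lintegral_toENNReal_neg_le hP
  suffices hle : ((-C : ℝ) : EReal) ≤ h from ((EReal.bot_lt_coe _).trans_le hle).ne'
  refine ge_of_tendsto hh ?_
  filter_upwards [eventually_gt_atTop 0] with n hn
  have hv := vol_cube_pos d hn
  have hneg : ((∫⁻ ω, (-H (finRestrict (cube d n) ω)).toENNReal ∂P : ℝ≥0∞) : EReal) ≤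
      ((vol (cube d n) * C : ℝ) : EReal) := by
    refine (EReal.coe_ennreal_le_coe_ennreal_iff.2 (hC n hn)).trans_eq ?_
    rw [EReal.coe_ennreal_ofReal, max_eq_left (by positivity)]
  rw [EReal.le_div_iff_mul_le (by exact_mod_cast hv) (EReal.coe_ne_top _), ← EReal.coe_mul,
    neg_mul, mul_comm, EReal.coe_neg, ← zero_sub, eintegral]
  exact EReal.sub_le_sub (EReal.coe_ennreal_nonneg _) hneg

end IsAdmissible

/-! ### Gibbs kernels -/

section Kernel

variable {H : Energy d} (R : ℝ) (Λ : Window d)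

lemma isLocalOn_energy (H : Energy d) (Λ : Window d) :
    IsLocalOn Λ.1 fun ω => H (finRestrict Λ ω) := fun ω =>
  congrArg H (Subtype.ext (restrict_restrict_of_subset subset_rfl ω))

lemma isLocalOn_localEnergy (H : Energy d) :
    IsLocalOn (Λ.thicken R).1 (localEnergy H R Λ) := fun ω =>
  congrArg₂ esub (isLocalOn_energy H (Λ.thicken R) ω)
    ((isLocalOn_energy H ((Λ.thicken R).diff Λ)).mono Set.sdiff_subset ω)

lemma isLocalOn_partitionFn (H : Energy d) :
    IsLocalOn (Λ.thicken R).1 (partitionFn H R Λ) := fun ω =>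
  lintegral_congr fun η => by
    rw [glue_restrict (subset_thicken Λ R), isLocalOn_localEnergy]

lemma isLocalOn_localDensity (H : Energy d) :
    IsLocalOn (Λ.thicken R).1 (localDensity H R Λ) := fun ω => by
  rw [localDensity, isLocalOn_partitionFn, isLocalOn_localEnergy, localDensity]

lemma partitionFn_glue (H : Energy d) (η ξ : Config d) :
    partitionFn H R Λ (glue Λ η ξ) = partitionFn H R Λ ξ := by
  simp only [partitionFn, glue_glue]

lemma measurable_exp_localEnergy (hH : Measurable H) :
    Measurable fun ω => EReal.exp (-localEnergy H R Λ ω) :=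
  measurable_exp_neg (measurable_localEnergy hH R Λ)

lemma measurable_partitionFn (hH : Measurable H) : Measurable (partitionFn H R Λ) :=
  measurable_lintegral_glue Λ (poisson Λ) (measurable_exp_localEnergy R Λ hH)

lemma measurable_localDensity (hH : Measurable H) : Measurable (localDensity H R Λ) :=
  (measurable_exp_localEnergy R Λ hH).div (measurable_partitionFn R Λ hH)

/-- The probability of `A` under the Gibbs distribution in `Λ` with boundary condition `ξ`. -/
def gibbsKernel (H : Energy d) (R : ℝ) (Λ : Window d) (A : Set (Config d)) (ξ : Config d) : ℝ≥0∞ :=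
  ∫⁻ η, A.indicator 1 (glue Λ η ξ) * localDensity H R Λ (glue Λ η ξ) ∂poisson Λ

variable {A : Set (Config d)}

lemma gibbsKernel_eq_div (hH : Measurable H) (hA : MeasurableSet A) (ξ : Config d) :
    gibbsKernel H R Λ A ξ = (∫⁻ η, A.indicator 1 (glue Λ η ξ) *
      EReal.exp (-localEnergy H R Λ (glue Λ η ξ)) ∂poisson Λ) / partitionFn H R Λ ξ := by
  rw [gibbsKernel, div_eq_mul_inv, ← lintegral_mul_const]
  · simp only [localDensity, partitionFn_glue, div_eq_mul_inv, mul_assoc]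
  · exact ((measurable_one.indicator hA).mul (measurable_exp_localEnergy R Λ hH)).comp
      (measurable_glue_left Λ ξ)

lemma gibbsKernel_le_one (hH : Measurable H) (hA : MeasurableSet A) (ξ : Config d) :
    gibbsKernel H R Λ A ξ ≤ 1 := by
  rw [gibbsKernel_eq_div R Λ hH hA]
  refine (ENNReal.div_le_div_right (lintegral_mono fun η => ?_) _).trans
    (ENNReal.div_self_le_one (a := partitionFn H R Λ ξ))
  exact mul_le_of_le_one_left' (Set.indicator_le_self' (fun _ _ => zero_le) _)

lemma gibbsKernel_glue (H : Energy d) (A : Set (Config d)) (η ξ : Config d) :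
    gibbsKernel H R Λ A (glue Λ η ξ) = gibbsKernel H R Λ A ξ := by
  simp only [gibbsKernel, glue_glue]

lemma measurable_gibbsKernel (hH : Measurable H) (hA : MeasurableSet A) :
    Measurable (gibbsKernel H R Λ A) :=
  measurable_lintegral_glue Λ (poisson Λ)
    ((measurable_one.indicator hA).mul (measurable_localDensity R Λ hH))

lemma isLocalOn_gibbsKernel (H : Energy d) {S : Set (Space d)} (hS : (Λ.thicken R).1 ⊆ S)
    (hA : IsLocalOn S (· ∈ A)) : IsLocalOn S (gibbsKernel H R Λ A) := fun ω =>
  lintegral_congr fun η => by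
    classical
    rw [glue_restrict ((subset_thicken Λ R).trans hS), (isLocalOn_localDensity R Λ H).mono hS,
      Set.indicator_apply, Set.indicator_apply]
    exact congrArg (· * _) (if_congr (iff_of_eq (hA _)) rfl rfl)

end Kernel

/-- `U` has mean one under the Gibbs distribution in `Λ` with any boundary condition of locally
finite energy. The defining identity is multiplied by the partition function. -/
def HasCondMeanOne (H : Energy d) (R : ℝ) (Λ : Window d) (U : Config d → ℝ≥0∞) : Prop :=
  ∀ ξ, restrict Λ.1ᶜ ξ ∈ finiteEnergy H →
    ∫⁻ η, U (glue Λ η ξ) * EReal.exp (-localEnergy H R Λ (glue Λ η ξ)) ∂poisson Λ =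
      partitionFn H R Λ ξ

lemma boltz_diff_glue (H : Energy d) (Λ V : Window d) (η ξ : Config d) :
    boltz H (V.diff Λ) (glue Λ η ξ) = boltz H (V.diff Λ) ξ :=
  boltz_congr H fun x => and_congr_left fun hx => by simp [mem_glue, hx.2]

namespace IsAdmissible

variable {H : Energy d} {R : ℝ}

lemma boltz_diff_ne_zero (hH : IsAdmissible H R) {Λ : Window d} {ω : Config d}
    (h : restrict Λ.1ᶜ ω ∈ finiteEnergy H) (V : Window d) : boltz H (V.diff Λ) ω ≠ 0 :=
  boltz_eq_zero_iff.not.2 (hH.diff_lt_top h V).ne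

lemma boltz_glue_eq_mul (hH : IsAdmissible H R) {Λ V : Window d} (hΛ : (Λ.thicken R).1 ⊆ V.1)
    {ξ : Config d} (hξ : restrict Λ.1ᶜ ξ ∈ finiteEnergy H) (η : Config d) :
    boltz H V (glue Λ η ξ) =
      boltz H (V.diff Λ) ξ * EReal.exp (-localEnergy H R Λ (glue Λ η ξ)) := by
  rw [hH.boltz_eq_mul (by rwa [restrict_compl_glue]) hΛ, boltz_diff_glue]

lemma exp_localEnergy_ne_top (hH : IsAdmissible H R) {Λ : Window d} {ω : Config d}
    (h : restrict Λ.1ᶜ ω ∈ finiteEnergy H) : EReal.exp (-localEnergy H R Λ ω) ≠ ⊤ := fun htop => by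
  have hfactor := hH.boltz_eq_mul h (subset_refl (Λ.thicken R).1)
  rw [htop, ENNReal.mul_top (hH.boltz_diff_ne_zero h _)] at hfactor
  exact hH.boltz_ne_top _ _ hfactor

lemma freeZ_le_partitionFn (hH : IsAdmissible H R) {B Λ : Window d}
    (hB : (B.thicken R).1 ⊆ Λ.1) {ω : Config d} (hω : restrict Λ.1ᶜ ω ∈ finiteEnergy H) :
    freeZ H B ≤ ENNReal.ofReal (Real.exp (vol Λ)) * partitionFn H R Λ ω := by
  refine le_trans (le_of_eq ?_) (exp_vol_mul_lintegral_poisson_mono ((subset_thicken B R).trans hB)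
    ((measurable_exp_localEnergy R Λ hH.meas).comp (measurable_glue_left Λ ω)))
  rw [freeZ]
  congr 1
  refine lintegral_congr_ae ?_
  filter_upwards [ae_poisson_subset B] with η hη
  simp only [hH.localEnergy_glue_isolated hB hη hω, boltz]

lemma partitionFn_ne_zero (hH : IsAdmissible H R) {Λ : Window d} {ω : Config d}
    (hω : restrict Λ.1ᶜ ω ∈ finiteEnergy H) : partitionFn H R Λ ω ≠ 0 := fun h => by
  have hle := (hH.one_le_freeZ (emptyWindow d)).trans
    (hH.freeZ_le_partitionFn ((thicken_emptyWindow R).trans_subset (Set.empty_subset _)) hω)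
  simp [h] at hle

lemma exists_exp_localEnergy_glue_le (hH : IsAdmissible H R) {Λ : Window d} {ω : Config d}
    (hω : restrict Λ.1ᶜ ω ∈ finiteEnergy H) :
    ∃ c : ℝ, 1 ≤ c ∧ ∃ K : ℝ≥0∞, K ≠ ⊤ ∧ ∀ η,
      EReal.exp (-localEnergy H R Λ (glue Λ η ω)) ≤ K * ENNReal.ofReal c ^ count Λ.1 η := by
  obtain ⟨A, hA0, hA⟩ := hH.exists_boltz_le
  set V := Λ.thicken R
  set b := boltz H (V.diff Λ) ω
  set c := ENNReal.ofReal (Real.exp A)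
  have hb0 : b ≠ 0 := hH.boltz_diff_ne_zero hω V
  have hbt : b ≠ ⊤ := hH.boltz_ne_top _ _
  have hcount (η : Config d) : count V.1 (glue Λ η ω) = count Λ.1 η + count (V.diff Λ).1 ω := by
    rw [count_glue]
    congr 2
    exact Set.inter_eq_right.2 (subset_thicken Λ R)
  refine ⟨Real.exp A, Real.one_le_exp hA0.le, b⁻¹ * c ^ count (V.diff Λ).1 ω,
    ENNReal.mul_ne_top (ENNReal.inv_ne_top.2 hb0) (ENNReal.pow_ne_top ENNReal.ofReal_ne_top),
    fun η => ?_⟩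
  calc EReal.exp (-localEnergy H R Λ (glue Λ η ω))
      = b⁻¹ * boltz H V (glue Λ η ω) := by
        rw [hH.boltz_glue_eq_mul subset_rfl hω, ← mul_assoc, ENNReal.inv_mul_cancel hb0 hbt,
          one_mul]
    _ ≤ b⁻¹ * c ^ count V.1 (glue Λ η ω) := by
        gcongr
        exact hA V _
    _ = b⁻¹ * c ^ count (V.diff Λ).1 ω * c ^ count Λ.1 η := by
        rw [hcount, pow_add]
        ring

lemma partitionFn_ne_top (hH : IsAdmissible H R) {Λ : Window d} {ω : Config d}
    (hω : restrict Λ.1ᶜ ω ∈ finiteEnergy H) : partitionFn H R Λ ω ≠ ⊤ := by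
  obtain ⟨c, hc, K, hK, hle⟩ := hH.exists_exp_localEnergy_glue_le hω
  refine ne_top_of_le_ne_top (ENNReal.mul_ne_top hK ENNReal.ofReal_ne_top) <|
    calc partitionFn H R Λ ω ≤ ∫⁻ η, K * ENNReal.ofReal c ^ count Λ.1 η ∂poisson Λ :=
          lintegral_mono hle
      _ = K * ∫⁻ η, ENNReal.ofReal c ^ count Λ.1 η ∂poisson Λ :=
          lintegral_const_mul' _ _ hK
      _ ≤ K * ENNReal.ofReal (Real.exp (vol Λ * (c - 1))) := by
          gcongr
          exact lintegral_pow_count_poisson_le Λ hc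

/-! ### The entropy gap -/

lemma lintegral_mul_boltz_glue (hH : IsAdmissible H R) {Λ V : Window d}
    (hΛ : (Λ.thicken R).1 ⊆ V.1) {U : Config d → ℝ≥0∞}
    (hmean : HasCondMeanOne H R Λ U) {ξ : Config d} (hξ : ξ.1 ⊆ (V.diff Λ).1) :
    ∫⁻ η, U (glue Λ η ξ) * boltz H V (glue Λ η ξ) ∂poisson Λ =
      ∫⁻ η, boltz H V (glue Λ η ξ) ∂poisson Λ := by
  by_cases htop : H (finRestrict V ξ) = ⊤
  · have hzero (η : Config d) : boltz H V (glue Λ η ξ) = 0 :=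
      boltz_eq_zero_iff.2 <| hH.eq_top_of_subset (ω := finRestrict V ξ)
        (fun x hx => ⟨Or.inr ⟨hx.1, (hξ hx.1).2⟩, hx.2⟩) htop
    simp only [hzero, mul_zero]
  have hfin : restrict Λ.1ᶜ ξ ∈ finiteEnergy H :=
    hH.finiteEnergy_of_subset Set.inter_subset_left
      (hH.finiteEnergy_of_window (hξ.trans Set.sdiff_subset) (lt_top_iff_ne_top.2 htop))
  simp only [hH.boltz_glue_eq_mul hΛ hfin, mul_left_comm (U _)]
  rw [lintegral_const_mul' _ _ (hH.boltz_ne_top _ _), hmean ξ hfin,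
    lintegral_const_mul' _ _ (hH.boltz_ne_top _ _), partitionFn]

lemma lintegral_mul_boltz_glue_translate (hH : IsAdmissible H R) {Λ C V : Window d} (a : Space d)
    (hΛ : (Λ.thicken R).1 ⊆ C.1) (hC : (C.translate a).1 ⊆ V.1) {U : Config d → ℝ≥0∞}
    (hU : Measurable U) (hmean : HasCondMeanOne H R Λ U) {ξ : Config d}
    (hξ : ξ.1 ⊆ (V.diff (Λ.translate a)).1) :
    ∫⁻ η, U (shift (-a) (glue (Λ.translate a) η ξ)) * boltz H V (glue (Λ.translate a) η ξ)
        ∂poisson (Λ.translate a) =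
      ∫⁻ η, boltz H V (glue (Λ.translate a) η ξ) ∂poisson (Λ.translate a) := by
  set V' := V.translate (-a) with hV'
  have hboltz (θ : Config d) : boltz H V (shift a θ) = boltz H V' θ := by
    rw [← hH.boltz_translate a V' θ]
    exact congrArg (boltz H · _) (Subtype.ext (Set.ext fun x => by simp [hV']))
  have hmb : Measurable fun η => boltz H V (glue (Λ.translate a) η ξ) :=
    (hH.measurable_boltz V).comp (measurable_glue_left _ ξ)
  have hUmb : Measurable fun η => U (shift (-a) (glue (Λ.translate a) η ξ)) *
      boltz H V (glue (Λ.translate a) η ξ) :=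
    ((hU.comp (measurable_shift _)).comp (measurable_glue_left _ ξ)).mul hmb
  rw [lintegral_poisson_translate a Λ hmb, lintegral_poisson_translate a Λ hUmb]
  simp only [← shift_glue_shift_neg, hboltz, shift_neg_shift]
  refine hH.lintegral_mul_boltz_glue (V := V') (fun x hx => hC ?_) hmean fun x hx => ?_
  · simpa using hΛ hx
  · have := hξ (mem_shift.1 hx)
    simp only [hV', Window.mem_diff, Window.mem_translate] at this ⊢
    simpa using this

theorem lintegral_prod_mul_boltz (hH : IsAdmissible H R) {ι : Type*} (a : ι → Space d)
    {Λ C V : Window d} (hΛ : (Λ.thicken R).1 ⊆ C.1)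
    (hdisj : ∀ i j, i ≠ j → Disjoint (C.translate (a i)).1 (C.translate (a j)).1)
    {U : Config d → ℝ≥0∞} (hU : Measurable U) (hloc : IsLocalOn C.1 U)
    (hmean : HasCondMeanOne H R Λ U) (J : Finset ι) (hJ : ∀ i ∈ J, (C.translate (a i)).1 ⊆ V.1) :
    ∫⁻ ω, (∏ i ∈ J, U (shift (-a i) ω)) * boltz H V ω ∂poisson V =
      ∫⁻ ω, boltz H V ω ∂poisson V := by
  classical
  induction J using Finset.induction_on with
  | empty => simp
  | insert i J hi ih =>
    have hUm (j : ι) : Measurable fun ω => U (shift (-a j) ω) := hU.comp (measurable_shift _)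
    have hprod (J : Finset ι) : Measurable fun ω =>
        (∏ j ∈ J, U (shift (-a j) ω)) * boltz H V ω :=
      (Finset.measurable_fun_prod _ fun j _ => hUm j).mul (hH.measurable_boltz V)
    have hCV := hJ i (Finset.mem_insert_self i J)
    have hsub : (Λ.translate (a i)).1 ⊆ (C.translate (a i)).1 := fun x hx =>
      hΛ (subset_thicken Λ R hx)
    rw [← ih fun j hj => hJ j (Finset.mem_insert_of_mem hj),
      lintegral_poisson_split (hsub.trans hCV) (hprod _),
      lintegral_poisson_split (hsub.trans hCV) (hprod _)]
    refine lintegral_congr_ae ?_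
    filter_upwards [ae_poisson_subset (V.diff (Λ.translate (a i)))] with ξ hξ
    have hother (η : Config d) : ∏ j ∈ J, U (shift (-a j) (glue (Λ.translate (a i)) η ξ)) =
        ∏ j ∈ J, U (shift (-a j) ξ) :=
      Finset.prod_congr rfl fun j hj => (hloc.comp_shift_neg (a j)).congr
        (restrict_glue_of_disjoint
          ((hdisj i j (ne_of_mem_of_not_mem hj hi).symm).mono_left hsub) η ξ)
    have hmb : Measurable fun η => boltz H V (glue (Λ.translate (a i)) η ξ) :=
      (hH.measurable_boltz V).comp (measurable_glue_left _ ξ)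
    have hUmb : Measurable fun η => U (shift (-a i) (glue (Λ.translate (a i)) η ξ)) *
        boltz H V (glue (Λ.translate (a i)) η ξ) :=
      ((hUm i).comp (measurable_glue_left _ ξ)).mul hmb
    simp only [Finset.prod_insert hi, hother]
    rw [lintegral_const_mul _ hmb, ← hH.lintegral_mul_boltz_glue_translate (a i) hΛ hCV hU hmean hξ,
      ← lintegral_const_mul _ hUmb]
    exact lintegral_congr fun η => by ring

end IsAdmissible

/-- The law of `ω` in the cube `[-n, n]^d` has finite entropy and integrable energy. -/
structure HasFiniteFreeEnergy (H : Energy d) (P : Measure (Config d)) (n : ℕ) : Prop where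
  klDiv_ne_top : InformationTheory.klDiv (cubeLaw P n) (poisson (cube d n)) ≠ ⊤
  pos_ne_top : ∫⁻ ω, (H (finRestrict (cube d n) ω)).toENNReal ∂P ≠ ⊤
  neg_ne_top : ∫⁻ ω, (-H (finRestrict (cube d n) ω)).toENNReal ∂P ≠ ⊤

/-- Entropy plus mean energy in the cube `[-n, n]^d`; meaningful under `HasFiniteFreeEnergy`. -/
def cubeFreeEnergy (H : Energy d) (P : Measure (Config d)) (n : ℕ) : ℝ :=
  (InformationTheory.klDiv (cubeLaw P n) (poisson (cube d n))).toReal +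
    ∫ ω, (H (finRestrict (cube d n) ω)).toReal ∂P

lemma integrable_cubeLaw {P : Measure (Config d)} {n : ℕ} {f : Config d → ℝ} (hf : Measurable f)
    (hloc : IsLocalOn (cube d n).1 f) (hint : Integrable f P) : Integrable f (cubeLaw P n) := by
  rw [integrable_map_measure hf.aestronglyMeasurable
    (measurable_restrict (cube d n).2.1).aemeasurable]
  exact hint.congr (ae_of_all _ fun ω => (hloc ω).symm)

lemma ae_cubeLaw {P : Measure (Config d)} {n : ℕ} {p : Config d → Prop}
    (hp : MeasurableSet {ω | p ω}) (hloc : IsLocalOn (cube d n).1 p) (h : ∀ᵐ ω ∂P, p ω) :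
    ∀ᵐ ω ∂cubeLaw P n, p ω :=
  (ae_map_iff (measurable_restrict (cube d n).2.1).aemeasurable hp).2
    (h.mono fun ω hω => (hloc ω).mpr hω)

namespace HasFiniteFreeEnergy

variable {H : Energy d} {P : Measure (Config d)} {n : ℕ}

lemma ae_cubeLaw_ne_top (h : HasFiniteFreeEnergy H P n) (hH : Measurable H) :
    ∀ᵐ ω ∂cubeLaw P n, H (finRestrict (cube d n) ω) ≠ ⊤ := by
  have hE := measurable_energy hH (cube d n)
  exact ae_cubeLaw (hE (measurableSet_singleton ⊤)).compl
    (fun ω => congrArg (· ≠ ⊤) (isLocalOn_energy H (cube d n) ω))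
    ((ae_ne_top_and_ne_bot hE h.pos_ne_top h.neg_ne_top).mono fun _ hω => hω.1)

lemma integrable_cubeLaw_energy (h : HasFiniteFreeEnergy H P n) (hH : Measurable H) :
    Integrable (fun ω => (H (finRestrict (cube d n) ω)).toReal) (cubeLaw P n) := by
  have hE := measurable_energy hH (cube d n)
  exact integrable_cubeLaw hE.ereal_toReal
    (fun ω => congrArg EReal.toReal (isLocalOn_energy H (cube d n) ω))
    (integrable_toReal_and_eintegral_eq hE h.pos_ne_top h.neg_ne_top).1

end HasFiniteFreeEnergy

lemma integral_cubeLaw_energy {H : Energy d} (hH : Measurable H) (P : Measure (Config d)) (n : ℕ) :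
    ∫ ω, (H (finRestrict (cube d n) ω)).toReal ∂cubeLaw P n =
      ∫ ω, (H (finRestrict (cube d n) ω)).toReal ∂P :=
  integral_cubeLaw (measurable_energy hH (cube d n)).ereal_toReal fun ω =>
    congrArg EReal.toReal (isLocalOn_energy H (cube d n) ω)

namespace IsAdmissible

variable {H : Energy d} {R : ℝ}

lemma boltz_eq_ofReal_exp (hH : IsAdmissible H R) {Λ : Window d} {ω : Config d}
    (h : H (finRestrict Λ ω) ≠ ⊤) :
    boltz H Λ ω = ENNReal.ofReal (Real.exp (-(H (finRestrict Λ ω)).toReal)) := by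
  rw [boltz, ← EReal.coe_toReal h (hH.ne_bot _), ← EReal.coe_neg, EReal.exp_coe, EReal.toReal_coe]

lemma prod_ofReal_exp_mul_boltz (hH : IsAdmissible H R) {Λ : Window d} {ω : Config d}
    (h : H (finRestrict Λ ω) ≠ ⊤) {ι : Type*} (J : Finset ι) (f : ι → ℝ) :
    (∏ i ∈ J, ENNReal.ofReal (Real.exp (f i))) * boltz H Λ ω =
      ENNReal.ofReal (Real.exp (∑ i ∈ J, f i - (H (finRestrict Λ ω)).toReal)) := by
  rw [hH.boltz_eq_ofReal_exp h, ← ENNReal.ofReal_prod_of_nonneg fun _ _ => (Real.exp_pos _).le,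
    ← Real.exp_sum, ← ENNReal.ofReal_mul (Real.exp_pos _).le, ← Real.exp_add, sub_eq_add_neg]

/-- Independent copies of the tilt `exp f` in disjoint translates of the cube `[-m, m]^d` leave the
partition function of the large cube unchanged, so each of them is paid for by the entropy. -/
theorem pow_mul_integral_le_cubeFreeEnergy_add_logZ (hH : IsAdmissible H R)
    {P : Measure (Config d)} (hP : IsStationaryFI P) {m n g q : ℕ} (hg : 0 < g)
    (hq : q * (2 * m + g) ≤ 2 * n) {Λ : Window d} (hΛ : (Λ.thicken R).1 ⊆ (cube d m).1)
    {f : Config d → ℝ} (hf : Measurable f) (hb : ∃ C, ∀ ω, |f ω| ≤ C)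
    (hloc : IsLocalOn (cube d m).1 f)
    (hmean : HasCondMeanOne H R Λ fun ω => ENNReal.ofReal (Real.exp (f ω)))
    (hfin : HasFiniteFreeEnergy H P n) :
    (q : ℝ) ^ d * ∫ ω, f ω ∂P ≤ cubeFreeEnergy H P n + logZ H (cube d n) := by
  have := hP.prob
  have := isProbabilityMeasure_cubeLaw P n
  have hEint := hfin.integrable_cubeLaw_energy hH.meas
  obtain ⟨hsint, hsum⟩ := integral_sum_shift hP hq hf hb hloc
  set S : Config d → ℝ := fun ω => ∑ z : Fin d → Fin q, f (shift (-blockCenter n m g z) ω)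
  set W : Config d → ℝ≥0∞ := fun ω => (∏ z : Fin d → Fin q,
    ENNReal.ofReal (Real.exp (f (shift (-blockCenter n m g z) ω)))) * boltz H (cube d n) ω
  have hWS : ∀ᵐ ω ∂cubeLaw P n,
      W ω = ENNReal.ofReal (Real.exp (S ω - (H (finRestrict (cube d n) ω)).toReal)) :=
    (hfin.ae_cubeLaw_ne_top hH.meas).mono fun ω hω => hH.prod_ofReal_exp_mul_boltz hω _ _
  have hlog : (fun ω => Real.log (W ω).toReal) =ᵐ[cubeLaw P n]
      fun ω => S ω - (H (finRestrict (cube d n) ω)).toReal := by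
    filter_upwards [hWS] with ω hω
    rw [hω, ENNReal.toReal_ofReal (Real.exp_pos _).le, Real.log_exp]
  have hZ : ∫⁻ ω, W ω ∂poisson (cube d n) = ∫⁻ ω, boltz H (cube d n) ω ∂poisson (cube d n) :=
    hH.lintegral_prod_mul_boltz (blockCenter n m g) hΛ (fun _ _ hz => disjoint_block hg hz)
      hf.exp.ennreal_ofReal (fun ω => by simp only [hloc ω]) hmean Finset.univ
      fun z _ => block_subset hq z
  have hDV := integral_log_le_klDiv_add_log hfin.klDiv_ne_top (W := W)
    ((Finset.measurable_fun_prod _ fun z _ => hf.exp.ennreal_ofReal.comp (measurable_shift _)).mul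
      (hH.measurable_boltz _))
    (by rw [hZ]; exact hH.lintegral_boltz_ne_zero _) (by rw [hZ]; exact hH.lintegral_boltz_ne_top _)
    (hWS.mono fun ω hω => by
      rw [hω]
      exact ⟨(ENNReal.ofReal_pos.2 (Real.exp_pos _)).ne', ENNReal.ofReal_ne_top⟩)
    ((hsint.sub hEint).congr hlog.symm)
  rw [integral_congr_ae hlog, integral_sub hsint hEint, hsum, hZ,
    integral_cubeLaw_energy hH.meas] at hDV
  rw [cubeFreeEnergy, logZ]
  linarith

end IsAdmissible

/-! ### Resampling -/

section Resampling

variable {H : Energy d} {R : ℝ}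

/-- The law obtained from `P` by resampling the points in `Λ` with the Gibbs kernel. -/
def resample (H : Energy d) (R : ℝ) (Λ : Window d) (P : Measure (Config d)) :
    Measure (Config d) :=
  (((poisson Λ).prod P).withDensity fun z => localDensity H R Λ (glue Λ z.1 z.2)).map
    fun z => glue Λ z.1 z.2

/-- The events depending only on the points in some cube; they generate the `σ`-algebra. -/
def localEvents (d : ℕ) : Set (Set (Config d)) :=
  {A | MeasurableSet A ∧ ∃ n : ℕ, IsLocalOn (cube d n).1 (· ∈ A)}

lemma generateFrom_localEvents (d : ℕ) :
    instMeasurableSpaceConfig d = MeasurableSpace.generateFrom (localEvents d) := by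
  refine le_antisymm (iSup_le fun Λ => ?_) (MeasurableSpace.generateFrom_le fun A hA => hA.1)
  rintro _ ⟨s, -, rfl⟩
  obtain ⟨n, hn⟩ := exists_subset_cube Λ
  refine MeasurableSpace.measurableSet_generateFrom
    ⟨measurable_count Λ trivial, n, fun ω => congrArg (· ∈ s) ?_⟩
  rw [count_restrict (cube d n).2.1]
  exact congrArg (count · ω) (Set.inter_eq_left.2 hn)

lemma isPiSystem_localEvents (d : ℕ) : IsPiSystem (localEvents d) := by
  rintro A ⟨hA, m, hm⟩ B ⟨hB, n, hn⟩ -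
  exact ⟨hA.inter hB, max m n, fun ω => congrArg₂ And
    (hm.mono (cube_mono (le_max_left m n)) ω) (hn.mono (cube_mono (le_max_right m n)) ω)⟩

lemma compl_mem_localEvents {A : Set (Config d)} (hA : A ∈ localEvents d) :
    Aᶜ ∈ localEvents d :=
  ⟨hA.1.compl, hA.2.imp fun _ hm ω => congrArg Not (hm ω)⟩

lemma lintegral_resample (R : ℝ) (Λ : Window d) (hH : Measurable H) (P : Measure (Config d))
    [SFinite P] {F : Config d → ℝ≥0∞} (hF : Measurable F) :
    ∫⁻ ω, F ω ∂resample H R Λ P =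
      ∫⁻ ω, ∫⁻ η, F (glue Λ η ω) * localDensity H R Λ (glue Λ η ω) ∂poisson Λ ∂P := by
  have hd := (measurable_localDensity R Λ hH).comp (measurable_glue Λ)
  have hFg := hF.comp (measurable_glue Λ)
  rw [resample, lintegral_map hF (measurable_glue Λ)]
  refine (lintegral_withDensity_eq_lintegral_mul _ hd hFg).trans ?_
  rw [lintegral_prod_symm _ (hd.mul hFg).aemeasurable]
  simp only [Pi.mul_apply, Function.comp_apply, mul_comm]

lemma resample_apply (R : ℝ) (Λ : Window d) (hH : Measurable H) (P : Measure (Config d))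
    [SFinite P] {A : Set (Config d)} (hA : MeasurableSet A) :
    resample H R Λ P A = ∫⁻ ω, gibbsKernel H R Λ A ω ∂P := by
  rw [← lintegral_indicator_one hA, lintegral_resample R Λ hH P (measurable_one.indicator hA)]
  rfl

namespace IsAdmissible

lemma gibbsKernel_univ (hH : IsAdmissible H R) (Λ : Window d) {ω : Config d}
    (hω : restrict Λ.1ᶜ ω ∈ finiteEnergy H) : gibbsKernel H R Λ Set.univ ω = 1 := by
  rw [gibbsKernel_eq_div R Λ hH.meas MeasurableSet.univ]
  simp only [Set.indicator_univ, Pi.one_apply, one_mul]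
  exact ENNReal.div_self (hH.partitionFn_ne_zero hω) (hH.partitionFn_ne_top hω)

lemma localDensity_ne_top (hH : IsAdmissible H R) {Λ : Window d} {ω : Config d}
    (hω : restrict Λ.1ᶜ ω ∈ finiteEnergy H) : localDensity H R Λ ω ≠ ⊤ :=
  ENNReal.div_ne_top (hH.exp_localEnergy_ne_top hω) (hH.partitionFn_ne_zero hω)

lemma restrict_mem_finiteEnergy (hH : IsAdmissible H R) {ω : Config d} (h : ω ∈ finiteEnergy H)
    (S : Set (Space d)) : restrict S ω ∈ finiteEnergy H :=
  hH.finiteEnergy_of_subset Set.inter_subset_left h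

variable {P : Measure (Config d)}

lemma isProbabilityMeasure_resample (hH : IsAdmissible H R) (Λ : Window d) [IsProbabilityMeasure P]
    (hfin : ∀ᵐ ω ∂P, ω ∈ finiteEnergy H) : IsProbabilityMeasure (resample H R Λ P) where
  measure_univ := by
    rw [resample_apply R Λ hH.meas P MeasurableSet.univ, lintegral_congr_ae
      (hfin.mono fun ω hω => hH.gibbsKernel_univ Λ (hH.restrict_mem_finiteEnergy hω _))]
    simp

lemma integral_resample (hH : IsAdmissible H R) (Λ : Window d) [IsProbabilityMeasure P]
    (hfin : ∀ᵐ ω ∂P, ω ∈ finiteEnergy H) {g : Config d → ℝ} (hg : Measurable g)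
    (hb : ∃ C, ∀ ω, |g ω| ≤ C) :
    ∫ ω, g ω ∂resample H R Λ P = ∫ ω, ∫ η, g (glue Λ η ω) *
      (localDensity H R Λ (glue Λ η ω)).toReal ∂poisson Λ ∂P := by
  have := hH.isProbabilityMeasure_resample Λ hfin
  obtain ⟨C, hC⟩ := hb
  have hglue := measurable_glue Λ
  have hd : Measurable fun z : Config d × Config d => localDensity H R Λ (glue Λ z.1 z.2) :=
    (measurable_localDensity R Λ hH.meas).comp hglue
  have hd_lt_top : ∀ᵐ z ∂(poisson Λ).prod P, localDensity H R Λ (glue Λ z.1 z.2) < ⊤ := by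
    filter_upwards [Measure.quasiMeasurePreserving_snd.ae hfin] with z hz
    refine (hH.localDensity_ne_top ?_).lt_top
    rw [restrict_compl_glue]
    exact hH.restrict_mem_finiteEnergy hz _
  have hint : Integrable g (resample H R Λ P) :=
    Integrable.of_bound hg.aestronglyMeasurable C (ae_of_all _ hC)
  rw [resample, integrable_map_measure hg.aestronglyMeasurable hglue.aemeasurable,
    integrable_withDensity_iff_integrable_smul' hd hd_lt_top] at hint
  rw [resample, integral_map hglue.aemeasurable hg.aestronglyMeasurable,
    integral_withDensity_eq_integral_toReal_smul hd hd_lt_top]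
  simp only [smul_eq_mul, Function.comp_apply] at hint ⊢
  rw [integral_prod_symm _ hint]
  simp only [mul_comm]

lemma isGibbs_of_resample_eq (hH : IsAdmissible H R) [IsProbabilityMeasure P]
    (hfin : ∀ᵐ ω ∂P, ω ∈ finiteEnergy H)
    (h : ∀ Λ, resample H R Λ P = P) : IsGibbs H R P where
  prob := ‹_›
  finite := hfin
  dlr Λ g hg hb := by rw [← hH.integral_resample Λ hfin hg hb, h Λ]

lemma resample_eq_of_isGibbs (hH : IsAdmissible H R) (hP : IsGibbs H R P) (Λ : Window d) :
    resample H R Λ P = P := by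
  have := hP.prob
  have := hH.isProbabilityMeasure_resample Λ hP.finite
  refine Measure.ext fun A hA => ?_
  have hind : Measurable (A.indicator (1 : Config d → ℝ)) := measurable_one.indicator hA
  have hb (ω : Config d) : |A.indicator (1 : Config d → ℝ) ω| ≤ 1 := by
    by_cases hω : ω ∈ A <;> simp [hω]
  have hdlr := hP.dlr Λ _ hind ⟨1, hb⟩
  rw [← hH.integral_resample Λ hP.finite hind ⟨1, hb⟩, integral_indicator_one hA,
    integral_indicator_one hA] at hdlr
  exact ((measureReal_eq_measureReal_iff).1 hdlr).symm

end IsAdmissible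

end Resampling

/-! ### Minimizers of the free energy are Gibbs measures -/

/-- Equality in the variational principle: the entropy, mean energy and logarithmic partition
function of the cubes are eventually finite and add up to `o(volume)`. -/
structure IsFreeEnergyMinimizer (H : Energy d) (P : Measure (Config d)) : Prop where
  eventually_finite : ∀ᶠ n : ℕ in atTop, HasFiniteFreeEnergy H P n
  tendsto : Tendsto (fun n : ℕ => (cubeFreeEnergy H P n + logZ H (cube d n)) / vol (cube d n))
    atTop (𝓝 0)

/-- The deviation of the indicator of `A` from its conditional probability under the Gibbs
distribution in `Λ`. -/
def condDeviation (H : Energy d) (R : ℝ) (Λ : Window d) (A : Set (Config d)) (ω : Config d) : ℝ :=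
  A.indicator 1 ω - (gibbsKernel H R Λ A ω).toReal

section CondDeviation

variable {H : Energy d} (R : ℝ) (Λ : Window d) {A : Set (Config d)}

lemma toReal_gibbsKernel_le_one (hH : Measurable H) (hA : MeasurableSet A) (ω : Config d) :
    (gibbsKernel H R Λ A ω).toReal ≤ 1 :=
  ENNReal.toReal_mono ENNReal.one_ne_top (gibbsKernel_le_one R Λ hH hA ω)

lemma abs_condDeviation_le_one (hH : Measurable H) (hA : MeasurableSet A) (ω : Config d) :
    |condDeviation H R Λ A ω| ≤ 1 := by
  have hle := toReal_gibbsKernel_le_one R Λ hH hA ω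
  have hnonneg : 0 ≤ (gibbsKernel H R Λ A ω).toReal := ENNReal.toReal_nonneg
  rw [condDeviation, abs_le]
  by_cases hω : ω ∈ A
  · simp only [Set.indicator_of_mem hω, Pi.one_apply]
    constructor <;> linarith
  · simp only [Set.indicator_of_notMem hω]
    constructor <;> linarith

lemma measurable_condDeviation (hH : Measurable H) (hA : MeasurableSet A) :
    Measurable (condDeviation H R Λ A) :=
  (measurable_one.indicator hA).sub (measurable_gibbsKernel R Λ hH hA).ennreal_toReal

lemma isLocalOn_condDeviation (H : Energy d) {S : Set (Space d)} (hS : (Λ.thicken R).1 ⊆ S)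
    (hA : IsLocalOn S (· ∈ A)) : IsLocalOn S (condDeviation H R Λ A) := fun ω => by
  classical
  rw [condDeviation, condDeviation, isLocalOn_gibbsKernel R Λ H hS hA ω, Set.indicator_apply,
    Set.indicator_apply, if_congr (iff_of_eq (hA ω)) rfl rfl]
  rfl

lemma integral_condDeviation (hH : Measurable H) (hA : MeasurableSet A) (P : Measure (Config d))
    [IsFiniteMeasure P] :
    ∫ ω, condDeviation H R Λ A ω ∂P = (P A).toReal - (resample H R Λ P A).toReal := by
  have hκ := measurable_gibbsKernel R Λ hH hA
  have hind : Integrable (A.indicator (1 : Config d → ℝ)) P :=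
    (integrable_const (1 : ℝ)).indicator hA
  have hκint : Integrable (fun ω => (gibbsKernel H R Λ A ω).toReal) P :=
    Integrable.of_bound hκ.ennreal_toReal.aestronglyMeasurable 1 (ae_of_all _ fun ω => by
      rw [Real.norm_of_nonneg ENNReal.toReal_nonneg]
      exact toReal_gibbsKernel_le_one R Λ hH hA ω)
  simp only [condDeviation]
  rw [integral_sub hind hκint, integral_indicator_one hA, Measure.real,
    integral_toReal hκ.aemeasurable (ae_of_all _ fun ω =>
      (gibbsKernel_le_one R Λ hH hA ω).trans_lt ENNReal.one_lt_top),
    ← resample_apply R Λ hH P hA]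

/-- The constant density one, perturbed in the direction of a conditionally centred observable. -/
def tilt (H : Energy d) (R : ℝ) (Λ : Window d) (A : Set (Config d)) (t : ℝ) (ω : Config d) : ℝ :=
  1 + t * condDeviation H R Λ A ω

lemma ofReal_tilt_add (hH : Measurable H) (hA : MeasurableSet A) {t : ℝ} (ht0 : 0 ≤ t)
    (ht1 : t ≤ 1) (ω : Config d) :
    ENNReal.ofReal (tilt H R Λ A t ω) + ENNReal.ofReal t * gibbsKernel H R Λ A ω =
      1 + ENNReal.ofReal t * A.indicator 1 ω := by
  have hnonneg : 0 ≤ tilt H R Λ A t ω := by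
    rw [tilt]
    nlinarith [(abs_le.1 (abs_condDeviation_le_one R Λ hH hA ω)).1]
  have hκ : gibbsKernel H R Λ A ω ≠ ⊤ :=
    ((gibbsKernel_le_one R Λ hH hA ω).trans_lt ENNReal.one_lt_top).ne
  rw [← ENNReal.ofReal_toReal hκ, ← ENNReal.ofReal_mul ht0,
    ← ENNReal.ofReal_add hnonneg (by positivity), tilt, condDeviation]
  by_cases hω : ω ∈ A
  · simp only [Set.indicator_of_mem hω, Pi.one_apply, mul_one]
    rw [← ENNReal.ofReal_one, ← ENNReal.ofReal_add zero_le_one ht0]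
    congr 1
    ring
  · simp only [Set.indicator_of_notMem hω, mul_zero, add_zero]
    rw [← ENNReal.ofReal_one]
    congr 1
    ring

lemma IsAdmissible.hasCondMeanOne_tilt {R : ℝ} (hH : IsAdmissible H R) (Λ : Window d)
    (hA : MeasurableSet A) {t : ℝ} (ht0 : 0 ≤ t) (ht1 : t ≤ 1) :
    HasCondMeanOne H R Λ fun ω => ENNReal.ofReal (tilt H R Λ A t ω) := fun ξ hξ => by
  set κ := gibbsKernel H R Λ A ξ with hκ
  set e := fun η => EReal.exp (-localEnergy H R Λ (glue Λ η ξ))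
  have hκ_ne_top : κ ≠ ⊤ :=
    ((gibbsKernel_le_one R Λ hH.meas hA ξ).trans_lt ENNReal.one_lt_top).ne
  have he : Measurable e :=
    (measurable_exp_localEnergy R Λ hH.meas).comp (measurable_glue_left Λ ξ)
  have hAe : Measurable fun η => A.indicator 1 (glue Λ η ξ) * e η :=
    ((measurable_const.indicator hA).comp (measurable_glue_left Λ ξ)).mul he
  have hκZ : ∫⁻ η, A.indicator 1 (glue Λ η ξ) * e η ∂poisson Λ = κ * partitionFn H R Λ ξ := by
    rw [hκ, gibbsKernel_eq_div R Λ hH.meas hA,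
      ENNReal.div_mul_cancel (hH.partitionFn_ne_zero hξ) (hH.partitionFn_ne_top hξ)]
  have hZ : ∫⁻ η, e η ∂poisson Λ = partitionFn H R Λ ξ := rfl
  have hpointwise (η : Config d) :
      ENNReal.ofReal (tilt H R Λ A t (glue Λ η ξ)) * e η + ENNReal.ofReal t * κ * e η =
        e η + ENNReal.ofReal t * (A.indicator 1 (glue Λ η ξ) * e η) := by
    rw [← add_mul, hκ, ← gibbsKernel_glue R Λ H A η ξ, ofReal_tilt_add R Λ hH.meas hA ht0 ht1,
      add_mul, one_mul, mul_assoc]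
  have hsum := lintegral_congr (μ := poisson Λ) hpointwise
  rw [lintegral_add_right _ (he.const_mul _), lintegral_add_left he, lintegral_const_mul _ he,
    lintegral_const_mul _ hAe, hκZ, hZ, ← mul_assoc] at hsum
  exact (ENNReal.add_left_inj (ENNReal.mul_ne_top
    (ENNReal.mul_ne_top ENNReal.ofReal_ne_top hκ_ne_top) (hH.partitionFn_ne_top hξ))).1 hsum

end CondDeviation

lemma sub_two_mul_sq_le_log_one_add {x : ℝ} (hx : |x| ≤ 1 / 2) :
    x - 2 * x ^ 2 ≤ Real.log (1 + x) := by
  rw [abs_le] at hx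
  have hpos : 0 < 1 + x := by linarith [hx.1]
  have hdiff : 1 - (1 + x)⁻¹ - (x - 2 * x ^ 2) = x ^ 2 * (1 + 2 * x) / (1 + x) := by
    field_simp
    ring
  have hnonneg : 0 ≤ x ^ 2 * (1 + 2 * x) / (1 + x) :=
    div_nonneg (mul_nonneg (sq_nonneg x) (by linarith [hx.1])) hpos.le
  linarith [Real.one_sub_inv_le_log_of_pos hpos]

lemma abs_log_one_add_le_one {x : ℝ} (hx : |x| ≤ 1 / 2) : |Real.log (1 + x)| ≤ 1 := by
  have hlower := sub_two_mul_sq_le_log_one_add hx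
  rw [abs_le] at hx ⊢
  have hupper := Real.log_le_sub_one_of_pos (x := 1 + x) (by linarith [hx.1])
  constructor <;> nlinarith

namespace IsFreeEnergyMinimizer

variable {H : Energy d} {R : ℝ} {P : Measure (Config d)}

lemma integral_nonpos (hmin : IsFreeEnergyMinimizer H P) (hH : IsAdmissible H R)
    (hP : IsStationaryFI P) {m : ℕ} {Λ : Window d} (hΛ : (Λ.thicken R).1 ⊆ (cube d m).1)
    {f : Config d → ℝ} (hf : Measurable f) (hb : ∃ C, ∀ ω, |f ω| ≤ C)
    (hloc : IsLocalOn (cube d m).1 f)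
    (hmean : HasCondMeanOne H R Λ fun ω => ENNReal.ofReal (Real.exp (f ω))) :
    ∫ ω, f ω ∂P ≤ 0 := by
  have hblocks := (tendsto_div_mul_pow d (Nat.succ_pos (2 * m))).mul_const (∫ ω, f ω ∂P)
  have hscaled := hmin.tendsto.mul_const (((2 * m).succ : ℝ) ^ d)
  rw [one_mul] at hblocks
  rw [zero_mul] at hscaled
  refine le_of_tendsto_of_tendsto hblocks hscaled ?_
  filter_upwards [hmin.eventually_finite] with n hn
  have hgap := hH.pow_mul_integral_le_cubeFreeEnergy_add_logZ hP one_pos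
    (Nat.div_mul_le_self (2 * n) (2 * m + 1)) hΛ hf hb hloc hmean hn
  rw [vol_cube, mul_pow, div_pow, mul_right_comm, div_mul_eq_mul_div]
  gcongr
  exact hgap

lemma integral_condDeviation_le (hmin : IsFreeEnergyMinimizer H P) (hH : IsAdmissible H R)
    (hP : IsStationaryFI P) (Λ : Window d) {A : Set (Config d)} (hA : A ∈ localEvents d) {t : ℝ}
    (ht0 : 0 < t) (ht1 : t ≤ 1 / 2) : ∫ ω, condDeviation H R Λ A ω ∂P ≤ 2 * t := by
  have := hP.prob
  obtain ⟨hAmeas, n, hn⟩ := hA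
  obtain ⟨n', hn'⟩ := exists_subset_cube (Λ.thicken R)
  have hΛ := hn'.trans (cube_mono (le_max_right n n'))
  have hDloc := isLocalOn_condDeviation R Λ H hΛ (hn.mono (cube_mono (le_max_left n n')))
  have hD := measurable_condDeviation R Λ hH.meas hAmeas
  have hD1 := abs_condDeviation_le_one R Λ hH.meas hAmeas
  have hDint : Integrable (condDeviation H R Λ A) P :=
    Integrable.of_bound hD.aestronglyMeasurable 1 (ae_of_all _ hD1)
  have htD (ω : Config d) : |t * condDeviation H R Λ A ω| ≤ 1 / 2 := by
    rw [abs_mul, abs_of_pos ht0]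
    nlinarith [hD1 ω]
  set f : Config d → ℝ := fun ω => Real.log (tilt H R Λ A t ω)
  have hf : Measurable f := ((hD.const_mul t).const_add 1).log
  have hf1 (ω : Config d) : |f ω| ≤ 1 := abs_log_one_add_le_one (htD ω)
  have hexp (ω : Config d) : Real.exp (f ω) = tilt H R Λ A t ω :=
    Real.exp_log (by rw [tilt]; linarith [(abs_le.1 (htD ω)).1])
  have hfle : ∫ ω, f ω ∂P ≤ 0 := by
    refine hmin.integral_nonpos hH hP hΛ hf ⟨1, hf1⟩ (fun ω => ?_) ?_
    · simp only [f, tilt, hDloc ω]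
    · simp only [hexp]
      exact hH.hasCondMeanOne_tilt Λ hAmeas ht0.le (by linarith)
  have hmono : ∫ ω, (t * condDeviation H R Λ A ω - 2 * t ^ 2) ∂P ≤ ∫ ω, f ω ∂P := by
    refine integral_mono ((hDint.const_mul t).sub (integrable_const _))
      (Integrable.of_bound hf.aestronglyMeasurable 1 (ae_of_all _ hf1)) fun ω => ?_
    refine le_trans ?_ (sub_two_mul_sq_le_log_one_add (htD ω))
    have : condDeviation H R Λ A ω ^ 2 ≤ 1 := (sq_le_one_iff_abs_le_one _).2 (hD1 ω)
    nlinarith [sq_nonneg t]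
  rw [integral_sub (hDint.const_mul t) (integrable_const _), integral_const_mul, integral_const,
    probReal_univ, one_smul] at hmono
  exact le_of_mul_le_mul_left (by linarith : t * _ ≤ t * (2 * t)) ht0

lemma measure_le_resample (hmin : IsFreeEnergyMinimizer H P) (hH : IsAdmissible H R)
    (hP : IsStationaryFI P) (Λ : Window d) {A : Set (Config d)} (hA : A ∈ localEvents d) :
    P A ≤ resample H R Λ P A := by
  have := hP.prob
  have hD : ∫ ω, condDeviation H R Λ A ω ∂P ≤ 0 := by
    refine le_of_forall_pos_le_add fun ε hε => ?_
    have := hmin.integral_condDeviation_le hH hP Λ hA (t := min (ε / 2) (1 / 2)) (by positivity)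
      (min_le_right _ _)
    linarith [min_le_left (ε / 2) (1 / 2)]
  rw [integral_condDeviation R Λ hH.meas hA.1, sub_nonpos] at hD
  refine (ENNReal.toReal_le_toReal (measure_ne_top P A) ?_).1 hD
  rw [resample_apply R Λ hH.meas P hA.1]
  exact ((lintegral_mono fun ω => gibbsKernel_le_one R Λ hH.meas hA.1 ω).trans_lt (by simp)).ne

lemma ae_mem_finiteEnergy (hmin : IsFreeEnergyMinimizer H P) (hH : IsAdmissible H R) :
    ∀ᵐ ω ∂P, ω ∈ finiteEnergy H := by
  obtain ⟨N, hN⟩ := eventually_atTop.1 hmin.eventually_finite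
  have hfin : ∀ᵐ ω ∂P, ∀ n : ℕ, H (finRestrict (cube d (max n N)) ω) ≠ ⊤ := ae_all_iff.2 fun n =>
    have hn := hN (max n N) (le_max_right n N)
    (ae_ne_top_and_ne_bot (measurable_energy hH.meas _) hn.pos_ne_top hn.neg_ne_top).mono
      fun _ hω => hω.1
  filter_upwards [hfin] with ω hω
  exact hH.mem_finiteEnergy_iff.2 fun n => hH.finRestrict_lt_top
    (Set.inter_subset_inter_right _ (cube_mono (le_max_left n N))) (hω n).lt_top

theorem isGibbs (hmin : IsFreeEnergyMinimizer H P) (hH : IsAdmissible H R)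
    (hP : IsStationaryFI P) : IsGibbs H R P := by
  have := hP.prob
  have hfin := hmin.ae_mem_finiteEnergy hH
  refine hH.isGibbs_of_resample_eq hfin fun Λ => ?_
  have := hH.isProbabilityMeasure_resample Λ hfin
  refine (ext_of_generate_finite (localEvents d) (generateFrom_localEvents d)
    (isPiSystem_localEvents d) (fun A hA => ?_) (by simp)).symm
  refine le_antisymm (hmin.measure_le_resample hH hP Λ hA) ?_
  have hcompl := hmin.measure_le_resample hH hP Λ (compl_mem_localEvents hA)
  rw [prob_compl_eq_one_sub hA.1, prob_compl_eq_one_sub hA.1] at hcompl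
  exact (ENNReal.sub_le_sub_iff_left prob_le_one ENNReal.one_ne_top).1 hcompl

end IsFreeEnergyMinimizer

/-! ### The free energy of a Gibbs measure -/

/-- The density at `ω_Λ` of the Poisson law tilted by `exp F`, divided by the local density. Its
mean under a Gibbs measure is at most one. -/
def gibbsRatio (H : Energy d) (R : ℝ) (Λ : Window d) (F : Config d → ℝ) (ω : Config d) : ℝ≥0∞ :=
  ENNReal.ofReal (Real.exp (F (restrict Λ.1 ω) - Real.log (∫ η, Real.exp (F η) ∂poisson Λ))) /
    localDensity H R Λ ω

lemma measurable_boundaryEnergy {H : Energy d} (hH : Measurable H) (R : ℝ) (Λ : Window d) :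
    Measurable (boundaryEnergy H R Λ) := by
  have hloc := measurable_localEnergy hH R Λ
  have hE := measurable_energy hH Λ
  refine Measurable.ite ((hloc (measurableSet_singleton ⊤)).inter (hE (measurableSet_singleton ⊤)))
    measurable_const ?_
  simp only [sub_eq_add_neg]
  exact hloc.add (continuous_neg.measurable.comp hE)

namespace IsAdmissible

variable {H : Energy d} {R : ℝ}

lemma exists_localEnergy_eq_coe (hH : IsAdmissible H R) {ω : Config d} (hω : ω ∈ finiteEnergy H)
    (Λ : Window d) : ∃ e b : ℝ, localEnergy H R Λ ω = e ∧ H (finRestrict Λ ω) = b ∧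
      boundaryEnergy H R Λ ω = ((e - b : ℝ) : EReal) := by
  have hesub (x y : ℝ) : esub x y = ((x - y : ℝ) : EReal) := by
    rw [esub, if_neg (by simp), EReal.coe_sub]
  have hreal (V : Window d) : ∃ x : ℝ, H (finRestrict V ω) = x :=
    ⟨_, (EReal.coe_toReal (hω V).ne (hH.ne_bot _)).symm⟩
  obtain ⟨x, hx⟩ := hreal (Λ.thicken R)
  obtain ⟨y, hy⟩ := hreal ((Λ.thicken R).diff Λ)
  obtain ⟨b, hb⟩ := hreal Λ
  have he : localEnergy H R Λ ω = ((x - y : ℝ) : EReal) := by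
    rw [localEnergy, energyDiff, hx, hy, hesub]
  exact ⟨x - y, b, he, hb, by rw [boundaryEnergy, he, hb, hesub]⟩

lemma measurable_gibbsRatio (hH : IsAdmissible H R) (Λ : Window d) {F : Config d → ℝ}
    (hF : Measurable F) : Measurable (gibbsRatio H R Λ F) :=
  ((hF.comp (measurable_restrict Λ.2.1)).sub_const _).exp.ennreal_ofReal.div
    (measurable_localDensity R Λ hH.meas)

lemma lintegral_gibbsRatio_le_one (hH : IsAdmissible H R) {P : Measure (Config d)}
    (hG : IsGibbs H R P) (Λ : Window d) {F : Config d → ℝ} (hF : Measurable F)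
    (hint : Integrable (fun ω => Real.exp (F ω)) (poisson Λ)) :
    ∫⁻ ω, gibbsRatio H R Λ F ω ∂P ≤ 1 := by
  have := hG.prob
  set z := ∫ ω, Real.exp (F ω) ∂poisson Λ with hz
  have hpos : 0 < z := integral_exp_pos hint
  have hkernel (ω : Config d) : ∫⁻ η, gibbsRatio H R Λ F (glue Λ η ω) *
      localDensity H R Λ (glue Λ η ω) ∂poisson Λ ≤ 1 := calc
    _ ≤ ∫⁻ η, ENNReal.ofReal (Real.exp (F η) * Real.exp (-Real.log z)) ∂poisson Λ := by
      refine lintegral_mono_ae ?_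
      filter_upwards [ae_poisson_subset Λ] with η hη
      rw [gibbsRatio, restrict_glue_of_subset subset_rfl, restrict_of_subset hη,
        ← Real.exp_add, ← sub_eq_add_neg, div_eq_mul_inv, mul_assoc]
      exact mul_le_of_le_one_right zero_le (ENNReal.inv_mul_le_one _)
    _ = 1 := by
      rw [← ofReal_integral_eq_lintegral_ofReal (hint.mul_const _)
        (ae_of_all _ fun _ => by positivity), integral_mul_const, Real.exp_neg,
        Real.exp_log hpos, ← hz, mul_inv_cancel₀ hpos.ne', ENNReal.ofReal_one]
  calc ∫⁻ ω, gibbsRatio H R Λ F ω ∂P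
      = ∫⁻ ω, gibbsRatio H R Λ F ω ∂resample H R Λ P := by rw [hH.resample_eq_of_isGibbs hG Λ]
    _ ≤ ∫⁻ _, 1 ∂P := by
        rw [lintegral_resample R Λ hH.meas P (hH.measurable_gibbsRatio Λ hF)]
        exact lintegral_mono hkernel
    _ = 1 := by simp

lemma toReal_gibbsRatio (hH : IsAdmissible H R) {ω : Config d} (hω : ω ∈ finiteEnergy H)
    (Λ : Window d) (F : Config d → ℝ) {e : ℝ} (he : localEnergy H R Λ ω = e) :
    (gibbsRatio H R Λ F ω).toReal =
      Real.exp (F (restrict Λ.1 ω) - Real.log (∫ η, Real.exp (F η) ∂poisson Λ) + e +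
        Real.log (partitionFn H R Λ ω).toReal) := by
  have hr := hH.restrict_mem_finiteEnergy hω Λ.1ᶜ
  have hZ : 0 < (partitionFn H R Λ ω).toReal :=
    ENNReal.toReal_pos (hH.partitionFn_ne_zero hr) (hH.partitionFn_ne_top hr)
  rw [gibbsRatio, localDensity, he, ← EReal.coe_neg, EReal.exp_coe, ENNReal.toReal_div,
    ENNReal.toReal_div, ENNReal.toReal_ofReal (Real.exp_pos _).le,
    ENNReal.toReal_ofReal (Real.exp_pos _).le, Real.exp_add, Real.exp_add, Real.exp_log hZ,
    Real.exp_neg]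
  field_simp

lemma log_freeZ_sub_vol_le (hH : IsAdmissible H R) {B Λ : Window d}
    (hB : (B.thicken R).1 ⊆ Λ.1) {ω : Config d} (hω : ω ∈ finiteEnergy H) :
    Real.log (freeZ H B).toReal - vol Λ ≤ Real.log (partitionFn H R Λ ω).toReal := by
  have hr := hH.restrict_mem_finiteEnergy hω Λ.1ᶜ
  have hZt := hH.partitionFn_ne_top hr
  have hZ : 0 < (partitionFn H R Λ ω).toReal := ENNReal.toReal_pos (hH.partitionFn_ne_zero hr) hZt
  have hlog := hH.log_freeZ_le_log (hH.freeZ_le_partitionFn hB hr)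
    (ENNReal.mul_ne_top ENNReal.ofReal_ne_top hZt)
  rw [ENNReal.toReal_mul, ENNReal.toReal_ofReal (Real.exp_pos _).le,
    Real.log_mul (Real.exp_pos _).ne' hZ.ne', Real.log_exp] at hlog
  linarith

lemma add_energy_le_gibbsRatio_sub_one (hH : IsAdmissible H R) {B Λ : Window d}
    (hB : (B.thicken R).1 ⊆ Λ.1) (F : Config d → ℝ) {ω : Config d} (hω : ω ∈ finiteEnergy H) :
    F (restrict Λ.1 ω) - Real.log (∫ η, Real.exp (F η) ∂poisson Λ) +
        (boundaryEnergy H R Λ ω).toReal + (H (finRestrict Λ ω)).toReal +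
        (Real.log (freeZ H B).toReal - vol Λ) ≤ (gibbsRatio H R Λ F ω).toReal - 1 := by
  obtain ⟨e, b, he, hb, hbd⟩ := hH.exists_localEnergy_eq_coe hω Λ
  have hZ := hH.log_freeZ_sub_vol_le hB hω
  have hexp := Real.add_one_le_exp (F (restrict Λ.1 ω) -
    Real.log (∫ η, Real.exp (F η) ∂poisson Λ) + e + Real.log (partitionFn H R Λ ω).toReal)
  rw [hb, hbd, EReal.toReal_coe, EReal.toReal_coe, hH.toReal_gibbsRatio hω Λ F he]
  linarith

variable {P : Measure (Config d)} {B Λ : Window d}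

lemma lintegral_toENNReal_energy_ne_top (hH : IsAdmissible H R) (hG : IsGibbs H R P)
    (hB : (B.thicken R).1 ⊆ Λ.1)
    (hbdry : Integrable (fun ω => (boundaryEnergy H R Λ ω).toReal) P) :
    ∫⁻ ω, (H (finRestrict Λ ω)).toENNReal ∂P ≠ ⊤ := by
  have := hG.prob
  have hle := hH.lintegral_gibbsRatio_le_one hG Λ (F := fun _ => 0) measurable_const
    (integrable_const _)
  have hratio := integrable_toReal_of_lintegral_ne_top
    (hH.measurable_gibbsRatio Λ (F := fun _ => 0) measurable_const).aemeasurable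
    (hle.trans_lt ENNReal.one_lt_top).ne
  have hbound : Integrable (fun ω => (gibbsRatio H R Λ (fun _ => 0) ω).toReal - 1 -
      (boundaryEnergy H R Λ ω).toReal - (Real.log (freeZ H B).toReal - vol Λ)) P :=
    ((hratio.sub (integrable_const 1)).sub hbdry).sub (integrable_const _)
  refine (lt_of_le_of_lt (lintegral_mono_ae ?_) hbound.lintegral_lt_top).ne
  filter_upwards [hG.finite] with ω hω
  have hpt := hH.add_energy_le_gibbsRatio_sub_one hB (fun _ => 0) hω
  simp only [Real.exp_zero, integral_const, probReal_univ, smul_eq_mul, mul_one, Real.log_one,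
    sub_zero] at hpt
  rw [EReal.toENNReal_of_ne_top (hω Λ).ne]
  exact ENNReal.ofReal_le_ofReal (by linarith)

lemma integral_sub_log_integral_exp_le (hH : IsAdmissible H R) (hG : IsGibbs H R P)
    (hB : (B.thicken R).1 ⊆ Λ.1)
    (hbdry : Integrable (fun ω => (boundaryEnergy H R Λ ω).toReal) P)
    (henergy : Integrable (fun ω => (H (finRestrict Λ ω)).toReal) P)
    {F : Config d → ℝ} (hF : Measurable F) (hb : ∃ C, ∀ ω, |F ω| ≤ C) :
    ∫ ω, F (restrict Λ.1 ω) ∂P - Real.log (∫ ω, Real.exp (F ω) ∂poisson Λ) ≤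
      -∫ ω, (boundaryEnergy H R Λ ω).toReal ∂P - ∫ ω, (H (finRestrict Λ ω)).toReal ∂P -
        (Real.log (freeZ H B).toReal - vol Λ) := by
  have := hG.prob
  obtain ⟨C, hC⟩ := hb
  have hexp : Integrable (fun ω => Real.exp (F ω)) (poisson Λ) :=
    Integrable.of_bound hF.exp.aestronglyMeasurable (Real.exp C) (ae_of_all _ fun ω => by
      rw [Real.norm_eq_abs, Real.abs_exp]
      exact Real.exp_le_exp.2 ((le_abs_self _).trans (hC ω)))
  have hFint : Integrable (fun ω => F (restrict Λ.1 ω)) P :=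
    Integrable.of_bound (hF.comp (measurable_restrict Λ.2.1)).aestronglyMeasurable C
      (ae_of_all _ fun ω => hC _)
  set c := Real.log (∫ ω, Real.exp (F ω) ∂poisson Λ)
  set K := Real.log (freeZ H B).toReal - vol Λ
  have hsub : Integrable (fun ω => F (restrict Λ.1 ω) - c) P := hFint.sub (integrable_const c)
  have hadd : Integrable (fun ω => F (restrict Λ.1 ω) - c +
      (boundaryEnergy H R Λ ω).toReal) P := hsub.add hbdry
  have hadd' : Integrable (fun ω => F (restrict Λ.1 ω) - c +
      (boundaryEnergy H R Λ ω).toReal + (H (finRestrict Λ ω)).toReal) P := hadd.add henergy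
  have hnonpos : ∫ ω, (F (restrict Λ.1 ω) - c + (boundaryEnergy H R Λ ω).toReal +
      (H (finRestrict Λ ω)).toReal + K) ∂P ≤ 0 :=
    integral_nonpos_of_le_sub_one (hH.measurable_gibbsRatio Λ hF).aemeasurable
      (hH.lintegral_gibbsRatio_le_one hG Λ hF hexp) (hadd'.add (integrable_const K))
      (hG.finite.mono fun ω hω => hH.add_energy_le_gibbsRatio_sub_one hB F hω)
  rw [integral_add hadd' (integrable_const K), integral_add hadd henergy, integral_add hsub hbdry,
    integral_sub hFint (integrable_const c), integral_const, integral_const, probReal_univ,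
    one_smul, one_smul] at hnonpos
  linarith

lemma lintegral_toENNReal_neg_energy_ne_top (hH : IsAdmissible H R) (hP : IsStationaryFI P)
    {n : ℕ} (hn : 0 < n) : ∫⁻ ω, (-H (finRestrict (cube d n) ω)).toENNReal ∂P ≠ ⊤ := by
  obtain ⟨C, -, hC⟩ := hH.exists_lintegral_toENNReal_neg_le hP
  exact ((hC n hn).trans_lt ENNReal.ofReal_lt_top).ne

theorem hasFiniteFreeEnergy_and_cubeFreeEnergy_le (hH : IsAdmissible H R)
    (hP : IsStationaryFI P) (hG : IsGibbs H R P) {n : ℕ} (hn : 0 < n)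
    (hB : (B.thicken R).1 ⊆ (cube d n).1)
    (hbdry : Integrable (fun ω => (boundaryEnergy H R (cube d n) ω).toReal) P) :
    HasFiniteFreeEnergy H P n ∧
      cubeFreeEnergy H P n ≤ -∫ ω, (boundaryEnergy H R (cube d n) ω).toReal ∂P -
        (Real.log (freeZ H B).toReal - vol (cube d n)) := by
  have := hP.prob
  have := isProbabilityMeasure_cubeLaw P n
  have hneg := hH.lintegral_toENNReal_neg_energy_ne_top hP hn
  have hpos := hH.lintegral_toENNReal_energy_ne_top hG hB hbdry
  have henergy := (integrable_toReal_and_eintegral_eq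
    (measurable_energy hH.meas (cube d n)) hpos hneg).1
  set M := -∫ ω, (boundaryEnergy H R (cube d n) ω).toReal ∂P -
    ∫ ω, (H (finRestrict (cube d n) ω)).toReal ∂P -
    (Real.log (freeZ H B).toReal - vol (cube d n))
  have hbound : ∀ F : Config d → ℝ, Measurable F → (∃ C, ∀ ω, |F ω| ≤ C) →
      ∫ ω, F ω ∂cubeLaw P n - Real.log (∫ ω, Real.exp (F ω) ∂poisson (cube d n)) ≤ M := by
    intro F hF hb
    rw [cubeLaw, integral_map (measurable_restrict (cube d n).2.1).aemeasurable
      hF.aestronglyMeasurable]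
    exact hH.integral_sub_log_integral_exp_le hG hB hbdry henergy hF hb
  have hM0 : 0 ≤ M := by simpa using hbound (fun _ => 0) measurable_const ⟨0, by simp⟩
  have hkl := klDiv_le_of_forall_bounded hbound
  refine ⟨⟨ne_top_of_le_ne_top ENNReal.ofReal_ne_top hkl, hpos, hneg⟩, ?_⟩
  have hklM := ENNReal.toReal_mono ENNReal.ofReal_ne_top hkl
  rw [ENNReal.toReal_ofReal hM0] at hklM
  rw [cubeFreeEnergy]
  linarith

lemma neg_logZ_le_cubeFreeEnergy (hH : IsAdmissible H R) (hP : IsStationaryFI P) {n : ℕ}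
    (hfin : HasFiniteFreeEnergy H P n) : -logZ H (cube d n) ≤ cubeFreeEnergy H P n := by
  have hgap := hH.pow_mul_integral_le_cubeFreeEnergy_add_logZ hP (m := 0) (g := 1) (q := 0)
    one_pos (by lia) (Λ := emptyWindow d)
    ((thicken_emptyWindow R).trans_subset (Set.empty_subset _)) (f := fun _ => 0)
    measurable_const ⟨0, by simp⟩ (fun _ => rfl) (fun ξ _ => by simp [partitionFn]) hfin
  simp only [integral_zero, mul_zero] at hgap
  linarith

end IsAdmissible

lemma tendsto_vol_cube_sub_div (d r : ℕ) :
    Tendsto (fun n : ℕ => vol (cube d (n - r)) / vol (cube d n)) atTop (𝓝 1) := by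
  have hone : Tendsto (fun n : ℕ => (1 - (r : ℝ) / n) ^ d) atTop (𝓝 ((1 - 0) ^ d)) :=
    ((tendsto_const_div_atTop_nhds_zero_nat _).const_sub 1).pow d
  rw [sub_zero, one_pow] at hone
  refine hone.congr' ?_
  filter_upwards [eventually_gt_atTop r] with n hn
  have hn' : (0 : ℝ) < n := by exact_mod_cast (Nat.zero_le r).trans_lt hn
  rw [vol_cube, vol_cube, ← div_pow, Nat.cast_sub hn.le]
  congr 1
  field_simp

lemma tendsto_sub_div_vol {a : ℕ → ℝ} {x : ℝ} (r : ℕ)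
    (h : Tendsto (fun n => a n / vol (cube d n)) atTop (𝓝 x)) :
    Tendsto (fun n => a (n - r) / vol (cube d n)) atTop (𝓝 x) := by
  have hmul := (h.comp (tendsto_sub_atTop_nat r)).mul (tendsto_vol_cube_sub_div d r)
  rw [mul_one] at hmul
  refine hmul.congr' ?_
  filter_upwards [eventually_gt_atTop r] with n hn
  have hv := (vol_cube_pos d (Nat.sub_pos_of_lt hn)).ne'
  simp only [Function.comp_apply]
  field_simp

/-! ### The variational principle -/

lemma eventually_ne_top_of_div_vol {a : ℕ → EReal} {x : EReal} (hx : x ≠ ⊤)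
    (h : Tendsto (fun n => a n / (vol (cube d n) : EReal)) atTop (𝓝 x)) :
    ∀ᶠ n in atTop, a n ≠ ⊤ := by
  filter_upwards [h.eventually_ne hx, eventually_gt_atTop 0] with n hne hn ha
  exact hne (by rw [ha, EReal.top_div_of_pos_ne_top (by exact_mod_cast vol_cube_pos d hn)
    (EReal.coe_ne_top _)])

lemma eventually_ne_bot_of_div_vol {a : ℕ → EReal} {x : EReal} (hx : x ≠ ⊥)
    (h : Tendsto (fun n => a n / (vol (cube d n) : EReal)) atTop (𝓝 x)) :
    ∀ᶠ n in atTop, a n ≠ ⊥ := by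
  filter_upwards [h.eventually_ne hx, eventually_gt_atTop 0] with n hne hn ha
  exact hne (by rw [ha, EReal.bot_div_of_pos_ne_top (by exact_mod_cast vol_cube_pos d hn)
    (EReal.coe_ne_top _)])

/-- The free energy per volume of `P` in the cube `[-n, n]^d`; unlike `cubeFreeEnergy` it is
meaningful without finiteness assumptions. -/
def freeEnergyDensity (H : Energy d) (P : Measure (Config d)) (n : ℕ) : EReal :=
  (InformationTheory.klDiv (cubeLaw P n) (poisson (cube d n)) : EReal) /
      (vol (cube d n) : EReal) +
    eintegral P (fun ω => H (finRestrict (cube d n) ω)) / (vol (cube d n) : EReal)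

lemma HasFiniteFreeEnergy.freeEnergyDensity_eq {H : Energy d} {P : Measure (Config d)} {n : ℕ}
    (h : HasFiniteFreeEnergy H P n) (hH : Measurable H) :
    freeEnergyDensity H P n = ((cubeFreeEnergy H P n / vol (cube d n) : ℝ) : EReal) := by
  rw [freeEnergyDensity,
    (integrable_toReal_and_eintegral_eq (measurable_energy hH _) h.pos_ne_top h.neg_ne_top).2,
    ← EReal.coe_ennreal_toReal h.klDiv_ne_top, ← EReal.coe_div, ← EReal.coe_div, ← EReal.coe_add,
    ← add_div, cubeFreeEnergy]

lemma tendsto_freeEnergyDensity {H : Energy d} {P : Measure (Config d)} {I h : EReal}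
    (hI : I ≠ ⊥) (hh : h ≠ ⊥) (hIP : HasSpecificEntropy P I) (hhP : HasMeanEnergy H P h) :
    Tendsto (freeEnergyDensity H P) atTop (𝓝 (I + h)) :=
  (EReal.continuousAt_add (p := (I, h)) (Or.inr hh) (Or.inl hI)).tendsto.comp
    (hIP.prodMk_nhds hhP)

namespace IsAdmissible

variable {H : Energy d} {R : ℝ} {P : Measure (Config d)}

lemma neg_logZ_div_le_freeEnergyDensity (hH : IsAdmissible H R) (hP : IsStationaryFI P) {n : ℕ}
    (hn : 0 < n) :
    ((-(logZ H (cube d n) / vol (cube d n)) : ℝ) : EReal) ≤ freeEnergyDensity H P n := by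
  have hv := vol_cube_pos d hn
  have hv' : (0 : EReal) < (vol (cube d n) : EReal) := by exact_mod_cast hv
  have hneg := hH.lintegral_toENNReal_neg_energy_ne_top hP hn
  by_cases hpos : ∫⁻ ω, (H (finRestrict (cube d n) ω)).toENNReal ∂P = ⊤
  · rw [freeEnergyDensity, eintegral, hpos, ← EReal.coe_ennreal_toReal hneg,
      EReal.coe_ennreal_top, EReal.top_sub_coe,
      EReal.top_div_of_pos_ne_top hv' (EReal.coe_ne_top _), ← coe_div_ofReal hv,
      EReal.add_top_of_ne_bot (EReal.coe_ennreal_ne_bot _)]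
    exact le_top
  by_cases hkl : InformationTheory.klDiv (cubeLaw P n) (poisson (cube d n)) = ⊤
  · rw [freeEnergyDensity, hkl, EReal.coe_ennreal_top,
      EReal.top_div_of_pos_ne_top hv' (EReal.coe_ne_top _),
      (integrable_toReal_and_eintegral_eq (measurable_energy hH.meas _) hpos hneg).2,
      ← EReal.coe_div, EReal.top_add_coe]
    exact le_top
  have hfin : HasFiniteFreeEnergy H P n := ⟨hkl, hpos, hneg⟩
  rw [hfin.freeEnergyDensity_eq hH.meas, EReal.coe_le_coe_iff, ← neg_div]
  exact div_le_div_of_nonneg_right (hH.neg_logZ_le_cubeFreeEnergy hP hfin) hv.le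

lemma hasFiniteFreeEnergy_of_freeEnergy_ne_top (hH : IsAdmissible H R) (hP : IsStationaryFI P)
    {I h : EReal} (hIP : HasSpecificEntropy P I) (hhP : HasMeanEnergy H P h) (hI : 0 ≤ I)
    (hfin : I + h ≠ ⊤) : ∀ᶠ n : ℕ in atTop, HasFiniteFreeEnergy H P n := by
  have hIb : I ≠ ⊥ := ne_bot_of_le_ne_bot EReal.zero_ne_bot hI
  have hhb := hH.meanEnergy_ne_bot hP hhP
  have hIt : I ≠ ⊤ := fun h => hfin (by rw [h, EReal.top_add_of_ne_bot hhb])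
  have hht : h ≠ ⊤ := fun h => hfin (by rw [h, EReal.add_top_of_ne_bot hIb])
  filter_upwards [eventually_ne_top_of_div_vol hIt hIP, eventually_ne_top_of_div_vol hht hhP,
    eventually_ne_bot_of_div_vol hhb hhP] with n hkl htop hbot
  obtain ⟨hpos, hneg⟩ := lintegral_ne_top_of_eintegral htop hbot
  exact ⟨fun h => hkl (EReal.coe_ennreal_eq_top_iff.2 h), hpos, hneg⟩

variable {p : ℝ}

theorem neg_pressure_le (hH : IsAdmissible H R)
    (hp : Tendsto (fun n : ℕ => logZ H (cube d n) / vol (cube d n)) atTop (𝓝 p))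
    (hP : IsStationaryFI P) {x : EReal} (hx : Tendsto (freeEnergyDensity H P) atTop (𝓝 x)) :
    ((-p : ℝ) : EReal) ≤ x := by
  refine le_of_tendsto_of_tendsto (EReal.tendsto_coe.2 hp.neg) hx ?_
  filter_upwards [eventually_gt_atTop 0] with n hn
  exact hH.neg_logZ_div_le_freeEnergyDensity hP hn

theorem isGibbs_of_freeEnergy_eq (hH : IsAdmissible H R)
    (hp : Tendsto (fun n : ℕ => logZ H (cube d n) / vol (cube d n)) atTop (𝓝 p))
    (hP : IsStationaryFI P) {I h : EReal} (hIP : HasSpecificEntropy P I)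
    (hhP : HasMeanEnergy H P h) (hI : 0 ≤ I) (heq : I + h = ((-p : ℝ) : EReal)) :
    IsGibbs H R P := by
  have hfin := hH.hasFiniteFreeEnergy_of_freeEnergy_ne_top hP hIP hhP hI
    (heq ▸ EReal.coe_ne_top _)
  have hfree := tendsto_freeEnergyDensity (ne_bot_of_le_ne_bot EReal.zero_ne_bot hI)
    (hH.meanEnergy_ne_bot hP hhP) hIP hhP
  rw [heq] at hfree
  have hlim : Tendsto (fun n : ℕ => cubeFreeEnergy H P n / vol (cube d n)) atTop (𝓝 (-p)) :=
    EReal.tendsto_coe.1 (hfree.congr' (hfin.mono fun n hn => hn.freeEnergyDensity_eq hH.meas))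
  refine IsFreeEnergyMinimizer.isGibbs ⟨hfin, ?_⟩ hH hP
  simpa only [add_div, neg_add_cancel] using hlim.add hp

lemma tendsto_log_freeZ_sub_vol_div (hH : IsAdmissible H R)
    (hp : Tendsto (fun n : ℕ => logZ H (cube d n) / vol (cube d n)) atTop (𝓝 p)) (r : ℕ) :
    Tendsto (fun n : ℕ => (Real.log (freeZ H (cube d (n - r))).toReal - vol (cube d n)) /
      vol (cube d n)) atTop (𝓝 p) := by
  have hlim := ((tendsto_sub_div_vol r hp).add (tendsto_vol_cube_sub_div d r)).sub_const 1
  rw [add_sub_cancel_right] at hlim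
  refine hlim.congr' ?_
  filter_upwards [eventually_gt_atTop 0] with n hn
  have hv := (vol_cube_pos d hn).ne'
  rw [hH.logZ_eq]
  field_simp
  ring

lemma eventually_integrable_boundaryEnergy (hH : IsAdmissible H R)
    (hb : HasNegligibleBoundary H R P) : ∀ᶠ n : ℕ in atTop,
      Integrable (fun ω => (boundaryEnergy H R (cube d n) ω).toReal) P ∧
      eintegral P (boundaryEnergy H R (cube d n)) =
        ((∫ ω, (boundaryEnergy H R (cube d n) ω).toReal ∂P : ℝ) : EReal) := by
  filter_upwards [eventually_ne_top_of_div_vol EReal.zero_ne_top hb,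
    eventually_ne_bot_of_div_vol EReal.zero_ne_bot hb] with n htop hbot
  obtain ⟨hpos, hneg⟩ := lintegral_ne_top_of_eintegral htop hbot
  exact integrable_toReal_and_eintegral_eq (measurable_boundaryEnergy hH.meas R _) hpos hneg

theorem le_neg_pressure_of_isGibbs (hH : IsAdmissible H R)
    (hp : Tendsto (fun n : ℕ => logZ H (cube d n) / vol (cube d n)) atTop (𝓝 p))
    (hP : IsStationaryFI P) (hG : IsGibbs H R P) (hb : HasNegligibleBoundary H R P) {x : EReal}
    (hx : Tendsto (freeEnergyDensity H P) atTop (𝓝 x)) : x ≤ ((-p : ℝ) : EReal) := by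
  obtain ⟨r, hr⟩ := exists_nat_gt R
  have hint := hH.eventually_integrable_boundaryEnergy hb
  have hboundary : Tendsto (fun n : ℕ =>
      (∫ ω, (boundaryEnergy H R (cube d n) ω).toReal ∂P) / vol (cube d n)) atTop (𝓝 0) :=
    EReal.tendsto_coe.1 (hb.congr' (hint.mono fun n hn => by rw [hn.2, ← EReal.coe_div]))
  have hlim := hboundary.neg.sub (hH.tendsto_log_freeZ_sub_vol_div hp r)
  rw [neg_zero, zero_sub] at hlim
  refine le_of_tendsto_of_tendsto hx (EReal.tendsto_coe.2 hlim) ?_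
  filter_upwards [hint, eventually_gt_atTop 0, eventually_ge_atTop r] with n hn hn0 hnr
  have hB : ((cube d (n - r)).thicken R).1 ⊆ (cube d n).1 := by
    simpa only [Nat.sub_add_cancel hnr] using
      thicken_cube_subset (d := d) (n - r) r hH.range_nonneg hr
  obtain ⟨hfin, hle⟩ := hH.hasFiniteFreeEnergy_and_cubeFreeEnergy_le hP hG hn0 hB hn.1
  rw [hfin.freeEnergyDensity_eq hH.meas, EReal.coe_le_coe_iff, ← neg_div, ← sub_div]
  exact div_le_div_of_nonneg_right hle (vol_nonneg _)

end IsAdmissible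

end GibbsPP

end

theorem theorem1 (d : ℕ) (hd : 1 ≤ d) (H : Energy d) (hmeas : Measurable H)
    (hbot : ∀ ω, H ω ≠ ⊥) (hstat : IsStationaryEnergy H) (hher : IsHereditary H)
    (hnd : IsNonDegenerate H) (hstable : IsStable H)
    (R : ℝ) (hR : 0 ≤ R) (hrange : HasRange H R)
    (hmean : ∀ P : Measure (Config d), IsStationaryFI P → ∃ h : EReal, HasMeanEnergy H P h)
    (hbdry : ∀ P : Measure (Config d), IsStationaryFI P → IsGibbs H R P →
      HasNegligibleBoundary H R P) :
    ∃ p : ℝ, HasPressure H R p ∧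
      ∀ P : Measure (Config d), IsStationaryFI P →
        ∃ I h : EReal, HasSpecificEntropy P I ∧ HasMeanEnergy H P h ∧
          -(p : EReal) ≤ I + h ∧ (I + h = -(p : EReal) ↔ IsGibbs H R P) := by
  have hH : IsAdmissible H R := ⟨hmeas, hstat, hher, hnd.2, hstable, hR, hrange⟩
  obtain ⟨p, hp⟩ := hH.exists_tendsto_logZ
  refine ⟨p, hH.hasPressure hp, fun P hP => ?_⟩
  obtain ⟨I, hI, hIP⟩ := exists_hasSpecificEntropy hP
  obtain ⟨h, hhP⟩ := hmean P hP
  have hfree := tendsto_freeEnergyDensity (ne_bot_of_le_ne_bot EReal.zero_ne_bot hI)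
    (hH.meanEnergy_ne_bot hP hhP) hIP hhP
  have hge := hH.neg_pressure_le hp hP hfree
  rw [← EReal.coe_neg]
  exact ⟨I, h, hIP, hhP, hge, fun heq => hH.isGibbs_of_freeEnergy_eq hp hP hIP hhP hI heq,
    fun hG => le_antisymm (hH.le_neg_pressure_of_isGibbs hp hP hG (hbdry P hP hG) hfree) hge⟩
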